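/- Let $n\ge 2$ be an integer, let $d$ be a real number with $n-2<d\le n$, and let $\mathcal H^d$ be $d$-dimensional Hausdorff measure on $\mathbb R^n$ (normalised so that $\mathcal H^n$ is Lebesgue measure). Let $\Gamma\subset\mathbb R^n$ be a compact $d$-set, i.e. there are constants $0<c_1\le c_2$ with $c_1r^d\le\mathcal H^d(\Gamma\cap B(x,r))\le c_2r^d$ for all $x\in\Gamma$ and $0<r\le1$, where $B(x,r)$ is the closed ball. For $k>0$ let $$\Phi_k(x,y)=\frac{\mathrm i}{4}\Big(\frac{k}{2\pi|x-y|}\Big)^{(n-2)/2}H^{(1)}_{(n-2)/2}(k|x-y|),\qquad x\ne y,$$ be the outgoing fundamental solution of the Helmholtz equation $\Delta u+k^2u=0$ in $\mathbb R^n$, where $H^{(1)}_\nu$ is the Hankel function of the first kind, and let $\mathcal A_k\psi(x)=\int_{\mathbb R^n}\Phi_k(x,y)\psi(y)\,dy$ be the Newtonian potential, extended in the usual way to compactly supported distributions. Let $\gamma:H^1(\mathbb R^n)\to L^2(\Gamma,\mathcal H^d)$ be the trace operator (the continuous extension of $u\mapsto u|_\Gamma$, $u\in\mathcal S(\mathbb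 R^n)$), let $\gamma^*:L^2(\Gamma,\mathcal H^d)\to H^{-1}(\mathbb R^n)$ be its adjoint, so that $\gamma^*\psi$ is the distribution $\varphi\mapsto\int_\Gamma\psi\,\varphi\,d\mathcal H^d$, and let $\chi\in C_0^\infty(\mathbb R^n)$ be equal to $1$ in a neighbourhood of $\Gamma$. Let $$\mathbb A_k:=\gamma\,\chi\,\mathcal A_k\,\gamma^*,$$ which does not depend on the choice of $\chi$, and let $\|\mathbb A_k\|_{L^2}$ be its norm as an operator on $L^2(\Gamma,\mathcal H^d)$. Then $\mathbb A_k$ is a well-defined bounded operator on $L^2(\Gamma,\mathcal H^d)$ for every $k>0$, and, given any $k_0>0$: * if $n\ge3$, there exists $C_1>0$ such that $$\|\mathbb A_k\|_{L^2}\le C_1k^{(n-3)/2},\qquad k\ge k_0;$$ * if $n=2$, there exists $C_2>0$ such that, for $k\ge k_0$, $$\|\mathbb A_k\|_{L^2}\le C_2\begin{cases}k^{-d},&\text{if } d<1/2,\\ k^{-1/2}\log(1+k),&\text{if } d=1/2,\\ k^{-1/2},&\text{if } d>1/2.\end{cases}$$ -/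

import Mathlib

open MeasureTheory Filter Topology Set
open scoped ENNReal ContDiff SchwartzMap FourierTransform

namespace DSetScattering

noncomputable section

/-- Euclidean space `ℝⁿ`. -/
abbrev Eucl (n : ℕ) : Type := EuclideanSpace ℝ (Fin n)

/-- The `d`-dimensional Hausdorff measure `ℋᵈ` on `ℝⁿ`, with the normalising factor
`π ^ (d / 2) / (2 ^ d Γ(d / 2 + 1))` (the volume of the ball of diameter one when `d` is an
integer), for which `ℋⁿ` is Lebesgue measure. Mathlib's `μH[d]` has no such factor. -/
def hausdorff (n : ℕ) (d : ℝ) : Measure (Eucl n) :=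
  ENNReal.ofReal (Real.pi ^ (d / 2) / (2 ^ d * Real.Gamma (d / 2 + 1))) • Measure.hausdorffMeasure d

/-- `F` is a `d`-set (Ahlfors-David `d`-regular): `F` is closed and `ℋᵈ(F ∩ B(x, r))` is
comparable with `r ^ d`, uniformly for `x ∈ F` and `0 < r ≤ 1`, with `B(x, r)` the closed ball. -/
def IsDSet {n : ℕ} (d : ℝ) (F : Set (Eucl n)) : Prop :=
  IsClosed F ∧ ∃ c₁ c₂ : ℝ, 0 < c₁ ∧ c₁ ≤ c₂ ∧
    ∀ x ∈ F, ∀ r : ℝ, 0 < r → r ≤ 1 →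
      ENNReal.ofReal (c₁ * r ^ d) ≤ hausdorff n d (F ∩ Metric.closedBall x r) ∧
      hausdorff n d (F ∩ Metric.closedBall x r) ≤ ENNReal.ofReal (c₂ * r ^ d)

/-- The measure `ℋᵈ` on `Γ`, as a measure on `ℝⁿ`. -/
def surf {n : ℕ} (d : ℝ) (Γ : Set (Eucl n)) : Measure (Eucl n) := (hausdorff n d).restrict Γ

/-- The complex Hilbert space `L²(Γ, ℋᵈ)`. -/
abbrev L2 {n : ℕ} (d : ℝ) (Γ : Set (Eucl n)) : Type := Lp ℂ 2 (surf d Γ)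

/-- The Hankel function of the first kind `H_ν⁽¹⁾(z)`, given for `ν > -1/2` and `z > 0` by Hankel's
integral
`√(2 / (π z)) e^{i (z - ν π / 2 - π / 4)} / Γ(ν + 1/2) ∫₀^∞ e^{-t} t^{ν - 1/2} (1 + i t / (2 z))^{ν - 1/2} dt`
with the principal branch of the power. -/
def hankelOne (ν z : ℝ) : ℂ :=
  (Real.sqrt (2 / (Real.pi * z)) : ℂ)
    * Complex.exp (Complex.I * ((z - ν * Real.pi / 2 - Real.pi / 4 : ℝ) : ℂ))
    / (Real.Gamma (ν + 1 / 2) : ℂ)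
    * ∫ t in Ioi (0 : ℝ), ((Real.exp (-t) * t ^ (ν - 1 / 2) : ℝ) : ℂ)
        * (1 + Complex.I * ((t / (2 * z) : ℝ) : ℂ)) ^ ((ν - 1 / 2 : ℝ) : ℂ)

/-- The outgoing fundamental solution `Φ_k(x, y)`, `x ≠ y`, of the Helmholtz equation
`Δu + k²u = 0` in `ℝⁿ`. -/
def fundSol {n : ℕ} (k : ℝ) (x y : Eucl n) : ℂ :=
  Complex.I / 4 * (((k / (2 * Real.pi * dist x y)) ^ (((n : ℝ) - 2) / 2) : ℝ) : ℂ)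
    * hankelOne (((n : ℝ) - 2) / 2) (k * dist x y)

/-- The acoustic Newtonian potential `𝒜_k f` of a square-integrable function `f` of bounded
support. -/
def newton {n : ℕ} (k : ℝ) (f : Eucl n → ℂ) (x : Eucl n) : ℂ :=
  ∫ y, fundSol k x y * f y

/-- The norm of `H¹(ℝⁿ)`, with value `∞` off `H¹(ℝⁿ)`. The Fourier transform of Mathlib has the
kernel `e^{-2πi x·ξ}`, so `1 + |ξ|²` for the unitary transform with kernel `e^{-i x·ξ}` becomes
`1 + |2πξ|²`. -/
def h1Norm {n : ℕ} (u : Lp ℂ 2 (volume : Measure (Eucl n))) : ℝ≥0∞ :=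
  (∫⁻ ξ, ‖(𝓕 u) ξ‖ₑ ^ 2 * ENNReal.ofReal (1 + (2 * Real.pi * ‖ξ‖) ^ 2)) ^ (1 / 2 : ℝ)

/-- `γ v = η`: the function `v` lies in `H¹(ℝⁿ)` and its trace on `Γ` is `η ∈ L²(Γ, ℋᵈ)`. Here
`γ : H¹(ℝⁿ) → L²(Γ, ℋᵈ)` is the continuous extension of the restriction `φ ↦ φ|_Γ` of
Schwartz functions. -/
def HasTrace {n : ℕ} (d : ℝ) (Γ : Set (Eucl n)) (v : Lp ℂ 2 (volume : Measure (Eucl n)))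
    (η : L2 d Γ) : Prop :=
  ∃ φ : ℕ → 𝓢(Eucl n, ℂ),
    Tendsto (fun j => h1Norm ((φ j).toLp 2 volume - v)) atTop (𝓝 0) ∧
    Tendsto (fun j => eLpNorm (fun x => φ j x - η x) 2 (surf d Γ)) atTop (𝓝 0)

/-- `χ ∈ C₀^∞(ℝⁿ)` with `χ = 1` in a neighbourhood of `Γ`. -/
def IsCutoff {n : ℕ} (Γ : Set (Eucl n)) (χ : Eucl n → ℂ) : Prop :=
  ContDiff ℝ ∞ χ ∧ HasCompactSupport χ ∧ ∀ᶠ x in 𝓝ˢ Γ, χ x = 1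

/-- `γ* ψ`, for `ψ ∈ L²(Γ, ℋᵈ)`, is the distribution `φ ↦ ∫_Γ ψ φ dℋᵈ` (written with the linear
rather than the antilinear pairing), the adjoint of the trace. It has compact support when `Γ` is
compact, and so acts on all smooth `φ`. -/
def adjTrace {n : ℕ} (d : ℝ) (Γ : Set (Eucl n)) (ψ : L2 d Γ) (φ : Eucl n → ℂ) : ℂ :=
  ∫ x, ψ x * φ x ∂(surf d Γ)

/-- `v = χ 𝒜_k (γ* ψ)` as distributions, where `v ∈ L²(ℝⁿ)`. As usual `𝒜_k` (the convolution with
an even kernel) acts on compactly supported distributions by transposition,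
`⟨𝒜_k f, φ⟩ = ⟨f, 𝒜_k φ⟩` for `φ ∈ C₀^∞(ℝⁿ)`; this is the continuous extension of `𝒜_k` from
square-integrable functions of bounded support. -/
def IsCutoffPotential {n : ℕ} (d : ℝ) (Γ : Set (Eucl n)) (k : ℝ) (χ : Eucl n → ℂ) (ψ : L2 d Γ)
    (v : Lp ℂ 2 (volume : Measure (Eucl n))) : Prop :=
  ∀ φ : 𝓢(Eucl n, ℂ), ∫ x, v x * φ x = adjTrace d Γ ψ (newton k (fun y => χ y * φ y))

/-- The bounded operator `T` on `L²(Γ, ℋᵈ)` is `𝔸_k = γ χ 𝒜_k γ*`, for every choice of the cut-off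
`χ`: for all `ψ`, `η` in `L²(Γ, ℋᵈ)`, the function `χ 𝒜_k γ* ψ` is in `H¹(ℝⁿ)` with trace `η` if and
only if `η = T ψ`. -/
def IsAk {n : ℕ} (d : ℝ) (Γ : Set (Eucl n)) (k : ℝ) (T : L2 d Γ →L[ℂ] L2 d Γ) : Prop :=
  ∀ χ : Eucl n → ℂ, IsCutoff Γ χ → ∀ ψ η : L2 d Γ,
    (∃ v, IsCutoffPotential d Γ k χ ψ v ∧ HasTrace d Γ v η) ↔ η = T ψ

end

end DSetScattering

/-! ### Upper regularity and integrals of powers of the distance. -/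

namespace DSetScattering

variable {n : ℕ}

/-! On `Γ` the operator is integration against `Φ_k`, a symmetric kernel, so Schur's test bounds its
norm by the supremum over `x ∈ Γ` of `∫_Γ |Φ_k(x, y)| dℋᵈ(y)` (`exists_schur_operator`). Two things
remain: to estimate this integral, and to show that the integral operator is the operator defined
through the trace.

For the estimate, Hankel's integral gives `|Φ_k| ≤ B k^((n-3)/2) r^(-(n-1)/2) J(k r)` with `r = |x -
y|` and `J` an absolutely convergent integral (`exists_norm_radial_le`). If `n ≥ 3`, then `J(ρ) ≤ C
(1 + ρ^(-(n-3)/2))`, so for bounded `r` and `k ≥ k₀` the kernel is at most a multiple of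
`k^((n-3)/2) r^(-(n-2))`, and this power is integrable over `Γ` uniformly in `x` because `d > n -
2`. If `n = 2`, then `|Φ_k| ≤ B (k r)^(-α)` for every `0 < α ≤ 1/2`. The value `α = 1/2` is the
decay at infinity; a smaller `α` stands in for the logarithmic singularity. For `d > 1/2` the choice
`α = 1/2` is enough. For `d ≤ 1/2` the integral is split at `r = 1/k`: the near part is of order
`k^(-d)`, and the far part is `k^(-1/2)` times `∫ s^(d-3/2) ds` from `1/k` to a bounded radius, up
to a boundary term, which produces the power or the logarithm.

For the identification, the kernel is regularised by replacing `|z|` with `√(|z|² + ε²)`. The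
cut-off potentials then become Schwartz functions, and they converge in `H¹(ℝⁿ)` and in `L²(Γ)`
(`exists_cutoff_potential`). Convergence rests on a weighted Cauchy-Schwarz inequality: a kernel of
size `r^(-a)` maps `L²(μ)` to `L²(ν)` when `μ` is `d`-regular, `ν` is `e`-regular and `2a < d + e`
(`tendsto_eLpNorm_kernel`). The gradient has `a = α + 1` and `e = n`; for `α = n - 2` the condition
reads `d > n - 2`. Uniqueness of the trace comes from the inequality `‖φ‖_{L²(Γ)} ≤ C ‖φ‖_{H¹}`
(`exists_lintegral_trace_le`). -/

/-- The upper half of Ahlfors regularity, for all centres and all radii. -/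
def UpperRegular (d : ℝ) (μ : Measure (Eucl n)) : Prop :=
  ∃ C : ℝ, 0 ≤ C ∧ ∀ (x : Eucl n) (r : ℝ), 0 < r →
    μ (Metric.closedBall x r) ≤ ENNReal.ofReal (C * r ^ d)

theorem surf_univ_lt_top {d : ℝ} {Γ : Set (Eucl n)} (hΓ : IsCompact Γ) (hΓd : IsDSet d Γ) :
    surf d Γ univ < ⊤ := by
  obtain ⟨-, c₁, c₂, -, -, h⟩ := hΓd
  rw [surf, Measure.restrict_apply_univ]
  obtain ⟨t, ht, htf, hcov⟩ := hΓ.finite_cover_balls (e := 1) one_pos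
  have hsub : Γ ⊆ ⋃ x ∈ t, Γ ∩ Metric.closedBall x 1 := by
    intro y hy
    obtain ⟨x, hx, hyx⟩ := mem_iUnion₂.1 (hcov hy)
    exact mem_iUnion₂.2 ⟨x, hx, hy, Metric.ball_subset_closedBall hyx⟩
  refine (measure_mono hsub).trans_lt ?_
  refine measure_biUnion_lt_top htf fun x hx => ?_
  exact (h x (ht hx) 1 one_pos le_rfl).2.trans_lt ENNReal.ofReal_lt_top

/-- A ball of radius `r ≤ 1/2` that meets `Γ` at `z` lies in the ball of radius `2r ≤ 1` about `z`,
where the `d`-set bound applies. For larger `r` the total mass is enough, since `(2r)^d ≥ 1`. -/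
theorem surf_upperRegular {d : ℝ} (hd : 0 ≤ d) {Γ : Set (Eucl n)} (hΓ : IsCompact Γ)
    (hΓd : IsDSet d Γ) : UpperRegular d (surf d Γ) := by
  have hfin := surf_univ_lt_top hΓ hΓd
  obtain ⟨-, c₁, c₂, hc₁, hc, h⟩ := hΓd
  set M := (surf d Γ univ).toReal with hM
  have hM0 : 0 ≤ M := ENNReal.toReal_nonneg
  have hc₂ : 0 < c₂ := hc₁.trans_le hc
  refine ⟨(c₂ + M) * 2 ^ d, by positivity, fun x r hr => ?_⟩
  rcases le_or_gt r (1 / 2) with hr2 | hr2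
  · by_cases hne : (Γ ∩ Metric.closedBall x r).Nonempty
    · obtain ⟨z, hz, hzx⟩ := hne
      have hsub : Metric.closedBall x r ∩ Γ ⊆ Γ ∩ Metric.closedBall z (2 * r) := by
        rintro y ⟨hy, hyΓ⟩
        refine ⟨hyΓ, ?_⟩
        rw [Metric.mem_closedBall] at *
        linarith [dist_triangle_right y z x]
      rw [surf, Measure.restrict_apply Metric.isClosed_closedBall.measurableSet]
      refine (measure_mono hsub).trans ((h z hz (2 * r) (by linarith) (by linarith)).2.trans ?_)
      apply ENNReal.ofReal_le_ofReal
      rw [Real.mul_rpow (by norm_num) hr.le]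
      have : 0 ≤ M * (2 ^ d * r ^ d) := by positivity
      nlinarith
    · rw [not_nonempty_iff_eq_empty] at hne
      rw [surf, Measure.restrict_apply Metric.isClosed_closedBall.measurableSet, inter_comm, hne]
      simp
  · refine (measure_mono (subset_univ _)).trans ?_
    rw [← ENNReal.ofReal_toReal (a := surf d Γ univ) hfin.ne, ← hM]
    apply ENNReal.ofReal_le_ofReal
    rw [mul_assoc, ← Real.mul_rpow (by norm_num) hr.le]
    have : (1 : ℝ) ≤ (2 * r) ^ d := Real.one_le_rpow (by linarith) hd
    nlinarith

theorem volume_upperRegular [NeZero n] : UpperRegular (n : ℝ) (volume : Measure (Eucl n)) := by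
  refine ⟨(volume (Metric.ball (0 : Eucl n) 1)).toReal, ENNReal.toReal_nonneg, fun x r hr => ?_⟩
  rw [Measure.addHaar_closedBall _ _ hr.le, mul_comm, ENNReal.ofReal_mul ENNReal.toReal_nonneg,
    ENNReal.ofReal_toReal measure_ball_lt_top.ne, finrank_euclideanSpace_fin, Real.rpow_natCast]

theorem UpperRegular.restrict {d : ℝ} {μ : Measure (Eucl n)} (h : UpperRegular d μ)
    (s : Set (Eucl n)) : UpperRegular d (μ.restrict s) := by
  obtain ⟨C, hC, h⟩ := h
  exact ⟨C, hC, fun x r hr => (Measure.restrict_apply_le _ _).trans (h x r hr)⟩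

/-- The fundamental theorem of calculus in layer-cake form: a power of the distance becomes a
superposition of indicators of balls. -/
theorem rpow_neg_eq_add_lintegral {a r R : ℝ} (ha : 0 ≤ a) (hr : 0 < r) (hrR : r ≤ R) :
    ENNReal.ofReal (r ^ (-a)) = ENNReal.ofReal (R ^ (-a)) +
      ∫⁻ s in Ioc r R, ENNReal.ofReal (a * s ^ (-a - 1)) := by
  have hR : 0 < R := hr.trans_le hrR
  have hint : IntervalIntegrable (fun s : ℝ => a * s ^ (-a - 1)) volume r R := by
    apply (intervalIntegral.intervalIntegrable_rpow _).const_mul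
    right
    rw [uIcc_of_le hrR]
    exact fun h => absurd h.1 (not_le.2 hr)
  have hint' : IntegrableOn (fun s : ℝ => a * s ^ (-a - 1)) (Ioc r R) :=
    (intervalIntegrable_iff_integrableOn_Ioc_of_le hrR).1 hint
  have hI : ∫ s in r..R, a * s ^ (-a - 1) = r ^ (-a) - R ^ (-a) := by
    rcases ha.eq_or_lt with rfl | ha'
    · simp
    · rw [intervalIntegral.integral_const_mul, integral_rpow]
      · rw [sub_add_cancel]
        field_simp
        ring
      · right
        refine ⟨by linarith, ?_⟩
        rw [uIcc_of_le hrR]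
        exact fun h => absurd h.1 (not_le.2 hr)
  rw [← ofReal_integral_eq_lintegral_ofReal hint', ← intervalIntegral.integral_of_le hrR, hI,
    ← ENNReal.ofReal_add (by positivity)]
  · congr 1; ring
  · have := Real.rpow_le_rpow_of_nonpos hr hrR (neg_nonpos.2 ha)
    linarith
  · filter_upwards [ae_restrict_mem measurableSet_Ioc] with s hs
    have : 0 < s := hr.trans hs.1
    simp only [Pi.zero_apply]
    positivity

/-- Layer cake and Tonelli: only the measure of balls enters. The inner radius survives as the lower
limit of the `s`-integral, which is what later separates `d < a`, `d = a` and `d > a`. -/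
theorem lintegral_annulus_rpow_neg_le {μ : Measure (Eucl n)} [SFinite μ] {C d a r R : ℝ}
    {x : Eucl n} (hC : 0 ≤ C)
    (hμ : ∀ r : ℝ, 0 < r → μ (Metric.closedBall x r) ≤ ENNReal.ofReal (C * r ^ d))
    (ha : 0 ≤ a) (hr : 0 ≤ r) (hR : 0 < R) :
    ∫⁻ y in {y | r < dist x y ∧ dist x y ≤ R}, ENNReal.ofReal (dist x y ^ (-a)) ∂μ ≤
      ENNReal.ofReal (C * R ^ (d - a)) +
        ENNReal.ofReal (a * C) * ∫⁻ s in Ioc r R, ENNReal.ofReal (s ^ (d - a - 1)) := by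
  set A : Set (Eucl n) := {y | r < dist x y ∧ dist x y ≤ R}
  have hA : MeasurableSet A :=
    (measurableSet_lt (f := fun _ => r) (g := fun y => dist x y) (by fun_prop) (by fun_prop)).inter
      (measurableSet_le (f := fun y => dist x y) (g := fun _ => R) (by fun_prop) (by fun_prop))
  have hAR : μ A ≤ ENNReal.ofReal (C * R ^ d) :=
    (measure_mono fun y hy => by rw [Metric.mem_closedBall, dist_comm]; exact hy.2).trans (hμ R hR)
  -- The lower limit `dist x y` depends on `y`; coding it as an indicator gives a product domain, on
  -- which the integrals can be swapped.
  obtain ⟨K, hK⟩ : ∃ K : ℝ × Eucl n → ℝ≥0∞, K = {p : ℝ × Eucl n | dist x p.2 ≤ p.1}.indicator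
    (fun p => ENNReal.ofReal (a * p.1 ^ (-a - 1))) := ⟨_, rfl⟩
  have hpt : ∀ y ∈ A, ENNReal.ofReal (dist x y ^ (-a)) ≤ ENNReal.ofReal (R ^ (-a)) +
      ∫⁻ s in Ioc r R, K (s, y) := by
    intro y hy
    rw [rpow_neg_eq_add_lintegral ha (hr.trans_lt hy.1) hy.2]
    refine add_le_add le_rfl ?_
    calc _ = ∫⁻ s in Ioc (dist x y) R, K (s, y) := by
          refine setLIntegral_congr_fun measurableSet_Ioc fun s hs => ?_
          rw [hK, indicator_of_mem]
          exact hs.1.le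
      _ ≤ _ := lintegral_mono_set (Ioc_subset_Ioc_left hy.1.le)
  have hmeas : Measurable K := by
    rw [hK]
    apply Measurable.indicator (by fun_prop)
    exact measurableSet_le (by fun_prop) (by fun_prop)
  calc _ ≤ ∫⁻ y in A, (ENNReal.ofReal (R ^ (-a)) +
      ∫⁻ s in Ioc r R, K (s, y)) ∂μ := setLIntegral_mono' hA hpt
    _ = ENNReal.ofReal (R ^ (-a)) * μ A + ∫⁻ s in Ioc r R, ∫⁻ y in A,
        K (s, y) ∂μ := by
      rw [lintegral_add_left measurable_const, setLIntegral_const, lintegral_lintegral_swap]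
      exact (hmeas.comp measurable_swap).aemeasurable
    _ ≤ _ := by
      rw [← lintegral_const_mul' _ _ ENNReal.ofReal_ne_top]
      refine add_le_add ?_ ?_
      · refine (mul_le_mul_right hAR _).trans ?_
        rw [← ENNReal.ofReal_mul (by positivity), sub_eq_add_neg, Real.rpow_add hR]
        apply le_of_eq; congr 1; ring
      · refine setLIntegral_mono' measurableSet_Ioc fun s hs => ?_
        have hs0 : 0 < s := hr.trans_lt hs.1
        calc _ ≤ ∫⁻ y in Metric.closedBall x s, ENNReal.ofReal (a * s ^ (-a - 1)) ∂μ := by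
              rw [← lintegral_indicator Metric.isClosed_closedBall.measurableSet]
              refine (lintegral_mono' Measure.restrict_le_self le_rfl).trans ?_
              refine lintegral_mono fun y => ?_
              by_cases hy : dist x y ≤ s
              · rw [hK, indicator_of_mem (by exact hy), indicator_of_mem]
                rwa [Metric.mem_closedBall, dist_comm]
              · rw [hK, indicator_of_notMem (by exact hy)]
                exact zero_le
          _ ≤ ENNReal.ofReal (a * s ^ (-a - 1)) * ENNReal.ofReal (C * s ^ d) := by
              rw [setLIntegral_const]
              gcongr
              exact hμ s hs0
          _ = _ := by
              rw [← ENNReal.ofReal_mul (by positivity), ← ENNReal.ofReal_mul (by positivity)]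
              congr 1
              rw [show d - a - 1 = (-a - 1) + d by ring, Real.rpow_add hs0]
              ring

theorem lintegral_Ioc_rpow_sub_one_le {p r R : ℝ} (hp : 0 < p) (hr : 0 ≤ r) (hR : 0 < R) :
    ∫⁻ s in Ioc r R, ENNReal.ofReal (s ^ (p - 1)) ≤ ENNReal.ofReal (R ^ p / p) := by
  refine (lintegral_mono_set (Ioc_subset_Ioc_left hr)).trans ?_
  have hint : IntegrableOn (fun s : ℝ => s ^ (p - 1)) (Ioc 0 R) :=
    (intervalIntegrable_iff_integrableOn_Ioc_of_le hR.le).1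
      (intervalIntegral.intervalIntegrable_rpow' (by linarith))
  rw [← ofReal_integral_eq_lintegral_ofReal hint, ← intervalIntegral.integral_of_le hR.le,
    integral_rpow (Or.inl (by linarith)), sub_add_cancel, Real.zero_rpow hp.ne', sub_zero]
  filter_upwards [ae_restrict_mem measurableSet_Ioc] with s hs
  exact Real.rpow_nonneg hs.1.le _

theorem lintegral_Ioc_rpow_neg_sub_one_le {p r R : ℝ} (hp : 0 < p) (hr : 0 < r) (hrR : r ≤ R) :
    ∫⁻ s in Ioc r R, ENNReal.ofReal (s ^ (-p - 1)) ≤ ENNReal.ofReal (r ^ (-p) / p) := by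
  have h := rpow_neg_eq_add_lintegral hp.le hr hrR
  rw [div_eq_inv_mul, ENNReal.ofReal_mul (by positivity), h, mul_add]
  refine le_add_left ?_
  rw [← lintegral_const_mul' _ _ ENNReal.ofReal_ne_top]
  refine setLIntegral_mono' measurableSet_Ioc fun s hs => ?_
  rw [← ENNReal.ofReal_mul (by positivity), inv_mul_cancel_left₀ hp.ne']

theorem lintegral_Ioc_inv {r R : ℝ} (hr : 0 < r) (hrR : r ≤ R) :
    ∫⁻ s in Ioc r R, ENNReal.ofReal (s ^ (-1 : ℝ)) = ENNReal.ofReal (Real.log (R / r)) := by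
  have h0 : (0 : ℝ) ∉ uIcc r R := by
    rw [uIcc_of_le hrR]
    exact fun h => absurd h.1 (not_le.2 hr)
  simp only [Real.rpow_neg_one]
  have hint : IntegrableOn (fun s : ℝ => s⁻¹) (Ioc r R) :=
    (intervalIntegrable_iff_integrableOn_Ioc_of_le hrR).1
      (intervalIntegral.intervalIntegrable_inv (fun s hs => ne_of_mem_of_not_mem hs h0)
        continuousOn_id)
  rw [← ofReal_integral_eq_lintegral_ofReal hint, ← intervalIntegral.integral_of_le hrR,
    integral_inv h0]
  filter_upwards [ae_restrict_mem measurableSet_Ioc] with s hs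
  exact inv_nonneg.2 (hr.le.trans hs.1.le)

/-- A `d`-regular measure with `d > 0` has no atoms. -/
theorem UpperRegular.nullSingletonClass {d : ℝ} (hd : 0 < d) {μ : Measure (Eucl n)} (h : UpperRegular d μ) :
    NullSingletonClass μ := by
  obtain ⟨C, hC, h⟩ := h
  refine ⟨fun x => le_antisymm ?_ zero_le⟩
  have hlim : Tendsto (fun r : ℝ => ENNReal.ofReal (C * r ^ d)) (𝓝[>] 0) (𝓝 0) := by
    have : Tendsto (fun r : ℝ => ENNReal.ofReal (C * r ^ d)) (𝓝 0)
        (𝓝 (ENNReal.ofReal (C * 0 ^ d))) :=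
      (ENNReal.continuous_ofReal.comp (continuous_const.mul
        (Real.continuous_rpow_const hd.le))).tendsto 0
    rw [Real.zero_rpow hd.ne', mul_zero, ENNReal.ofReal_zero] at this
    exact this.mono_left nhdsWithin_le_nhds
  refine ge_of_tendsto hlim ?_
  filter_upwards [self_mem_nhdsWithin] with r hr
  exact (measure_mono (by simpa using (le_of_lt hr : (0 : ℝ) ≤ r))).trans (h x r hr)

/-- The annulus bound with inner radius `0`; the centre is negligible because there are no atoms. -/
theorem UpperRegular.exists_lintegral_closedBall_le {d a : ℝ} {μ : Measure (Eucl n)} [SFinite μ]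
    (h : UpperRegular d μ) (ha : 0 ≤ a) (had : a < d) :
    ∃ C : ℝ, 0 ≤ C ∧ ∀ (x : Eucl n) (R : ℝ), 0 < R →
      ∫⁻ y in {y | dist x y ≤ R}, ENNReal.ofReal (dist x y ^ (-a)) ∂μ ≤
        ENNReal.ofReal (C * R ^ (d - a)) := by
  have := h.nullSingletonClass (ha.trans_lt had)
  obtain ⟨C, hC, h⟩ := h
  have hda : 0 < d - a := by linarith
  refine ⟨C + a * C * (d - a)⁻¹, by positivity, fun x R hR => ?_⟩
  have hset : {y | dist x y ≤ R} =ᵐ[μ] {y | 0 < dist x y ∧ dist x y ≤ R} := by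
    have : ∀ᵐ y ∂μ, y ≠ x := by simp [ae_iff]
    filter_upwards [this] with y hy
    have h0 : 0 < dist x y := dist_pos.2 hy.symm
    apply propext
    change dist x y ≤ R ↔ 0 < dist x y ∧ dist x y ≤ R
    simp [h0]
  rw [setLIntegral_congr hset]
  refine (lintegral_annulus_rpow_neg_le hC (h x) ha le_rfl hR).trans ?_
  refine (add_le_add_right (mul_le_mul_right
    (lintegral_Ioc_rpow_sub_one_le hda le_rfl hR) _) _).trans ?_
  rw [← ENNReal.ofReal_mul (by positivity), ← ENNReal.ofReal_add (by positivity) (by positivity)]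
  apply le_of_eq; congr 1; ring

/-- Within distance `1` the previous bound applies; beyond it the integrand is at most `1` and the
mass is finite. -/
theorem UpperRegular.exists_lintegral_le {d a : ℝ} {μ : Measure (Eucl n)} [IsFiniteMeasure μ]
    (h : UpperRegular d μ) (ha : 0 ≤ a) (had : a < d) :
    ∃ C : ℝ, 0 ≤ C ∧ ∀ x : Eucl n,
      ∫⁻ y, ENNReal.ofReal (dist x y ^ (-a)) ∂μ ≤ ENNReal.ofReal C := by
  obtain ⟨C, hC, hx⟩ := h.exists_lintegral_closedBall_le ha had
  refine ⟨C + (μ univ).toReal, by positivity, fun x => ?_⟩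
  have hm : MeasurableSet {y | dist x y ≤ 1} := measurableSet_le (by fun_prop) measurable_const
  rw [← lintegral_add_compl _ hm, ENNReal.ofReal_add hC ENNReal.toReal_nonneg,
    ENNReal.ofReal_toReal (measure_ne_top _ _)]
  refine add_le_add ((hx x 1 one_pos).trans (by simp)) ?_
  calc _ ≤ ∫⁻ y in {y | dist x y ≤ 1}ᶜ, 1 ∂μ := by
        refine setLIntegral_mono' hm.compl fun y hy => ?_
        rw [← ENNReal.ofReal_one]
        apply ENNReal.ofReal_le_ofReal
        exact Real.rpow_le_one_of_one_le_of_nonpos (le_of_not_ge hy) (neg_nonpos.2 ha)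
    _ ≤ _ := by
      rw [setLIntegral_one]
      exact measure_mono (subset_univ _)

end DSetScattering

/-! ### Weakly singular kernels between `L²` spaces of regular measures. -/

namespace DSetScattering

variable {n : ℕ}

theorem lintegral_mul_sq_le {α : Type*} [MeasurableSpace α] {μ : Measure α} {f g : α → ℝ≥0∞}
    (hf : AEMeasurable f μ) (hg : AEMeasurable g μ) :
    (∫⁻ x, f x * g x ∂μ) ^ 2 ≤ (∫⁻ x, f x ^ 2 ∂μ) * ∫⁻ x, g x ^ 2 ∂μ := by
  have h := ENNReal.lintegral_mul_le_Lp_mul_Lq μ Real.HolderConjugate.two_two hf hg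
  calc _ ≤ _ := pow_le_pow_left' h 2
    _ = _ := by
      rw [mul_pow, ← ENNReal.rpow_natCast, ← ENNReal.rpow_natCast, ← ENNReal.rpow_mul,
        ← ENNReal.rpow_mul]
      norm_num

theorem ae_prod_fst_ne_snd {μ ν : Measure (Eucl n)} [SFinite μ] [SFinite ν]
    [NullSingletonClass μ] : ∀ᵐ p ∂(ν.prod μ), p.1 ≠ p.2 := by
  have hm : MeasurableSet {p : Eucl n × Eucl n | p.1 = p.2} :=
    measurableSet_eq_fun measurable_fst measurable_snd
  rw [ae_iff]
  simp only [ne_eq, not_not]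
  rw [Measure.measure_prod_null hm]
  refine Eventually.of_forall fun x => ?_
  have : Prod.mk x ⁻¹' {p : Eucl n × Eucl n | p.1 = p.2} = {x} := by
    ext y; simp [eq_comm]
  simp only [this, measure_singleton, Pi.zero_apply]

theorem ofReal_mul_rpow_dist_sq {x y : Eucl n} (hxy : x ≠ y) (s : ℝ) :
    ENNReal.ofReal (dist x y ^ s) ^ 2 = ENNReal.ofReal (dist x y ^ (2 * s)) := by
  have h0 := dist_pos.2 hxy
  rw [← ENNReal.ofReal_pow (by positivity), ← Real.rpow_natCast, ← Real.rpow_mul h0.le]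
  congr 2; push_cast; ring

/-- Cauchy-Schwarz for a kernel operator against a power weight. -/
theorem UpperRegular.exists_lintegral_kernel_sq_le {d s : ℝ} {μ ν : Measure (Eucl n)}
    [IsFiniteMeasure μ] [IsFiniteMeasure ν] (hμ : UpperRegular d μ) (hs : 0 ≤ s) (hsd : 2 * s < d) :
    ∃ C : ℝ, ∀ (k : Eucl n × Eucl n → ℝ≥0∞) (f : Eucl n → ℝ≥0∞), Measurable k → Measurable f →
      ∫⁻ x, (∫⁻ y, k (x, y) * f y ∂μ) ^ 2 ∂ν ≤ ENNReal.ofReal C *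
        ∫⁻ p, k p ^ 2 * ENNReal.ofReal (dist p.1 p.2 ^ (2 * s)) * f p.2 ^ 2 ∂(ν.prod μ) := by
  have := hμ.nullSingletonClass (by linarith)
  obtain ⟨C, hC, hCx⟩ := hμ.exists_lintegral_le (a := 2 * s) (by positivity) hsd
  refine ⟨C, fun k f hk hf => ?_⟩
  have hmeas : Measurable fun p : Eucl n × Eucl n =>
      k p ^ 2 * ENNReal.ofReal (dist p.1 p.2 ^ (2 * s)) * f p.2 ^ 2 := by fun_prop
  rw [lintegral_prod _ hmeas.aemeasurable, ← lintegral_const_mul' _ _ ENNReal.ofReal_ne_top]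
  refine lintegral_mono fun x => ?_
  have hne : ∀ᵐ y ∂μ, y ≠ x := by simp [ae_iff]
  -- Insert `r^(-s) r^s = 1`: the square of the first factor is integrable in `y` uniformly in `x`,
  -- because `2s < d`.
  have h1 : ∫⁻ y, k (x, y) * f y ∂μ = ∫⁻ y, ENNReal.ofReal (dist x y ^ (-s)) *
      (k (x, y) * ENNReal.ofReal (dist x y ^ s) * f y) ∂μ := by
    refine lintegral_congr_ae ?_
    filter_upwards [hne] with y hy
    have h0 := dist_pos.2 hy.symm
    have : ENNReal.ofReal (dist x y ^ (-s)) * ENNReal.ofReal (dist x y ^ s) = 1 := by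
      rw [← ENNReal.ofReal_mul (by positivity), ← Real.rpow_add h0]
      simp
    calc _ = (ENNReal.ofReal (dist x y ^ (-s)) * ENNReal.ofReal (dist x y ^ s)) *
          (k (x, y) * f y) := by rw [this, one_mul]
      _ = _ := by ring
  rw [h1]
  refine (lintegral_mul_sq_le (by fun_prop) (by fun_prop)).trans ?_
  refine mul_le_mul' ?_ (lintegral_mono_ae ?_)
  · refine le_trans (lintegral_mono_ae ?_) (hCx x)
    filter_upwards [hne] with y hy
    rw [ofReal_mul_rpow_dist_sq hy.symm, mul_neg]
  · filter_upwards [hne] with y hy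
    rw [mul_pow, mul_pow, ofReal_mul_rpow_dist_sq hy.symm]

/-- The exponent is shared in proportion to the dimensions, so that both strict inequalities reduce
to `2a < d + e`. -/
theorem exists_weight_split {a d e : ℝ} (ha : 0 ≤ a) (hd : 0 < d) (he : 0 < e)
    (hade : 2 * a < d + e) :
    ∃ s t : ℝ, 0 ≤ s ∧ 0 ≤ t ∧ s + t = a ∧ 2 * s < d ∧ 2 * t < e := by
  have hde : 0 < d + e := by linarith
  refine ⟨a * d / (d + e), a * e / (d + e), by positivity, by positivity, by field_simp, ?_, ?_⟩
  · rw [← mul_div_assoc, div_lt_iff₀ hde]; nlinarith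
  · rw [← mul_div_assoc, div_lt_iff₀ hde]; nlinarith

/-- Integrate in `x` first: regularity of `ν` bounds that integral uniformly in `y`. -/
theorem UpperRegular.lintegral_prod_rpow_neg_mul_lt_top {e t : ℝ} {μ ν : Measure (Eucl n)}
    [IsFiniteMeasure μ] [IsFiniteMeasure ν] (hν : UpperRegular e ν) (ht : 0 ≤ t) (hte : t < e)
    {f : Eucl n → ℝ≥0∞} (hf : Measurable f) (hf' : ∫⁻ y, f y ∂μ ≠ ⊤) :
    ∫⁻ p, ENNReal.ofReal (dist p.1 p.2 ^ (-t)) * f p.2 ∂(ν.prod μ) ≠ ⊤ := by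
  obtain ⟨C, hC, hCx⟩ := hν.exists_lintegral_le ht hte
  have hmeas : Measurable fun p : Eucl n × Eucl n =>
    ENNReal.ofReal (dist p.1 p.2 ^ (-t)) * f p.2 := by fun_prop
  rw [lintegral_prod_symm' _ hmeas]
  refine ((lintegral_mono (g := fun y => ENNReal.ofReal C * f y) fun y => ?_).trans_lt ?_).ne
  · simp only
    rw [lintegral_mul_const _ (by fun_prop)]
    gcongr
    simpa only [dist_comm] using hCx y
  · rw [lintegral_const_mul _ hf]
    exact ENNReal.mul_lt_top ENNReal.ofReal_lt_top hf'.lt_top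

/-- Of the squared kernel `r^(-2a)`, the weight `r^(2s)` leaves `r^(-2t)`, the share to be
integrated in `x`. -/
theorem enorm_sq_mul_weight_le {x y : Eucl n} (hxy : x ≠ y) {C a s t : ℝ} (hC : 0 ≤ C)
    (hst : s + t = a) {z : ℂ} (hz : ‖z‖ ≤ C * dist x y ^ (-a)) (b : ℝ≥0∞) :
    ‖z‖ₑ ^ 2 * ENNReal.ofReal (dist x y ^ (2 * s)) * b ≤
      ENNReal.ofReal (C ^ 2) * (ENNReal.ofReal (dist x y ^ (-(2 * t))) * b) := by
  have h0 := dist_pos.2 hxy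
  have hz' : ‖z‖ₑ ≤ ENNReal.ofReal (C * dist x y ^ (-a)) := by
    rw [← ofReal_norm]
    exact ENNReal.ofReal_le_ofReal hz
  rw [← mul_assoc]
  refine mul_le_mul_left ?_ b
  calc _ ≤ ENNReal.ofReal (C * dist x y ^ (-a)) ^ 2 * ENNReal.ofReal (dist x y ^ (2 * s)) := by
        gcongr
    _ = _ := by
      rw [← ENNReal.ofReal_pow (by positivity), ← ENNReal.ofReal_mul (by positivity),
        ← ENNReal.ofReal_mul (sq_nonneg C)]
      congr 1
      rw [mul_pow, ← Real.rpow_natCast (dist x y ^ (-a)), ← Real.rpow_mul h0.le, mul_assoc,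
        ← Real.rpow_add h0]
      congr 2
      rw [← hst]; push_cast; ring

theorem eLpNorm_two_sq {α : Type*} [MeasurableSpace α] {μ : Measure α} {E : Type*}
    [NormedAddCommGroup E] (f : α → E) : eLpNorm f 2 μ ^ 2 = ∫⁻ x, ‖f x‖ₑ ^ 2 ∂μ := by
  have h := eLpNorm_nnreal_pow_eq_lintegral (f := f) (μ := μ) (p := 2) (by norm_num)
  simpa using h

theorem tendsto_zero_of_sq {ι : Type*} {l : Filter ι} {f : ι → ℝ≥0∞}
    (h : Tendsto (fun i => f i ^ 2) l (𝓝 0)) : Tendsto f l (𝓝 0) := by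
  have := (ENNReal.continuous_rpow_const (y := 1 / 2)).tendsto 0 |>.comp h
  rw [ENNReal.zero_rpow_of_pos (by norm_num)] at this
  refine this.congr fun i => ?_
  simp only [Function.comp_apply]
  rw [← ENNReal.rpow_natCast, ← ENNReal.rpow_mul]
  norm_num

theorem lintegral_enorm_sq_ne_top {α : Type*} [MeasurableSpace α] {μ : Measure α} {E : Type*}
    [NormedAddCommGroup E] {f : α → E} (hf : MemLp f 2 μ) : ∫⁻ x, ‖f x‖ₑ ^ 2 ∂μ ≠ ⊤ := by
  rw [← eLpNorm_two_sq]
  exact ENNReal.pow_ne_top hf.eLpNorm_ne_top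

section Kernel

variable {a d e C : ℝ} {μ ν : Measure (Eucl n)} [IsFiniteMeasure μ] [IsFiniteMeasure ν]
  {ψ : Eucl n → ℂ}

/-- The share `s` of the singularity is absorbed by `μ` in Cauchy-Schwarz, and the share `t` by `ν`
in Tonelli. It is applied with `ν = μ` on `Γ` and with `ν` equal to Lebesgue measure on the support
of the cut-off. -/
theorem lintegral_kernel_enorm_sq_lt_top (hμ : UpperRegular d μ) (hν : UpperRegular e ν)
    (ha : 0 ≤ a) (hd : 0 < d) (he : 0 < e) (hade : 2 * a < d + e)
    (hψ : StronglyMeasurable ψ) (hψ2 : MemLp ψ 2 μ) {K : Eucl n → Eucl n → ℂ}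
    (hK : StronglyMeasurable (Function.uncurry K)) (hC : 0 ≤ C)
    (hKb : ∀ x y, x ≠ y → ‖K x y‖ ≤ C * dist x y ^ (-a)) :
    ∫⁻ x, (∫⁻ y, ‖K x y * ψ y‖ₑ ∂μ) ^ 2 ∂ν < ⊤ := by
  obtain ⟨s, t, hs, ht, hst, hsd, hte⟩ := exists_weight_split ha hd he hade
  have := hμ.nullSingletonClass hd
  obtain ⟨M, hM⟩ := hμ.exists_lintegral_kernel_sq_le (ν := ν) hs hsd
  have h := hM (fun p => ‖K p.1 p.2‖ₑ) (fun y => ‖ψ y‖ₑ) hK.measurable.enorm hψ.measurable.enorm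
  simp only [enorm_mul]
  refine h.trans_lt (ENNReal.mul_lt_top ENNReal.ofReal_lt_top ?_)
  have hfin : ∫⁻ y, ‖ψ y‖ₑ ^ 2 ∂μ ≠ ⊤ := lintegral_enorm_sq_ne_top hψ2
  have hfin2 := hν.lintegral_prod_rpow_neg_mul_lt_top (μ := μ) (t := 2 * t) (by positivity) hte
    (hψ.measurable.enorm.pow_const 2) hfin
  refine (lintegral_mono_ae (g := fun p => ENNReal.ofReal (C ^ 2) *
    (ENNReal.ofReal (dist p.1 p.2 ^ (-(2 * t))) * ‖ψ p.2‖ₑ ^ 2)) ?_).trans_lt ?_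
  · filter_upwards [ae_prod_fst_ne_snd] with p hp
    exact enorm_sq_mul_weight_le hp hC hst (hKb _ _ hp) _
  · rw [lintegral_const_mul' _ _ ENNReal.ofReal_ne_top]
    exact ENNReal.mul_lt_top ENNReal.ofReal_lt_top hfin2.lt_top

theorem ae_integrable_kernel (hμ : UpperRegular d μ) (hν : UpperRegular e ν)
    (ha : 0 ≤ a) (hd : 0 < d) (he : 0 < e) (hade : 2 * a < d + e)
    (hψ : StronglyMeasurable ψ) (hψ2 : MemLp ψ 2 μ) {K : Eucl n → Eucl n → ℂ}
    (hK : StronglyMeasurable (Function.uncurry K)) (hC : 0 ≤ C)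
    (hKb : ∀ x y, x ≠ y → ‖K x y‖ ≤ C * dist x y ^ (-a)) :
    ∀ᵐ x ∂ν, Integrable (fun y => K x y * ψ y) μ := by
  have h := lintegral_kernel_enorm_sq_lt_top hμ hν ha hd he hade hψ hψ2 hK hC hKb
  have hm : StronglyMeasurable fun p : Eucl n × Eucl n => K p.1 p.2 * ψ p.2 :=
    hK.mul (hψ.comp_measurable measurable_snd)
  have hm2 : Measurable fun x => (∫⁻ y, ‖K x y * ψ y‖ₑ ∂μ) ^ 2 :=
    (Measurable.lintegral_prod_right hm.measurable.enorm).pow_const 2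
  filter_upwards [ae_lt_top hm2 h.ne] with x hx
  refine ⟨(hm.comp_measurable measurable_prodMk_left).aestronglyMeasurable, ?_⟩
  by_contra hcon
  rw [HasFiniteIntegral, not_lt, top_le_iff] at hcon
  exact hx.ne (by rw [hcon, ENNReal.top_pow two_ne_zero])

theorem memLp_kernel (hμ : UpperRegular d μ) (hν : UpperRegular e ν)
    (ha : 0 ≤ a) (hd : 0 < d) (he : 0 < e) (hade : 2 * a < d + e)
    (hψ : StronglyMeasurable ψ) (hψ2 : MemLp ψ 2 μ) {K : Eucl n → Eucl n → ℂ}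
    (hK : StronglyMeasurable (Function.uncurry K)) (hC : 0 ≤ C)
    (hKb : ∀ x y, x ≠ y → ‖K x y‖ ≤ C * dist x y ^ (-a)) :
    MemLp (fun x => ∫ y, K x y * ψ y ∂μ) 2 ν := by
  have h := lintegral_kernel_enorm_sq_lt_top hμ hν ha hd he hade hψ hψ2 hK hC hKb
  have hm : StronglyMeasurable fun p : Eucl n × Eucl n => K p.1 p.2 * ψ p.2 :=
    hK.mul (hψ.comp_measurable measurable_snd)
  refine ⟨hm.integral_prod_right.aestronglyMeasurable, ?_⟩
  refine (ENNReal.pow_lt_top_iff (n := 2).1 ?_).resolve_right two_ne_zero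
  rw [eLpNorm_two_sq]
  refine (lintegral_mono fun x => ?_).trans_lt h
  gcongr
  exact enorm_integral_le_lintegral_enorm _

/-- Dominated convergence on the product space, after Cauchy-Schwarz. The majorant is the one that
gave finiteness, with `2C` in place of `C` for the difference of two kernels. -/
theorem tendsto_eLpNorm_kernel (hμ : UpperRegular d μ) (hν : UpperRegular e ν)
    (ha : 0 ≤ a) (hd : 0 < d) (he : 0 < e) (hade : 2 * a < d + e)
    (hψ : StronglyMeasurable ψ) (hψ2 : MemLp ψ 2 μ) {K : ℕ → Eucl n → Eucl n → ℂ}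
    {K' : Eucl n → Eucl n → ℂ}
    (hK : ∀ j, StronglyMeasurable (Function.uncurry (K j)))
    (hK' : StronglyMeasurable (Function.uncurry K')) (hC : 0 ≤ C)
    (hKb : ∀ j x y, x ≠ y → ‖K j x y‖ ≤ C * dist x y ^ (-a))
    (hlim : ∀ x y, x ≠ y → Tendsto (fun j => K j x y) atTop (𝓝 (K' x y))) :
    Tendsto (fun j => eLpNorm (fun x => ∫ y, K j x y * ψ y ∂μ - ∫ y, K' x y * ψ y ∂μ) 2 ν)
      atTop (𝓝 0) := by
  have hK'b : ∀ x y, x ≠ y → ‖K' x y‖ ≤ C * dist x y ^ (-a) := fun x y hxy =>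
    le_of_tendsto (hlim x y hxy).norm (Eventually.of_forall fun j => hKb j x y hxy)
  obtain ⟨s, t, hs, ht, hst, hsd, hte⟩ := exists_weight_split ha hd he hade
  have := hμ.nullSingletonClass hd
  obtain ⟨M, hM⟩ := hμ.exists_lintegral_kernel_sq_le (ν := ν) hs hsd
  apply tendsto_zero_of_sq
  simp only [eLpNorm_two_sq]
  set D : ℕ → Eucl n × Eucl n → ℂ := fun j p => K j p.1 p.2 - K' p.1 p.2 with hD
  have hDm : ∀ j, Measurable (D j) := fun j => ((hK j).sub hK').measurable
  have hDb : ∀ j p, p.1 ≠ p.2 → ‖D j p‖ ≤ 2 * C * dist p.1 p.2 ^ (-a) := fun j p hp =>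
    (norm_sub_le _ _).trans (by linarith [hKb j _ _ hp, hK'b _ _ hp])
  have hlim0 : Tendsto (fun j => ENNReal.ofReal M * ∫⁻ p, ‖D j p‖ₑ ^ 2 *
      ENNReal.ofReal (dist p.1 p.2 ^ (2 * s)) * ‖ψ p.2‖ₑ ^ 2 ∂(ν.prod μ)) atTop (𝓝 0) := by
    rw [← mul_zero (ENNReal.ofReal M)]
    refine ENNReal.Tendsto.const_mul ?_ (Or.inr ENNReal.ofReal_ne_top)
    rw [← lintegral_zero (μ := ν.prod μ)]
    have hψm := hψ.measurable
    refine tendsto_lintegral_of_dominated_convergence (fun p => ENNReal.ofReal ((2 * C) ^ 2) *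
      (ENNReal.ofReal (dist p.1 p.2 ^ (-(2 * t))) * ‖ψ p.2‖ₑ ^ 2)) (fun j => ?_) (fun j => ?_) ?_ ?_
    · have := hDm j
      fun_prop
    · filter_upwards [ae_prod_fst_ne_snd] with p hp
      exact enorm_sq_mul_weight_le hp (by positivity) hst (hDb j p hp) _
    · rw [lintegral_const_mul' _ _ ENNReal.ofReal_ne_top]
      exact ENNReal.mul_ne_top ENNReal.ofReal_ne_top (hν.lintegral_prod_rpow_neg_mul_lt_top
        (by positivity) hte (hψ.measurable.enorm.pow_const 2) (lintegral_enorm_sq_ne_top hψ2))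
    · filter_upwards [ae_prod_fst_ne_snd] with p hp
      have h1 : Tendsto (fun j => ‖D j p‖ₑ ^ 2) atTop (𝓝 0) := by
        have h2 : Tendsto (fun j => D j p) atTop (𝓝 0) := by
          rw [← sub_self (K' p.1 p.2)]
          exact (hlim _ _ hp).sub_const _
        have h3 := ((ENNReal.continuous_pow 2).comp continuous_enorm).tendsto (0 : ℂ) |>.comp h2
        simpa [Function.comp_def] using h3
      have h4 := ENNReal.Tendsto.mul_const (b := ENNReal.ofReal (dist p.1 p.2 ^ (2 * s)) *
        ‖ψ p.2‖ₑ ^ 2) h1 (Or.inr (ENNReal.mul_ne_top ENNReal.ofReal_ne_top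
          (ENNReal.pow_ne_top enorm_ne_top)))
      simpa [mul_assoc] using h4
  refine tendsto_of_tendsto_of_tendsto_of_le_of_le tendsto_const_nhds hlim0
    (fun j => zero_le) (fun j => ?_)
  refine le_trans (lintegral_mono_ae ?_)
    (hM (fun p => ‖D j p‖ₑ) (fun y => ‖ψ y‖ₑ) (hDm j).enorm hψ.measurable.enorm)
  filter_upwards [ae_integrable_kernel hμ hν ha hd he hade hψ hψ2 (hK j) hC (hKb j),
    ae_integrable_kernel hμ hν ha hd he hade hψ hψ2 hK' hC hK'b] with x hx hx'
  rw [← integral_sub hx hx']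
  gcongr
  refine (enorm_integral_le_lintegral_enorm _).trans (le_of_eq ?_)
  refine lintegral_congr fun y => ?_
  rw [← enorm_mul, hD, sub_mul]

end Kernel

end DSetScattering

/-! ### The trace inequality. -/

namespace DSetScattering

variable {n : ℕ}

theorem lintegral_comp_add_smul (g : Eucl n → ℝ≥0∞) (hg : Measurable g) (x : Eucl n) {t : ℝ}
    (ht : 0 < t) :
    ∫⁻ h, g (x + t • h) = ENNReal.ofReal (t ^ (-(n : ℝ))) * ∫⁻ y, g y := by
  have h1 : ∫⁻ h, g (x + t • h) = ∫⁻ y, g (x + y) ∂(Measure.map (t • ·) volume) := by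
    rw [lintegral_map (by fun_prop) (by fun_prop)]
  rw [h1, Measure.map_addHaar_smul _ ht.ne', lintegral_smul_measure, lintegral_add_left_eq_self,
    finrank_euclideanSpace_fin, smul_eq_mul, Real.rpow_neg ht.le, Real.rpow_natCast,
    abs_of_pos (by positivity)]

/-- The substitution `y = x + t h` costs `t^(-n)`, and each `y` is reached only from the `x` within
distance `t`, a set of measure at most `C t^d`. -/
theorem lintegral_lintegral_comp_add_smul_le {C d : ℝ} (hC : 0 ≤ C) {μ : Measure (Eucl n)}
    [SFinite μ] (hμ : ∀ (x : Eucl n) (r : ℝ), 0 < r →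
      μ (Metric.closedBall x r) ≤ ENNReal.ofReal (C * r ^ d))
    {g : Eucl n → ℝ≥0∞} (hg : Measurable g) {t : ℝ} (ht : 0 < t) :
    ∫⁻ x, (∫⁻ h in Metric.closedBall (0 : Eucl n) 1, g (x + t • h)) ∂μ ≤
      ENNReal.ofReal (C * t ^ (d - n)) * ∫⁻ y, g y := by
  obtain ⟨K, hK⟩ : ∃ K : Eucl n × Eucl n → ℝ≥0∞,
    K = {p : Eucl n × Eucl n | dist p.1 p.2 ≤ t}.indicator (fun p => g p.2) := ⟨_, rfl⟩
  have hKm : Measurable K := by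
    rw [hK]
    exact Measurable.indicator (by fun_prop) (measurableSet_le (by fun_prop) (by fun_prop))
  have h1 : ∀ x, ∫⁻ h in Metric.closedBall (0 : Eucl n) 1, g (x + t • h) =
      ENNReal.ofReal (t ^ (-(n : ℝ))) * ∫⁻ y, K (x, y) := by
    intro x
    rw [← lintegral_comp_add_smul (fun y => K (x, y)) (by fun_prop) x ht,
      ← lintegral_indicator Metric.isClosed_closedBall.measurableSet]
    refine lintegral_congr fun h => ?_
    have hiff : h ∈ Metric.closedBall (0 : Eucl n) 1 ↔
        (x, x + t • h) ∈ {p : Eucl n × Eucl n | dist p.1 p.2 ≤ t} := by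
      rw [mem_closedBall_zero_iff, mem_ofPred_eq, dist_self_add_right, norm_smul, Real.norm_eq_abs,
        abs_of_pos ht]
      constructor
      · intro h; nlinarith
      · intro h; nlinarith
    by_cases hh : h ∈ Metric.closedBall (0 : Eucl n) 1
    · rw [indicator_of_mem hh, hK, indicator_of_mem (hiff.1 hh)]
    · rw [indicator_of_notMem hh, hK, indicator_of_notMem (fun h' => hh (hiff.2 h'))]
  simp only [h1]
  rw [lintegral_const_mul' _ _ ENNReal.ofReal_ne_top, lintegral_lintegral_swap (by fun_prop)]
  have h2 : ∀ y, ∫⁻ x, K (x, y) ∂μ ≤ ENNReal.ofReal (C * t ^ d) * g y := by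
    intro y
    calc _ ≤ ∫⁻ x in Metric.closedBall y t, g y ∂μ := by
          rw [← lintegral_indicator Metric.isClosed_closedBall.measurableSet]
          refine lintegral_mono fun x => ?_
          by_cases hx : dist x y ≤ t
          · rw [hK, indicator_of_mem (by exact hx), indicator_of_mem (by exact hx)]
          · rw [hK, indicator_of_notMem (by exact hx)]
            exact zero_le
      _ ≤ _ := by
        rw [setLIntegral_const, mul_comm]
        gcongr
        exact hμ y t ht
  refine (mul_le_mul_right (lintegral_mono h2) _).trans ?_
  rw [lintegral_const_mul' _ _ ENNReal.ofReal_ne_top, ← mul_assoc,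
    ← ENNReal.ofReal_mul (by positivity), sub_eq_add_neg, Real.rpow_add ht]
  apply le_of_eq; congr 2; ring

theorem enorm_le_add_lintegral_fderiv {f : Eucl n → ℂ} (hf : ContDiff ℝ 1 f) (x h : Eucl n)
    (hh : ‖h‖ ≤ 1) :
    ‖f x‖ₑ ≤ ‖f (x + h)‖ₑ + ∫⁻ t in Ioc (0 : ℝ) 1, ‖fderiv ℝ f (x + t • h)‖ₑ := by
  have hc : Continuous (fderiv ℝ f) := hf.continuous_fderiv (by norm_num)
  have hderiv : ∀ t ∈ uIcc (0 : ℝ) 1,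
      HasDerivAt (fun t : ℝ => f (x + t • h)) (fderiv ℝ f (x + t • h) h) t := by
    intro t _
    have h1 : HasDerivAt (fun t : ℝ => x + t • h) h t := by
      simpa using ((hasDerivAt_id t).smul_const h).const_add x
    exact (hf.differentiable (by norm_num) _).hasFDerivAt.comp_hasDerivAt t h1
  have hint := intervalIntegral.integral_eq_sub_of_hasDerivAt hderiv
    (Continuous.intervalIntegrable (by fun_prop) _ _)
  have : f x = f (x + h) - ∫ t in (0 : ℝ)..1, fderiv ℝ f (x + t • h) h := by
    rw [hint]; simp
  rw [this, intervalIntegral.integral_of_le zero_le_one]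
  refine enorm_sub_le.trans (add_le_add le_rfl ?_)
  refine (enorm_integral_le_lintegral_enorm _).trans (lintegral_mono fun t => ?_)
  have hle : ‖fderiv ℝ f (x + t • h) h‖ ≤ ‖fderiv ℝ f (x + t • h)‖ :=
    ((fderiv ℝ f (x + t • h)).le_opNorm h).trans
      (mul_le_of_le_one_right (norm_nonneg _) hh)
  exact enorm_le_iff_norm_le.2 hle

theorem ENNReal_add_sq_le (a b : ℝ≥0∞) : (a + b) ^ 2 ≤ 2 * (a ^ 2 + b ^ 2) := by
  have h := ENNReal.rpow_add_le_mul_rpow_add_rpow a b (p := 2) (by norm_num)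
  norm_num at h
  exact h

/-- The trace inequality on a set of dimension `d > n - 2`. -/
theorem exists_lintegral_trace_le [NeZero n] {d : ℝ} (hd : (n : ℝ) - 2 < d)
    {μ : Measure (Eucl n)} [IsFiniteMeasure μ] (hμ : UpperRegular d μ) :
    ∃ C : ℝ≥0∞, C ≠ ⊤ ∧ ∀ f : Eucl n → ℂ, ContDiff ℝ 1 f →
      ∫⁻ x, ‖f x‖ₑ ^ 2 ∂μ ≤ C * ((∫⁻ x, ‖f x‖ₑ ^ 2) + ∫⁻ x, ‖fderiv ℝ f x‖ₑ ^ 2) := by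
  obtain ⟨M, hM, hμ⟩ := hμ
  -- Here `d > n - 2` enters as `σ < 1`. Cauchy-Schwarz in `t` with weights `t^(-σ/2)` and `t^(σ/2)`
  -- leaves `∫ t^(-σ)`, and then `t^σ t^(d-n) = t^(-σ)`, so the same finite integral `A` appears
  -- twice.
  set σ : ℝ := (n - d) / 2 with hσ
  have hσ1 : σ < 1 := by rw [hσ]; linarith
  have hdσ : d - n = -2 * σ := by rw [hσ]; ring
  set A : ℝ≥0∞ := ∫⁻ t in Ioc (0 : ℝ) 1, ENNReal.ofReal (t ^ (-σ)) with hA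
  have hAt : A ≠ ⊤ := by
    have := lintegral_Ioc_rpow_sub_one_le (p := 1 - σ) (r := 0) (R := 1) (by linarith) le_rfl
      one_pos
    rw [show 1 - σ - 1 = -σ by ring] at this
    exact (this.trans_lt ENNReal.ofReal_lt_top).ne
  set B : Set (Eucl n) := Metric.closedBall (0 : Eucl n) 1 with hB
  have hBm : MeasurableSet B := Metric.isClosed_closedBall.measurableSet
  have hB0 : volume B ≠ 0 := (Metric.measure_closedBall_pos _ _ one_pos).ne'
  have hBt : volume B ≠ ⊤ := measure_closedBall_lt_top.ne
  refine ⟨(volume B)⁻¹ * (2 * μ univ + 2 * A * (ENNReal.ofReal M * A)), ?_, fun f hf => ?_⟩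
  · have := measure_ne_top μ univ
    refine ENNReal.mul_ne_top (ENNReal.inv_ne_top.2 hB0) (ENNReal.add_ne_top.2 ⟨?_, ?_⟩)
    · exact ENNReal.mul_ne_top (by norm_num) this
    · exact ENNReal.mul_ne_top (ENNReal.mul_ne_top (by norm_num) hAt)
        (ENNReal.mul_ne_top ENNReal.ofReal_ne_top hAt)
  have hfc : Continuous f := hf.continuous
  have hc : Continuous (fderiv ℝ f) := hf.continuous_fderiv (by norm_num)
  set D : Eucl n → ℝ≥0∞ := fun x => ‖fderiv ℝ f x‖ₑ with hD
  have hDm : Measurable D := hc.measurable.enorm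
  have hfm : Measurable f := hfc.measurable
  have hcs : ∀ x h : Eucl n, (∫⁻ t in Ioc (0 : ℝ) 1, D (x + t • h)) ^ 2 ≤
      A * ∫⁻ t in Ioc (0 : ℝ) 1, ENNReal.ofReal (t ^ σ) * D (x + t • h) ^ 2 := by
    intro x h
    have h1 : ∫⁻ t in Ioc (0 : ℝ) 1, D (x + t • h) = ∫⁻ t in Ioc (0 : ℝ) 1,
        ENNReal.ofReal (t ^ (-σ / 2)) * (ENNReal.ofReal (t ^ (σ / 2)) * D (x + t • h)) := by
      refine setLIntegral_congr_fun measurableSet_Ioc fun t ht => ?_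
      have h0 : 0 < t := ht.1
      rw [← mul_assoc, ← ENNReal.ofReal_mul (by positivity), ← Real.rpow_add h0]
      simp [neg_div]
    rw [h1]
    refine (lintegral_mul_sq_le (by fun_prop) (by fun_prop)).trans (le_of_eq ?_)
    congr 1
    · refine setLIntegral_congr_fun measurableSet_Ioc fun t ht => ?_
      have h0 : 0 < t := ht.1
      rw [← ENNReal.ofReal_pow (by positivity), ← Real.rpow_natCast, ← Real.rpow_mul h0.le]
      congr 2; push_cast; ring
    · refine setLIntegral_congr_fun measurableSet_Ioc fun t ht => ?_
      have h0 : 0 < t := ht.1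
      rw [mul_pow, ← ENNReal.ofReal_pow (by positivity), ← Real.rpow_natCast,
        ← Real.rpow_mul h0.le]
      congr 3; push_cast; ring
  have hpt : ∀ x, ∀ h ∈ B, ‖f x‖ₑ ^ 2 ≤ 2 * ‖f (x + h)‖ₑ ^ 2 +
      2 * A * ∫⁻ t in Ioc (0 : ℝ) 1, ENNReal.ofReal (t ^ σ) * D (x + t • h) ^ 2 := by
    intro x h hh
    have h1 := enorm_le_add_lintegral_fderiv hf x h (by simpa [hB] using hh)
    refine (pow_le_pow_left' h1 2).trans ((ENNReal_add_sq_le _ _).trans ?_)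
    rw [mul_add, mul_assoc 2 A]
    gcongr
    exact hcs x h
  have hDm2 : Measurable fun p : (Eucl n × Eucl n) × ℝ =>
      ENNReal.ofReal (p.2 ^ σ) * D (p.1.1 + p.2 • p.1.2) ^ 2 := by fun_prop
  have hDm3 : Measurable fun p : Eucl n × Eucl n =>
      ∫⁻ t in Ioc (0 : ℝ) 1, ENNReal.ofReal (t ^ σ) * D (p.1 + t • p.2) ^ 2 :=
    Measurable.lintegral_prod_right hDm2
  -- Averaging over displacements `h` in the unit ball turns `f (x + h)` into a volume integral of
  -- `f`.
  have havg : ∀ x, ‖f x‖ₑ ^ 2 * volume B ≤ 2 * (∫⁻ y, ‖f y‖ₑ ^ 2) + 2 * A * ∫⁻ h in B,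
      ∫⁻ t in Ioc (0 : ℝ) 1, ENNReal.ofReal (t ^ σ) * D (x + t • h) ^ 2 := by
    intro x
    have hDx : Measurable fun h : Eucl n =>
      ∫⁻ t in Ioc (0 : ℝ) 1, ENNReal.ofReal (t ^ σ) * D (x + t • h) ^ 2 := by
      refine Measurable.lintegral_prod_right' (f := fun p : Eucl n × ℝ =>
        ENNReal.ofReal (p.2 ^ σ) * D (x + p.2 • p.1) ^ 2) ?_
      fun_prop
    rw [← setLIntegral_const]
    refine (setLIntegral_mono' hBm (hpt x)).trans ?_
    rw [lintegral_add_left (by fun_prop), lintegral_const_mul _ (by fun_prop),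
      lintegral_const_mul _ hDx]
    refine add_le_add (mul_le_mul_right ?_ 2) le_rfl
    have htr : ∫⁻ h, ‖f (x + h)‖ₑ ^ 2 = ∫⁻ y, ‖f y‖ₑ ^ 2 :=
      lintegral_add_left_eq_self (fun y => ‖f y‖ₑ ^ 2) x
    exact (setLIntegral_le_lintegral _ _).trans htr.le
  have hswap : ∫⁻ x, (∫⁻ h in B, ∫⁻ t in Ioc (0 : ℝ) 1,
      ENNReal.ofReal (t ^ σ) * D (x + t • h) ^ 2) ∂μ ≤
      ENNReal.ofReal M * A * ∫⁻ y, D y ^ 2 := by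
    have h1 : ∀ x, ∫⁻ h in B, ∫⁻ t in Ioc (0 : ℝ) 1, ENNReal.ofReal (t ^ σ) * D (x + t • h) ^ 2 =
        ∫⁻ t in Ioc (0 : ℝ) 1, ∫⁻ h in B, ENNReal.ofReal (t ^ σ) * D (x + t • h) ^ 2 := by
      intro x
      rw [lintegral_lintegral_swap]
      fun_prop
    simp only [h1]
    rw [lintegral_lintegral_swap]
    · rw [mul_assoc, hA, ← lintegral_mul_const _ (by fun_prop),
        ← lintegral_const_mul _ (by fun_prop)]
      refine setLIntegral_mono' measurableSet_Ioc fun t ht => ?_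
      have h0 : 0 < t := ht.1
      simp only [lintegral_const_mul' _ _ ENNReal.ofReal_ne_top]
      refine (mul_le_mul_right (lintegral_lintegral_comp_add_smul_le hM hμ
        (hDm.pow_const 2) h0) _).trans (le_of_eq ?_)
      rw [← mul_assoc, ← mul_assoc, ← ENNReal.ofReal_mul (by positivity),
        ← ENNReal.ofReal_mul (by positivity), hdσ, mul_left_comm, ← Real.rpow_add h0]
      congr 4; ring
    · refine Measurable.aemeasurable ?_
      refine Measurable.lintegral_prod_right' (f := fun p : (Eucl n × ℝ) × Eucl n =>
        ENNReal.ofReal (p.1.2 ^ σ) * D (p.1.1 + p.1.2 • p.2) ^ 2) ?_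
      fun_prop
  have hfin : (∫⁻ x, ‖f x‖ₑ ^ 2 ∂μ) * volume B ≤
      2 * μ univ * (∫⁻ y, ‖f y‖ₑ ^ 2) + 2 * A * (ENNReal.ofReal M * A) * ∫⁻ y, D y ^ 2 := by
    rw [← lintegral_mul_const _ (by fun_prop)]
    refine (lintegral_mono havg).trans ?_
    rw [lintegral_add_left measurable_const, lintegral_const, lintegral_const_mul]
    · rw [mul_right_comm, mul_assoc (2 * A)]
      gcongr
    · exact Measurable.lintegral_prod_right hDm3
  rw [mul_assoc, mul_comm (volume B)⁻¹, ← div_eq_mul_inv,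
    ENNReal.le_div_iff_mul_le (Or.inl hB0) (Or.inl hBt)]
  refine hfin.trans ?_
  rw [mul_add, add_mul, add_mul]
  refine add_le_add ?_ ?_
  · exact le_self_add
  · exact le_add_self

end DSetScattering

/-! ### Gradients, the `H¹` norm and uniqueness of the trace. -/

namespace DSetScattering

variable {n : ℕ}

open LineDeriv

/-- The `j`-th unit vector. -/
noncomputable abbrev unitVec (j : Fin n) : Eucl n := EuclideanSpace.single j (1 : ℝ)

/-- `w` is the gradient of `v`, as an `L²` function. -/
def HasL2Gradient (v : Lp ℂ 2 (volume : Measure (Eucl n)))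
    (w : Fin n → Lp ℂ 2 (volume : Measure (Eucl n))) : Prop :=
  ∀ j, (𝓕 (w j) : Lp ℂ 2 (volume : Measure (Eucl n))) =ᵐ[volume]
    fun ξ => (2 * Real.pi * Complex.I * (ξ j : ℝ)) * (𝓕 v) ξ

theorem SchwartzMap.hasL2Gradient (φ : 𝓢(Eucl n, ℂ)) :
    HasL2Gradient (φ.toLp 2 volume) (fun j => (∂_{unitVec j} φ).toLp 2 volume) := by
  intro j
  rw [SchwartzMap.toLp_fourier_eq, SchwartzMap.toLp_fourier_eq, SchwartzMap.fourier_lineDerivOp_eq]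
  have htg : (inner ℝ · (unitVec j) : Eucl n → ℝ).HasTemperateGrowth :=
    ((innerSL ℝ).flip (unitVec j)).hasTemperateGrowth
  filter_upwards [SchwartzMap.coeFn_toLp ((2 * Real.pi * Complex.I) •
    SchwartzMap.smulLeftCLM ℂ (inner ℝ · (unitVec j)) (𝓕 φ)) 2 volume,
    SchwartzMap.coeFn_toLp (𝓕 φ) 2 volume] with ξ h1 h2
  rw [h1, h2, smul_apply, SchwartzMap.smulLeftCLM_apply_apply htg]
  simp [EuclideanSpace.inner_single_right, mul_assoc]

theorem HasL2Gradient.sub {v v' : Lp ℂ 2 (volume : Measure (Eucl n))}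
    {w w' : Fin n → Lp ℂ 2 (volume : Measure (Eucl n))} (h : HasL2Gradient v w)
    (h' : HasL2Gradient v' w') : HasL2Gradient (v - v') (w - w') := by
  intro j
  have e1 : (𝓕 (w j - w' j) : Lp ℂ 2 (volume : Measure (Eucl n))) = 𝓕 (w j) - 𝓕 (w' j) :=
    map_sub (Lp.fourierTransformₗᵢ (Eucl n) ℂ) _ _
  have e2 : (𝓕 (v - v') : Lp ℂ 2 (volume : Measure (Eucl n))) = 𝓕 v - 𝓕 v' :=
    map_sub (Lp.fourierTransformₗᵢ (Eucl n) ℂ) _ _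
  rw [Pi.sub_apply, e1, e2]
  filter_upwards [h j, h' j, Lp.coeFn_sub (𝓕 (w j)) (𝓕 (w' j)),
    Lp.coeFn_sub (𝓕 v) (𝓕 v')] with ξ a b c d
  rw [c, d, Pi.sub_apply, Pi.sub_apply, a, b, mul_sub]

theorem h1Norm_sq (v : Lp ℂ 2 (volume : Measure (Eucl n))) :
    h1Norm v ^ 2 = ∫⁻ ξ, ‖(𝓕 v) ξ‖ₑ ^ 2 * ENNReal.ofReal (1 + (2 * Real.pi * ‖ξ‖) ^ 2) := by
  rw [h1Norm, ← ENNReal.rpow_natCast, ← ENNReal.rpow_mul]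
  norm_num

theorem Lp.enorm_sq_eq {α : Type*} [MeasurableSpace α] {μ : Measure α} (v : Lp ℂ 2 μ) :
    ‖v‖ₑ ^ 2 = ∫⁻ x, ‖v x‖ₑ ^ 2 ∂μ := by
  rw [← eLpNorm_two_sq, Lp.enorm_def]

theorem Lp.enorm_fourier (v : Lp ℂ 2 (volume : Measure (Eucl n))) :
    ‖(𝓕 v : Lp ℂ 2 (volume : Measure (Eucl n)))‖ₑ = ‖v‖ₑ := by
  rw [← ofReal_norm, ← ofReal_norm, Lp.norm_fourier_eq]

/-- Plancherel: the weight `1 + |2πξ|²` is `1` plus the sum of the squared moduli of the multipliers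
`2πi ξ_j`. -/
theorem HasL2Gradient.h1Norm_sq_eq {v : Lp ℂ 2 (volume : Measure (Eucl n))}
    {w : Fin n → Lp ℂ 2 (volume : Measure (Eucl n))} (h : HasL2Gradient v w) :
    h1Norm v ^ 2 = ‖v‖ₑ ^ 2 + ∑ j, ‖w j‖ₑ ^ 2 := by
  have hm : ∀ u : Lp ℂ 2 (volume : Measure (Eucl n)), Measurable u := fun u =>
    (Lp.stronglyMeasurable u).measurable
  rw [h1Norm_sq]
  simp_rw [← Lp.enorm_fourier v, ← fun j => Lp.enorm_fourier (w j), Lp.enorm_sq_eq]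
  rw [← lintegral_finsetSum _ (fun j _ => ((hm _).enorm.pow_const 2)),
    ← lintegral_add_left ((hm _).enorm.pow_const 2)]
  refine lintegral_congr_ae ?_
  filter_upwards [ae_all_iff.2 h] with ξ hξ
  simp only [hξ, enorm_mul, mul_pow]
  rw [ENNReal.ofReal_add zero_le_one (by positivity), mul_add, ENNReal.ofReal_one, mul_one,
    ← Finset.sum_mul, mul_comm]
  congr 2
  simp only [← mul_pow, ← enorm_mul]
  rw [mul_pow, EuclideanSpace.norm_sq_eq, Finset.mul_sum, ENNReal.ofReal_sum_of_nonneg]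
  · refine Finset.sum_congr rfl fun j _ => ?_
    rw [← ofReal_norm, ← ENNReal.ofReal_pow (norm_nonneg _)]
    congr 1
    simp only [norm_mul, Complex.norm_real, Complex.norm_I, Real.norm_eq_abs, Complex.norm_ofNat,
      mul_pow, sq_abs]
    ring
  · intro j _; positivity

/-- The Fourier transform is continuous on `L²`, and two successive subsequences converge almost
everywhere, so the multiplier relation passes to the limit. -/
theorem HasL2Gradient.of_tendsto {v : ℕ → Lp ℂ 2 (volume : Measure (Eucl n))}
    {w : ℕ → Fin n → Lp ℂ 2 (volume : Measure (Eucl n))}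
    {v' : Lp ℂ 2 (volume : Measure (Eucl n))} {w' : Fin n → Lp ℂ 2 (volume : Measure (Eucl n))}
    (h : ∀ m, HasL2Gradient (v m) (w m)) (hv : Tendsto v atTop (𝓝 v'))
    (hw : ∀ j, Tendsto (fun m => w m j) atTop (𝓝 (w' j))) : HasL2Gradient v' w' := by
  intro j
  have hF : Continuous fun u : Lp ℂ 2 (volume : Measure (Eucl n)) =>
      (𝓕 u : Lp ℂ 2 (volume : Measure (Eucl n))) := (Lp.fourierTransformₗᵢ (Eucl n) ℂ).continuous
  obtain ⟨ns, hns, h1⟩ := (tendstoInMeasure_of_tendsto_Lp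
    ((hF.tendsto _).comp hv)).exists_seq_tendsto_ae
  obtain ⟨ms, hms, h2⟩ := (tendstoInMeasure_of_tendsto_Lp
    (((hF.tendsto _).comp (hw j)).comp hns.tendsto_atTop)).exists_seq_tendsto_ae
  filter_upwards [h1, h2, ae_all_iff.2 fun m => h m j] with ξ h1 h2 h3
  refine tendsto_nhds_unique h2 ?_
  refine ((h1.comp hms.tendsto_atTop).const_mul
    (2 * Real.pi * Complex.I * (ξ j : ℝ) : ℂ)).congr fun m => ?_
  exact (h3 (ns (ms m))).symm

/-- The limits of the partial derivatives need not be known in advance to form the gradient of `v`: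
closedness of the gradient supplies this. -/
theorem tendsto_h1Norm_sub {φ : ℕ → 𝓢(Eucl n, ℂ)}
    {v : Lp ℂ 2 (volume : Measure (Eucl n))} {w : Fin n → Lp ℂ 2 (volume : Measure (Eucl n))}
    (hv : Tendsto (fun m => (φ m).toLp 2 volume) atTop (𝓝 v))
    (hw : ∀ j, Tendsto (fun m => (∂_{unitVec j} (φ m)).toLp 2 volume) atTop (𝓝 (w j))) :
    Tendsto (fun m => h1Norm ((φ m).toLp 2 volume - v)) atTop (𝓝 0) := by
  have h := fun m => SchwartzMap.hasL2Gradient (φ m)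
  have hlim := HasL2Gradient.of_tendsto h hv hw
  apply tendsto_zero_of_sq
  have hnorm : ∀ (u : ℕ → Lp ℂ 2 (volume : Measure (Eucl n))) (u' : Lp ℂ 2 volume),
      Tendsto u atTop (𝓝 u') → Tendsto (fun m => ‖u m - u'‖ₑ ^ 2) atTop (𝓝 0) := by
    intro u u' hu
    have h2 : Tendsto (fun m => u m - u') atTop (𝓝 0) := by
      rw [← sub_self u']
      exact hu.sub_const _
    have h3 := ((ENNReal.continuous_pow 2).comp continuous_enorm).tendsto
      (0 : Lp ℂ 2 (volume : Measure (Eucl n))) |>.comp h2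
    simpa [Function.comp_def] using h3
  have key : Tendsto (fun m => ‖(φ m).toLp 2 volume - v‖ₑ ^ 2 +
      ∑ j, ‖(∂_{unitVec j} (φ m)).toLp 2 volume - w j‖ₑ ^ 2) atTop (𝓝 (0 + ∑ _j : Fin n, 0)) :=
    (hnorm _ _ hv).add (tendsto_finsetSum _ fun j _ => hnorm _ _ (hw j))
  rw [Finset.sum_const_zero, add_zero] at key
  refine key.congr fun m => ?_
  rw [((h m).sub hlim).h1Norm_sq_eq]
  rfl

theorem norm_sq_le_sum_unitVec (L : Eucl n →L[ℝ] ℂ) :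
    ‖L‖ ^ 2 ≤ n * ∑ j, ‖L (unitVec j)‖ ^ 2 := by
  have h1 : ‖L‖ ≤ ∑ j, ‖L (unitVec j)‖ := by
    refine L.opNorm_le_bound (Finset.sum_nonneg fun _ _ => norm_nonneg _) fun x => ?_
    have hx : x = ∑ j, x j • unitVec j := by
      have := (EuclideanSpace.basisFun (Fin n) ℝ).sum_repr x
      simpa using this.symm
    calc ‖L x‖ = ‖∑ j, x j • L (unitVec j)‖ := by
          conv_lhs => rw [hx, map_sum]
          simp only [map_smul]
      _ ≤ ∑ j, ‖x j • L (unitVec j)‖ := norm_sum_le _ _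
      _ ≤ ∑ j, ‖L (unitVec j)‖ * ‖x‖ := by
          refine Finset.sum_le_sum fun j _ => ?_
          rw [norm_smul, mul_comm]
          gcongr
          exact PiLp.norm_apply_le x j
      _ = _ := by rw [Finset.sum_mul]
  calc ‖L‖ ^ 2 ≤ (∑ j, ‖L (unitVec j)‖) ^ 2 := by gcongr
    _ ≤ _ := by
      have := sq_sum_le_card_mul_sum_sq (s := (Finset.univ : Finset (Fin n)))
        (f := fun j => ‖L (unitVec j)‖)
      simpa using this

theorem enorm_sq_le_sum_unitVec (L : Eucl n →L[ℝ] ℂ) :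
    ‖L‖ₑ ^ 2 ≤ n * ∑ j, ‖L (unitVec j)‖ₑ ^ 2 := by
  have h := ENNReal.ofReal_le_ofReal (norm_sq_le_sum_unitVec L)
  rw [ENNReal.ofReal_mul (by positivity), ENNReal.ofReal_sum_of_nonneg fun _ _ => by positivity,
    ENNReal.ofReal_pow (norm_nonneg _), ofReal_norm, ENNReal.ofReal_natCast] at h
  simpa only [ENNReal.ofReal_pow (norm_nonneg _), ofReal_norm] using h

theorem enorm_toLp_sq (φ : 𝓢(Eucl n, ℂ)) : ‖φ.toLp 2 volume‖ₑ ^ 2 = ∫⁻ x, ‖φ x‖ₑ ^ 2 := by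
  rw [Lp.enorm_sq_eq]
  refine lintegral_congr_ae ?_
  filter_upwards [SchwartzMap.coeFn_toLp φ 2 volume] with x hx
  rw [hx]

theorem exists_trace_le_h1Norm [NeZero n] {d : ℝ} (hd : (n : ℝ) - 2 < d)
    {μ : Measure (Eucl n)} [IsFiniteMeasure μ] (hμ : UpperRegular d μ) :
    ∃ C : ℝ≥0∞, C ≠ ⊤ ∧ ∀ φ : 𝓢(Eucl n, ℂ),
      eLpNorm φ 2 μ ^ 2 ≤ C * h1Norm (φ.toLp 2 volume) ^ 2 := by
  obtain ⟨C, hC, h⟩ := exists_lintegral_trace_le hd hμ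
  refine ⟨C * n, ENNReal.mul_ne_top hC (ENNReal.natCast_ne_top n), fun φ => ?_⟩
  rw [eLpNorm_two_sq]
  refine (h φ (φ.smooth 1)).trans ?_
  rw [mul_assoc]
  gcongr
  rw [(SchwartzMap.hasL2Gradient φ).h1Norm_sq_eq, mul_add]
  have hn : (1 : ℝ≥0∞) ≤ n := by exact_mod_cast NeZero.one_le
  refine add_le_add ?_ ?_
  · rw [enorm_toLp_sq]
    exact le_mul_of_one_le_left' hn
  · simp only [enorm_toLp_sq]
    have hm : ∀ j : Fin n, Measurable fun x => ‖(∂_{unitVec j} φ) x‖ₑ ^ 2 := fun j =>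
      (∂_{unitVec j} φ).continuous.measurable.enorm.pow_const 2
    rw [← lintegral_finsetSum _ fun j _ => hm j, ← lintegral_const_mul' _ _ (by simp)]
    exact lintegral_mono fun x => enorm_sq_le_sum_unitVec (fderiv ℝ φ x)

theorem h1Norm_sub_sq_le (u v : Lp ℂ 2 (volume : Measure (Eucl n))) :
    h1Norm (u - v) ^ 2 ≤ 2 * (h1Norm u ^ 2 + h1Norm v ^ 2) := by
  have hm : ∀ u : Lp ℂ 2 (volume : Measure (Eucl n)), Measurable u := fun u =>
    (Lp.stronglyMeasurable u).measurable
  have e2 : (𝓕 (u - v) : Lp ℂ 2 (volume : Measure (Eucl n))) = 𝓕 u - 𝓕 v :=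
    map_sub (Lp.fourierTransformₗᵢ (Eucl n) ℂ) _ _
  simp only [h1Norm_sq]
  have hmu := hm (𝓕 u)
  rw [← lintegral_add_left (by fun_prop),
    ← lintegral_const_mul' _ _ (by norm_num), e2]
  refine lintegral_mono_ae ?_
  filter_upwards [Lp.coeFn_sub (𝓕 u) (𝓕 v)] with ξ h
  rw [h, ← add_mul, ← mul_assoc]
  gcongr
  exact (pow_le_pow_left' enorm_sub_le 2).trans (ENNReal_add_sq_le _ _)

/-- Two sequences that approximate `v` differ by a null sequence in `H¹`, hence, by the trace
inequality, in `L²(Γ)`. -/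
theorem HasTrace.unique [NeZero n] {d : ℝ} {Γ : Set (Eucl n)} (hΓ : IsCompact Γ)
    (hΓd : IsDSet d Γ) (hd0 : 0 ≤ d) (hd : (n : ℝ) - 2 < d)
    {v : Lp ℂ 2 (volume : Measure (Eucl n))} {η η' : L2 d Γ} (h : HasTrace d Γ v η)
    (h' : HasTrace d Γ v η') : η = η' := by
  have : IsFiniteMeasure (surf d Γ) := ⟨surf_univ_lt_top hΓ hΓd⟩
  obtain ⟨C, hC, hCtr⟩ := exists_trace_le_h1Norm hd (surf_upperRegular hd0 hΓ hΓd)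
  obtain ⟨φ, h1, h2⟩ := h
  obtain ⟨φ', h1', h2'⟩ := h'
  have hsq : ∀ {f : ℕ → ℝ≥0∞}, Tendsto f atTop (𝓝 0) →
      Tendsto (fun j => f j ^ 2) atTop (𝓝 0) := by
    intro f hf
    simpa [Function.comp_def] using ((ENNReal.continuous_pow 2).tendsto 0).comp hf
  have h3 : Tendsto (fun j => eLpNorm (φ j - φ' j : 𝓢(Eucl n, ℂ)) 2 (surf d Γ)) atTop (𝓝 0) := by
    apply tendsto_zero_of_sq
    have hb : Tendsto (fun j => C * (2 * (h1Norm ((φ j).toLp 2 volume - v) ^ 2 +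
        h1Norm ((φ' j).toLp 2 volume - v) ^ 2))) atTop (𝓝 0) := by
      have := ENNReal.Tendsto.const_mul (a := C) (ENNReal.Tendsto.const_mul (a := 2)
        ((hsq h1).add (hsq h1')) (Or.inr (by norm_num))) (Or.inr hC)
      simpa using this
    refine tendsto_of_tendsto_of_tendsto_of_le_of_le tendsto_const_nhds hb
      (fun j => zero_le) (fun j => (hCtr _).trans ?_)
    have : (φ j - φ' j).toLp 2 volume =
        ((φ j).toLp 2 volume - v) - ((φ' j).toLp 2 volume - v) := by
      rw [sub_sub_sub_cancel_right]; rfl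
    rw [this]
    gcongr
    exact h1Norm_sub_sq_le _ _
  have hms : ∀ φ : 𝓢(Eucl n, ℂ), AEStronglyMeasurable φ (surf d Γ) := fun φ =>
    φ.continuous.aestronglyMeasurable
  have hmη : ∀ η : L2 d Γ, AEStronglyMeasurable η (surf d Γ) := fun η =>
    (Lp.stronglyMeasurable η).aestronglyMeasurable
  have h4 : ∀ j, eLpNorm (η - η' : Eucl n → ℂ) 2 (surf d Γ) ≤
      (eLpNorm (fun x => φ j x - η x) 2 (surf d Γ) + eLpNorm (φ j - φ' j : 𝓢(Eucl n, ℂ)) 2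
        (surf d Γ)) + eLpNorm (fun x => φ' j x - η' x) 2 (surf d Γ) := by
    intro j
    have e : (η - η' : Eucl n → ℂ) = ((φ j - φ' j : 𝓢(Eucl n, ℂ)) - fun x => φ j x - η x) +
        fun x => φ' j x - η' x := by
      ext x
      simp
    rw [e]
    refine (eLpNorm_add_le ((hms _).sub ((hms _).sub (hmη _))) ((hms _).sub (hmη _))
      (by norm_num)).trans (add_le_add ?_ le_rfl)
    rw [add_comm (eLpNorm (fun x => φ j x - η x) 2 (surf d Γ))]
    exact eLpNorm_sub_le (hms _) ((hms _).sub (hmη _)) (by norm_num)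
  have h5 : eLpNorm (η - η' : Eucl n → ℂ) 2 (surf d Γ) ≤ 0 := by
    have h6 := (h2.add h3).add h2'
    rw [add_zero, add_zero] at h6
    exact ge_of_tendsto' h6 h4
  apply Lp.ext
  have h6 := (eLpNorm_eq_zero_iff ((hmη η).sub (hmη η')) (by norm_num)).1 (le_antisymm h5 zero_le)
  filter_upwards [h6] with x hx
  exact sub_eq_zero.1 hx

theorem Lp.eq_of_integral_mul_schwartz_eq {v v' : Lp ℂ 2 (volume : Measure (Eucl n))}
    (h : ∀ φ : 𝓢(Eucl n, ℂ), ∫ x, v x * φ x = ∫ x, v' x * φ x) : v = v' := by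
  have hl : ∀ v : Lp ℂ 2 (volume : Measure (Eucl n)), LocallyIntegrable v volume := fun v =>
    (Lp.memLp v).locallyIntegrable (by norm_num)
  apply Lp.ext
  refine ae_eq_of_integral_contDiff_smul_eq (hl v) (hl v') fun g hg hgs => ?_
  have hgs' : HasCompactSupport fun x => (g x : ℂ) := hgs.comp_left (g := Complex.ofReal) rfl
  have hgs2 := h (hgs'.toSchwartzMap (Complex.ofRealCLM.contDiff.comp hg))
  have e : ∀ v : Lp ℂ 2 (volume : Measure (Eucl n)), ∫ x, g x • v x = ∫ x, v x *
      (hgs'.toSchwartzMap (Complex.ofRealCLM.contDiff.comp hg)) x := fun v =>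
    integral_congr_ae (Eventually.of_forall fun x => by
      simp only [Complex.real_smul]
      exact mul_comm _ _)
  rw [e, e, hgs2]

end DSetScattering

/-! ### Hankel's integral on a complex sector. -/

namespace DSetScattering

noncomputable section

/-- The integrand of Hankel's integral, for a complex argument `w`. -/
def hankelKer (β : ℝ) (w : ℂ) (t : ℝ) : ℂ :=
  ((Real.exp (-t) * t ^ β : ℝ) : ℂ) * (1 + Complex.I * (t / (2 * w))) ^ (β : ℂ)

/-- Hankel's integral, for a complex argument `w`. -/
def hankelInt (β : ℝ) (w : ℂ) : ℂ := ∫ t in Ioi (0 : ℝ), hankelKer β w t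

/-- The absolutely convergent integral that dominates Hankel's integral. -/
def hankelBound (β ρ : ℝ) : ℝ :=
  ∫ t in Ioi (0 : ℝ), Real.exp (-t) * t ^ β * (1 + t / (2 * ρ)) ^ β

/-- A sector around the positive half-axis. -/
def sector : Set ℂ := {w | 2 * |w.im| < w.re}

theorem isOpen_sector : IsOpen sector :=
  isOpen_lt (by fun_prop) Complex.continuous_re

theorem sector_re_pos {w : ℂ} (hw : w ∈ sector) : 0 < w.re :=
  lt_of_le_of_lt (by positivity) hw

theorem sector_ne_zero {w : ℂ} (hw : w ∈ sector) : w ≠ 0 := by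
  rintro rfl
  simpa using sector_re_pos hw

theorem ofReal_mem_sector {x : ℝ} (hx : 0 < x) : (x : ℂ) ∈ sector := by
  simpa [sector] using hx

theorem norm_I_mul_div {w : ℂ} {t : ℝ} (ht : 0 ≤ t) :
    ‖Complex.I * (t / (2 * w))‖ = t / (2 * ‖w‖) := by
  simp [abs_of_nonneg ht]

theorem re_I_mul_div (w : ℂ) (t : ℝ) :
    (Complex.I * (t / (2 * w))).re = t / 2 * (w.im / ‖w‖ ^ 2) := by
  have : (t / (2 * w) : ℂ) = ((t / 2 : ℝ) : ℂ) * w⁻¹ := by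
    rcases eq_or_ne w 0 with rfl | hw
    · simp
    · push_cast; field_simp
  rw [this, Complex.mul_re, Complex.I_re, Complex.I_im, zero_mul, one_mul, zero_sub,
    Complex.im_ofReal_mul, Complex.inv_im, Complex.normSq_eq_norm_sq]
  ring

theorem im_I_mul_div (w : ℂ) (t : ℝ) :
    (Complex.I * (t / (2 * w))).im = t / 2 * (w.re / ‖w‖ ^ 2) := by
  have : (t / (2 * w) : ℂ) = ((t / 2 : ℝ) : ℂ) * w⁻¹ := by
    rcases eq_or_ne w 0 with rfl | hw
    · simp
    · push_cast; field_simp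
  rw [this, Complex.mul_im, Complex.I_re, Complex.I_im, zero_mul, one_mul, zero_add,
    Complex.re_ofReal_mul, Complex.inv_re, Complex.normSq_eq_norm_sq]

theorem one_add_mem_slitPlane {w : ℂ} (hw : w ∈ sector) {t : ℝ} (ht : 0 < t) :
    1 + Complex.I * (t / (2 * w)) ∈ Complex.slitPlane := by
  right
  have h0 := sector_re_pos hw
  have h1 : 0 < ‖w‖ := norm_pos_iff.2 (sector_ne_zero hw)
  rw [Complex.add_im, Complex.one_im, zero_add, im_I_mul_div]
  positivity

theorem norm_one_add_le {w : ℂ} {t : ℝ} (ht : 0 ≤ t) :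
    ‖1 + Complex.I * (t / (2 * w))‖ ≤ 1 + t / (2 * ‖w‖) :=
  (norm_add_le _ _).trans (by rw [norm_I_mul_div ht, norm_one])

/-- With `q = i t / (2w)` and `u = |q|`, the sector forces `Re q ≥ -u/2`, so `|1 + q|² ≥ 1 - u +
u²`, which exceeds `(1 + u)²/4` by `3(u - 1)²/4`. Hence `|1 + q|` and `1 + u` are comparable, and
powers of either sign can be bounded. -/
theorem le_norm_one_add {w : ℂ} (hw : w ∈ sector) {t : ℝ} (ht : 0 ≤ t) :
    (1 + t / (2 * ‖w‖)) / 2 ≤ ‖1 + Complex.I * (t / (2 * w))‖ := by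
  have h1 : 0 < ‖w‖ := norm_pos_iff.2 (sector_ne_zero hw)
  have him : 2 * |w.im| ≤ ‖w‖ := (le_of_lt hw).trans (Complex.re_le_norm w)
  set q := Complex.I * (t / (2 * w)) with hq
  set u := t / (2 * ‖w‖) with hu
  have hu0 : 0 ≤ u := by positivity
  have hqn : ‖q‖ = u := norm_I_mul_div ht
  have hre : -(u / 2) ≤ q.re := by
    rw [hq, re_I_mul_div]
    have h2 : -(‖w‖ / 2) ≤ w.im := by linarith [neg_abs_le w.im]
    have h3 : -(u / 2) = t / 2 * (-(‖w‖ / 2) / ‖w‖ ^ 2) := by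
      rw [hu]; field_simp
    rw [h3]
    gcongr
  have hsq : ‖1 + q‖ ^ 2 = 1 + 2 * q.re + u ^ 2 := by
    rw [← hqn, ← Complex.normSq_eq_norm_sq, ← Complex.normSq_eq_norm_sq, Complex.normSq_apply,
      Complex.normSq_apply]
    simp
    ring
  refine le_of_sq_le_sq ?_ (norm_nonneg _)
  nlinarith [sq_nonneg (u - 1)]

theorem rpow_le_two_rpow_mul {β a b : ℝ} (hb : 1 ≤ b) (h1 : b / 2 ≤ a) (h2 : a ≤ b) :
    a ^ β ≤ 2 ^ |β| * b ^ β := by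
  have ha : 0 < a := by linarith
  have hb0 : 0 < b := by linarith
  rcases le_total 0 β with hβ | hβ
  · rw [abs_of_nonneg hβ]
    calc a ^ β ≤ b ^ β := Real.rpow_le_rpow ha.le h2 hβ
      _ ≤ _ := le_mul_of_one_le_left (by positivity) (Real.one_le_rpow (by norm_num) hβ)
  · rw [abs_of_nonpos hβ]
    calc a ^ β ≤ (b / 2) ^ β := Real.rpow_le_rpow_of_nonpos (by positivity) h1 hβ
      _ = _ := by
        rw [div_eq_inv_mul, Real.mul_rpow (by norm_num) hb0.le, Real.inv_rpow (by norm_num),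
          ← Real.rpow_neg (by norm_num)]

theorem norm_one_add_cpow_le {w : ℂ} (hw : w ∈ sector) {t : ℝ} (ht : 0 ≤ t) (β : ℝ) :
    ‖(1 + Complex.I * (t / (2 * w))) ^ (β : ℂ)‖ ≤ 2 ^ |β| * (1 + t / (2 * ‖w‖)) ^ β := by
  rw [Complex.norm_cpow_real]
  refine rpow_le_two_rpow_mul ?_ (le_norm_one_add hw ht) (norm_one_add_le ht)
  have : 0 ≤ t / (2 * ‖w‖) := by positivity
  linarith

theorem norm_hankelKer_le {w : ℂ} (hw : w ∈ sector) {t : ℝ} (ht : 0 ≤ t) (β : ℝ) :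
    ‖hankelKer β w t‖ ≤ 2 ^ |β| * (Real.exp (-t) * t ^ β * (1 + t / (2 * ‖w‖)) ^ β) := by
  rw [hankelKer, norm_mul, Complex.norm_real, Real.norm_of_nonneg (by positivity), mul_left_comm]
  gcongr
  exact norm_one_add_cpow_le hw ht β

/-- The derivative of `hankelKer` in its complex argument. -/
def hankelKerDeriv (β : ℝ) (w : ℂ) (t : ℝ) : ℂ :=
  ((Real.exp (-t) * t ^ β : ℝ) : ℂ) * (β * (1 + Complex.I * (t / (2 * w))) ^ ((β : ℂ) - 1) *
    -(Complex.I * (t / (2 * w)) / w))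

theorem hasDerivAt_hankelKer {w : ℂ} (hw : w ∈ sector) {t : ℝ} (ht : 0 < t) (β : ℝ) :
    HasDerivAt (fun w => hankelKer β w t) (hankelKerDeriv β w t) w := by
  have hw0 := sector_ne_zero hw
  have h1 : HasDerivAt (fun w : ℂ => 1 + Complex.I * (t / (2 * w)))
      (-(Complex.I * (t / (2 * w)) / w)) w := by
    have h2 := (((hasDerivAt_inv hw0).const_mul (Complex.I * t / 2)).const_add 1)
    have e1 : (fun w : ℂ => 1 + Complex.I * (t / (2 * w))) =
        fun w => 1 + Complex.I * t / 2 * w⁻¹ := by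
      ext z
      rw [div_eq_mul_inv, mul_inv]
      ring
    have e2 : -(Complex.I * (t / (2 * w)) / w) = Complex.I * t / 2 * -(w ^ 2)⁻¹ := by
      field_simp
    rw [e1, e2]
    exact h2
  exact (h1.cpow_const (one_add_mem_slitPlane hw ht)).const_mul _

/-- Differentiation in `w` produces the factor `-β q / ((1 + q) w)`, and `|q| / |1 + q| ≤ 2` on the
sector: a derivative costs only `1/|w|`. -/
theorem norm_hankelKerDeriv_le {w : ℂ} (hw : w ∈ sector) {t : ℝ} (ht : 0 < t) (β : ℝ) :
    ‖hankelKerDeriv β w t‖ ≤ 2 * |β| * 2 ^ |β| / ‖w‖ *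
      (Real.exp (-t) * t ^ β * (1 + t / (2 * ‖w‖)) ^ β) := by
  have h1 : 0 < ‖w‖ := norm_pos_iff.2 (sector_ne_zero hw)
  have hz := le_norm_one_add hw ht.le
  have hcp := norm_one_add_cpow_le hw ht.le β
  have hq := norm_I_mul_div (w := w) ht.le
  set q := Complex.I * (t / (2 * w))
  set u := t / (2 * ‖w‖)
  have hu0 : 0 ≤ u := by positivity
  have hz0 : 1 + q ≠ 0 := by
    rw [← norm_pos_iff]; linarith
  have hzp : 0 < ‖1 + q‖ := norm_pos_iff.2 hz0
  rw [hankelKerDeriv, norm_mul, Complex.norm_real, Real.norm_of_nonneg (by positivity), norm_mul,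
    norm_mul, norm_neg, norm_div, hq, Complex.norm_real, Complex.cpow_sub _ _ hz0, norm_div,
    Complex.cpow_one, Real.norm_eq_abs]
  have h3 : u / ‖1 + q‖ ≤ 2 := by
    rw [div_le_iff₀ hzp]; linarith
  calc _ = Real.exp (-t) * t ^ β * (|β| / ‖w‖ * (‖(1 + q) ^ (β : ℂ)‖ * (u / ‖1 + q‖))) := by
        field_simp
    _ ≤ Real.exp (-t) * t ^ β * (|β| / ‖w‖ * ((2 ^ |β| * (1 + u) ^ β) * 2)) := by
        gcongr
    _ = _ := by ring

theorem one_add_rpow_le {p u : ℝ} (hp : 0 ≤ p) (hu : 0 ≤ u) :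
    (1 + u) ^ p ≤ 2 ^ p * (1 + u ^ p) := by
  have h0 : 0 ≤ u ^ p := by positivity
  rcases le_total u 1 with h | h
  · calc (1 + u) ^ p ≤ 2 ^ p := Real.rpow_le_rpow (by positivity) (by linarith) hp
      _ ≤ _ := le_mul_of_one_le_right (by positivity) (by linarith)
  · calc (1 + u) ^ p ≤ (2 * u) ^ p := Real.rpow_le_rpow (by positivity) (by linarith) hp
      _ = 2 ^ p * u ^ p := Real.mul_rpow (by norm_num) hu
      _ ≤ _ := by gcongr; linarith

theorem integrableOn_exp_neg_mul_rpow {β : ℝ} (hβ : -1 < β) :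
    IntegrableOn (fun t : ℝ => Real.exp (-t) * t ^ β) (Ioi 0) := by
  simpa using Real.GammaIntegral_convergent (s := β + 1) (by linarith)

theorem integrableOn_hankel_majorant {β p c : ℝ} (hβ : -1 < β) (hp : 0 ≤ p) (hc : 0 ≤ c) :
    IntegrableOn (fun t : ℝ => Real.exp (-t) * t ^ β * (1 + c * t) ^ p) (Ioi 0) := by
  have h1 := (integrableOn_exp_neg_mul_rpow hβ).const_mul (2 ^ p)
  have h2 := (integrableOn_exp_neg_mul_rpow (β := β + p) (by linarith)).const_mul (2 ^ p * c ^ p)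
  refine (h1.add h2).mono' ?_ ?_
  · refine ContinuousOn.aestronglyMeasurable (fun t ht => ContinuousAt.continuousWithinAt ?_)
      measurableSet_Ioi
    have h0 : (0 : ℝ) < t := ht
    have h3 : 1 + c * t ≠ 0 := by positivity
    exact ((by fun_prop : ContinuousAt (fun t : ℝ => Real.exp (-t)) t).mul
      (Real.continuousAt_rpow_const t β (Or.inl h0.ne'))).mul
      ((by fun_prop : ContinuousAt (fun t : ℝ => 1 + c * t) t).rpow_const (Or.inl h3))
  · filter_upwards [ae_restrict_mem measurableSet_Ioi] with t ht
    have h0 : (0 : ℝ) < t := ht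
    rw [Real.norm_of_nonneg (by positivity)]
    calc _ ≤ Real.exp (-t) * t ^ β * (2 ^ p * (1 + (c * t) ^ p)) := by
          gcongr
          exact one_add_rpow_le hp (by positivity)
      _ = _ := by
        rw [Real.mul_rpow hc h0.le, Pi.add_apply, Real.rpow_add h0]
        ring

theorem integrableOn_hankelBound {β ρ : ℝ} (hβ : -1 < β) (hρ : 0 < ρ) :
    IntegrableOn (fun t : ℝ => Real.exp (-t) * t ^ β * (1 + t / (2 * ρ)) ^ β) (Ioi 0) := by
  refine (integrableOn_hankel_majorant hβ (abs_nonneg β)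
    (c := 1 / (2 * ρ)) (by positivity)).mono' ?_ ?_
  · refine ContinuousOn.aestronglyMeasurable (fun t ht => ContinuousAt.continuousWithinAt ?_)
      measurableSet_Ioi
    have h0 : (0 : ℝ) < t := ht
    have h3 : 1 + t / (2 * ρ) ≠ 0 := by positivity
    exact ((by fun_prop : ContinuousAt (fun t : ℝ => Real.exp (-t)) t).mul
      (Real.continuousAt_rpow_const t β (Or.inl h0.ne'))).mul
      ((by fun_prop : ContinuousAt (fun t : ℝ => 1 + t / (2 * ρ)) t).rpow_const (Or.inl h3))
  · filter_upwards [ae_restrict_mem measurableSet_Ioi] with t ht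
    have h0 : (0 : ℝ) < t := ht
    rw [Real.norm_of_nonneg (by positivity), one_div_mul_eq_div]
    gcongr
    · have : 0 ≤ t / (2 * ρ) := by positivity
      linarith
    · exact le_abs_self β

theorem aestronglyMeasurable_hankelKer {β : ℝ} {w : ℂ} (hw : w ∈ sector) :
    AEStronglyMeasurable (hankelKer β w) (volume.restrict (Ioi 0)) := by
  refine ContinuousOn.aestronglyMeasurable (fun t ht => ContinuousAt.continuousWithinAt ?_)
    measurableSet_Ioi
  have h0 : (0 : ℝ) < t := ht
  have h1 : ContinuousAt (fun t : ℝ => Real.exp (-t) * t ^ β) t :=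
    (by fun_prop : ContinuousAt (fun t : ℝ => Real.exp (-t)) t).mul
      (Real.continuousAt_rpow_const t β (Or.inl h0.ne'))
  have h2 : ContinuousAt (fun t : ℝ => 1 + Complex.I * (t / (2 * w))) t := by fun_prop
  exact (Complex.continuous_ofReal.continuousAt.comp h1).mul
    (h2.cpow continuousAt_const (one_add_mem_slitPlane hw h0))

theorem aestronglyMeasurable_hankelKerDeriv {β : ℝ} {w : ℂ} (hw : w ∈ sector) :
    AEStronglyMeasurable (hankelKerDeriv β w) (volume.restrict (Ioi 0)) := by
  refine ContinuousOn.aestronglyMeasurable (fun t ht => ContinuousAt.continuousWithinAt ?_)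
    measurableSet_Ioi
  have h0 : (0 : ℝ) < t := ht
  have h1 : ContinuousAt (fun t : ℝ => Real.exp (-t) * t ^ β) t :=
    (by fun_prop : ContinuousAt (fun t : ℝ => Real.exp (-t)) t).mul
      (Real.continuousAt_rpow_const t β (Or.inl h0.ne'))
  have h2 : ContinuousAt (fun t : ℝ => 1 + Complex.I * (t / (2 * w))) t := by fun_prop
  exact (Complex.continuous_ofReal.continuousAt.comp h1).mul
    ((continuousAt_const.mul (h2.cpow continuousAt_const (one_add_mem_slitPlane hw h0))).mul (by fun_prop))

theorem integrable_hankelKer {β : ℝ} (hβ : -1 < β) {w : ℂ} (hw : w ∈ sector) :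
    IntegrableOn (hankelKer β w) (Ioi 0) := by
  have h1 : 0 < ‖w‖ := norm_pos_iff.2 (sector_ne_zero hw)
  refine ((integrableOn_hankelBound hβ h1).const_mul (2 ^ |β|)).mono'
    (aestronglyMeasurable_hankelKer hw) ?_
  filter_upwards [ae_restrict_mem measurableSet_Ioi] with t ht
  exact norm_hankelKer_le hw (le_of_lt ht) β

theorem norm_hankelInt_le {β : ℝ} (hβ : -1 < β) {w : ℂ} (hw : w ∈ sector) :
    ‖hankelInt β w‖ ≤ 2 ^ |β| * hankelBound β ‖w‖ := by
  have h1 : 0 < ‖w‖ := norm_pos_iff.2 (sector_ne_zero hw)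
  rw [hankelInt, hankelBound, ← integral_const_mul]
  refine norm_integral_le_of_norm_le ((integrableOn_hankelBound hβ h1).const_mul _) ?_
  filter_upwards [ae_restrict_mem measurableSet_Ioi] with t ht
  exact norm_hankelKer_le hw (le_of_lt ht) β

theorem exists_hasDerivAt_hankelInt {β : ℝ} (hβ : -1 < β) {w : ℂ} (hw : w ∈ sector) :
    ∃ F' : ℂ, HasDerivAt (hankelInt β) F' w ∧
      ‖F'‖ ≤ 2 * |β| * 2 ^ |β| / ‖w‖ * hankelBound β ‖w‖ := by
  have h1 : 0 < ‖w‖ := norm_pos_iff.2 (sector_ne_zero hw)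
  have hs : sector ∩ Metric.ball w (‖w‖ / 2) ∈ 𝓝 w :=
    inter_mem (isOpen_sector.mem_nhds hw) (Metric.ball_mem_nhds _ (by positivity))
  refine ⟨∫ t in Ioi (0 : ℝ), hankelKerDeriv β w t,
    (hasDerivAt_integral_of_dominated_loc_of_deriv_le (F := hankelKer β) (F' := hankelKerDeriv β)
      -- On the ball of radius `|w|/2` about `w` one has `|z| ≥ |w|/2`; the exponent `|β|` makes the
      -- power monotone in its base.
      (bound := fun t => 2 * |β| * 2 ^ |β| / (‖w‖ / 2) *
        (Real.exp (-t) * t ^ β * (1 + (1 / ‖w‖) * t) ^ |β|)) hs ?_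
      (integrable_hankelKer hβ hw) (aestronglyMeasurable_hankelKerDeriv hw) ?_ ?_ ?_).2, ?_⟩
  · filter_upwards [isOpen_sector.mem_nhds hw] with z hz
    exact aestronglyMeasurable_hankelKer hz
  · filter_upwards [ae_restrict_mem measurableSet_Ioi] with t ht z hz
    have h0 : (0 : ℝ) < t := ht
    have hzw : ‖w‖ / 2 ≤ ‖z‖ := by
      have := hz.2
      rw [mem_ball_iff_norm'] at this
      have h3 := norm_sub_norm_le w z
      linarith
    have h4 : t / (2 * ‖z‖) ≤ 1 / ‖w‖ * t := by
      rw [one_div_mul_eq_div]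
      gcongr
      linarith
    have h5 : 0 ≤ t / (2 * ‖z‖) := by positivity
    refine (norm_hankelKerDeriv_le hz.1 h0 β).trans ?_
    gcongr
    calc (1 + t / (2 * ‖z‖)) ^ β ≤ (1 + t / (2 * ‖z‖)) ^ |β| :=
          Real.rpow_le_rpow_of_exponent_le (by linarith) (le_abs_self β)
      _ ≤ _ := by gcongr
  · exact (integrableOn_hankel_majorant hβ (abs_nonneg β) (by positivity)).const_mul _
  · filter_upwards [ae_restrict_mem measurableSet_Ioi] with t ht z hz
    exact hasDerivAt_hankelKer hz.1 ht β
  · rw [hankelBound, ← integral_const_mul]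
    refine norm_integral_le_of_norm_le ((integrableOn_hankelBound hβ h1).const_mul _) ?_
    filter_upwards [ae_restrict_mem measurableSet_Ioi] with t ht
    exact norm_hankelKerDeriv_le hw ht β

/-- The reason for a complex argument: one complex derivative on an open sector gives analyticity,
hence smoothness on the half-axis. -/
theorem contDiffAt_hankelInt_ofReal {β : ℝ} (hβ : -1 < β) {x : ℝ} (hx : 0 < x) :
    ContDiffAt ℝ ∞ (fun x : ℝ => hankelInt β x) x := by
  have hd : DifferentiableOn ℂ (hankelInt β) sector := fun w hw =>
    (exists_hasDerivAt_hankelInt hβ hw).choose_spec.1.differentiableAt.differentiableWithinAt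
  have ha : ContDiffAt ℂ ∞ (hankelInt β) x :=
    (hd.analyticAt (isOpen_sector.mem_nhds (ofReal_mem_sector hx))).contDiffAt
  exact (ha.restrict_scalars ℝ).comp x Complex.ofRealCLM.contDiff.contDiffAt

theorem hankelBound_nonneg {β ρ : ℝ} (hρ : 0 < ρ) : 0 ≤ hankelBound β ρ := by
  refine setIntegral_nonneg measurableSet_Ioi fun t ht => ?_
  have h0 : (0 : ℝ) < t := ht
  positivity

/-- For `n ≥ 3`: splitting the power by `one_add_rpow_le` leaves two Gamma integrals. -/
theorem exists_hankelBound_le {β : ℝ} (hβ : 0 ≤ β) :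
    ∃ C : ℝ, 0 ≤ C ∧ ∀ ρ : ℝ, 0 < ρ → hankelBound β ρ ≤ C * (1 + ρ ^ (-β)) := by
  have i1 := integrableOn_exp_neg_mul_rpow (β := β) (by linarith)
  have i2 := integrableOn_exp_neg_mul_rpow (β := β + β) (by linarith)
  have n1 : 0 ≤ ∫ t in Ioi (0 : ℝ), Real.exp (-t) * t ^ β :=
    setIntegral_nonneg measurableSet_Ioi fun t ht => by
      have h0 : (0 : ℝ) < t := ht
      positivity
  have n2 : 0 ≤ ∫ t in Ioi (0 : ℝ), Real.exp (-t) * t ^ (β + β) :=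
    setIntegral_nonneg measurableSet_Ioi fun t ht => by
      have h0 : (0 : ℝ) < t := ht
      positivity
  set I₁ := ∫ t in Ioi (0 : ℝ), Real.exp (-t) * t ^ β
  set I₂ := ∫ t in Ioi (0 : ℝ), Real.exp (-t) * t ^ (β + β)
  refine ⟨2 ^ β * (I₁ + I₂), by positivity, fun ρ hρ => ?_⟩
  calc hankelBound β ρ ≤ ∫ t in Ioi (0 : ℝ), (2 ^ β * (Real.exp (-t) * t ^ β) +
        2 ^ β * ρ ^ (-β) * (Real.exp (-t) * t ^ (β + β))) := by
        refine setIntegral_mono_on (integrableOn_hankelBound (by linarith) hρ)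
          ((i1.const_mul _).add (i2.const_mul _)) measurableSet_Ioi fun t ht => ?_
        have h0 : (0 : ℝ) < t := ht
        calc _ ≤ Real.exp (-t) * t ^ β * (2 ^ β * (1 + (t / ρ) ^ β)) := by
              gcongr
              refine (one_add_rpow_le hβ (by positivity)).trans ?_
              gcongr
              linarith
          _ = _ := by
            rw [Real.div_rpow h0.le hρ.le, Real.rpow_add h0, Real.rpow_neg hρ.le]
            ring
    _ = 2 ^ β * I₁ + 2 ^ β * ρ ^ (-β) * I₂ := by
        rw [integral_add (i1.const_mul _) (i2.const_mul _), integral_const_mul,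
          integral_const_mul]
    _ ≤ _ := by
        have h3 : 0 ≤ ρ ^ (-β) := by positivity
        have h4 : (0 : ℝ) ≤ 2 ^ β := by positivity
        have h5 : 0 ≤ 2 ^ β * I₁ * ρ ^ (-β) := by positivity
        have h6 : 0 ≤ 2 ^ β * I₂ := by positivity
        nlinarith

/-- For `n = 2`, where `β = -1/2`: `(1 + u)^β ≤ (1 + u)^(-θ) ≤ u^(-θ)` trades integrability at `t =
0` for a power of `ρ`. There the range is `0 ≤ θ < 1/2`; at the endpoint the Gamma integral
diverges, a trace of the logarithmic singularity. -/
theorem exists_hankelBound_le_of_neg {β θ : ℝ} (hβ : -1 < β) (hθ : 0 ≤ θ) (hθβ : θ ≤ -β)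
    (hθ1 : θ < 1 + β) :
    ∃ C : ℝ, 0 ≤ C ∧ ∀ ρ : ℝ, 0 < ρ → hankelBound β ρ ≤ C * ρ ^ θ := by
  have i1 := integrableOn_exp_neg_mul_rpow (β := β - θ) (by linarith)
  have n1 : 0 ≤ ∫ t in Ioi (0 : ℝ), Real.exp (-t) * t ^ (β - θ) :=
    setIntegral_nonneg measurableSet_Ioi fun t ht => by
      have h0 : (0 : ℝ) < t := ht
      positivity
  set I₁ := ∫ t in Ioi (0 : ℝ), Real.exp (-t) * t ^ (β - θ) with hI₁
  refine ⟨2 ^ θ * I₁, by positivity, fun ρ hρ => ?_⟩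
  calc hankelBound β ρ ≤ ∫ t in Ioi (0 : ℝ), (2 ^ θ * ρ ^ θ) * (Real.exp (-t) * t ^ (β - θ)) := by
        refine setIntegral_mono_on (integrableOn_hankelBound hβ hρ)
          (i1.const_mul _) measurableSet_Ioi fun t ht => ?_
        have h0 : (0 : ℝ) < t := ht
        have hu : 0 < t / (2 * ρ) := by positivity
        calc _ ≤ Real.exp (-t) * t ^ β * (t / (2 * ρ)) ^ (-θ) := by
              gcongr
              calc (1 + t / (2 * ρ)) ^ β ≤ (1 + t / (2 * ρ)) ^ (-θ) :=
                    Real.rpow_le_rpow_of_exponent_le (by linarith) (by linarith)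
                _ ≤ _ := Real.rpow_le_rpow_of_nonpos hu (by linarith) (by linarith)
          _ = _ := by
            rw [Real.div_rpow h0.le (by positivity), sub_eq_add_neg, Real.rpow_add h0,
              Real.rpow_neg (by positivity : 0 ≤ 2 * ρ), Real.mul_rpow (by norm_num) hρ.le]
            field_simp
    _ = _ := by
        rw [integral_const_mul]
        ring

end

end DSetScattering

/-! ### Size of the fundamental solution and of its radial derivative. -/

namespace DSetScattering

noncomputable section

/-- The fundamental solution as a function of the distance. -/
def radial (n : ℕ) (k r : ℝ) : ℂ :=
  Complex.I / 4 * (((k / (2 * Real.pi * r)) ^ (((n : ℝ) - 2) / 2) : ℝ) : ℂ)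
    * hankelOne (((n : ℝ) - 2) / 2) (k * r)

theorem fundSol_eq_radial {n : ℕ} (k : ℝ) (x y : Eucl n) :
    fundSol k x y = radial n k (dist x y) := rfl

/-- Division by zero gives `√(2 / 0) = 0`, so the kernel is harmless on the diagonal. -/
theorem radial_zero (n : ℕ) (k : ℝ) : radial n k 0 = 0 := by
  simp [radial, hankelOne]

theorem hankelOne_eq (ν z : ℝ) : hankelOne ν z = (Real.sqrt (2 / (Real.pi * z)) : ℂ)
    * Complex.exp (Complex.I * ((z - ν * Real.pi / 2 - Real.pi / 4 : ℝ) : ℂ))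
    / (Real.Gamma (ν + 1 / 2) : ℂ) * hankelInt (ν - 1 / 2) z := by
  simp only [hankelOne, hankelInt, hankelKer]
  push_cast
  rfl

/-- The powers combine as `(k/r)^ν (k r)^(-1/2) = k^(ν-1/2) r^(-(ν+1/2))`. The constant `A` does not
depend on `k`, and the phase has modulus one. -/
theorem exists_radial_eq (n : ℕ) :
    ∃ A : ℝ, 0 ≤ A ∧ ∀ k : ℝ, 0 < k → ∃ c : ℂ, ‖c‖ = A * k ^ (((n : ℝ) - 3) / 2) ∧
      ∀ r : ℝ, 0 < r → radial n k r = c * ((r ^ (-(((n : ℝ) - 1) / 2)) : ℝ) : ℂ) *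
        Complex.exp (Complex.I * ((k * r : ℝ) : ℂ)) *
          hankelInt (((n : ℝ) - 3) / 2) ((k * r : ℝ) : ℂ) := by
  set ν : ℝ := ((n : ℝ) - 2) / 2 with hν
  have e1 : ((n : ℝ) - 3) / 2 = ν - 1 / 2 := by rw [hν]; ring
  have e2 : ((n : ℝ) - 1) / 2 = ν + 1 / 2 := by rw [hν]; ring
  set B : ℝ := (2 * Real.pi) ^ (-ν) * Real.sqrt (2 / Real.pi) with hB
  have hB0 : 0 ≤ B := by positivity
  refine ⟨1 / 4 * B / |Real.Gamma (ν + 1 / 2)|, by positivity, fun k hk => ?_⟩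
  refine ⟨Complex.I / 4 * ((k ^ (ν - 1 / 2) * B : ℝ) : ℂ) *
    Complex.exp (Complex.I * ((-(ν * Real.pi / 2) - Real.pi / 4 : ℝ) : ℂ)) /
      (Real.Gamma (ν + 1 / 2) : ℂ), ?_, fun r hr => ?_⟩
  · rw [norm_div, norm_mul, norm_mul, mul_comm Complex.I (_ : ℂ), Complex.norm_exp_ofReal_mul_I,
      Complex.norm_real, Complex.norm_real, Real.norm_of_nonneg (by positivity), norm_div,
      Complex.norm_I, Real.norm_eq_abs, e1]
    norm_num
    ring
  · have h1 : (k / (2 * Real.pi * r)) ^ ν * Real.sqrt (2 / (Real.pi * (k * r))) =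
        k ^ (ν - 1 / 2) * B * r ^ (-(ν + 1 / 2)) := by
      rw [show 2 / (Real.pi * (k * r)) = (2 / Real.pi) * (k * r)⁻¹ by field_simp,
        Real.sqrt_mul (by positivity), Real.sqrt_inv, Real.sqrt_eq_rpow (k * r),
        Real.mul_rpow hk.le hr.le, Real.div_rpow hk.le (by positivity),
        Real.mul_rpow (by positivity) hr.le, hB, Real.rpow_sub hk, Real.rpow_neg hr.le,
        Real.rpow_add hr, Real.rpow_neg (by positivity)]
      field_simp
    have h2 : Complex.exp (Complex.I * ((k * r - ν * Real.pi / 2 - Real.pi / 4 : ℝ) : ℂ)) =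
        Complex.exp (Complex.I * ((k * r : ℝ) : ℂ)) *
        Complex.exp (Complex.I * ((-(ν * Real.pi / 2) - Real.pi / 4 : ℝ) : ℂ)) := by
      rw [← Complex.exp_add]
      congr 1
      push_cast
      ring
    rw [radial, hankelOne_eq, ← hν, h2, e1, e2]
    have h3 := congrArg (fun x : ℝ => (x : ℂ)) h1
    simp only [Complex.ofReal_mul] at h3 ⊢
    linear_combination (Complex.I / 4 * Complex.exp (Complex.I * (k * r)) *
      Complex.exp (Complex.I * ((-(ν * Real.pi / 2) - Real.pi / 4 : ℝ) : ℂ)) /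
      (Real.Gamma (ν + 1 / 2) : ℂ) * hankelInt (ν - 1 / 2) (k * r)) * h3

theorem neg_one_lt_hankel_exponent {n : ℕ} (hn : 2 ≤ n) : -1 < ((n : ℝ) - 3) / 2 := by
  have : (2 : ℝ) ≤ n := by exact_mod_cast hn
  linarith

theorem contDiffAt_radial {n : ℕ} (hn : 2 ≤ n) {k r : ℝ} (hk : 0 < k) (hr : 0 < r) :
    ContDiffAt ℝ ∞ (radial n k) r := by
  obtain ⟨A, -, hA⟩ := exists_radial_eq n
  obtain ⟨c, -, hc⟩ := hA k hk
  have hev : radial n k =ᶠ[𝓝 r] fun r => c * ((r ^ (-(((n : ℝ) - 1) / 2)) : ℝ) : ℂ) *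
        Complex.exp (Complex.I * ((k * r : ℝ) : ℂ)) *
          hankelInt (((n : ℝ) - 3) / 2) ((k * r : ℝ) : ℂ) := by
    filter_upwards [lt_mem_nhds hr] with s hs using hc s hs
  refine ContDiffAt.congr_of_eventuallyEq ?_ hev
  have hkr : ContDiffAt ℝ ∞ (fun r : ℝ => k * r) r := contDiffAt_const.mul contDiffAt_id
  refine ((contDiffAt_const.mul ?_).mul ?_).mul ?_
  · exact Complex.ofRealCLM.contDiff.contDiffAt.comp r
      (contDiffAt_id.rpow_const_of_ne hr.ne')
  · exact (contDiffAt_const.mul (Complex.ofRealCLM.contDiff.contDiffAt.comp r hkr)).cexp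
  · exact ContDiffAt.comp (g := fun x : ℝ => hankelInt (((n : ℝ) - 3) / 2) x) r
      (contDiffAt_hankelInt_ofReal (neg_one_lt_hankel_exponent hn) (mul_pos hk hr)) hkr

/-- In the product rule the power and Hankel's integral each contribute a factor of order `1/r`, and
the oscillation contributes `k`; together these are controlled by `(1 + k r)/r`. -/
theorem exists_norm_radial_le {n : ℕ} (hn : 2 ≤ n) :
    ∃ B : ℝ, 0 ≤ B ∧ ∀ k r : ℝ, 0 < k → 0 < r →
      ‖radial n k r‖ ≤ B * k ^ (((n : ℝ) - 3) / 2) * r ^ (-(((n : ℝ) - 1) / 2)) *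
        hankelBound (((n : ℝ) - 3) / 2) (k * r) ∧
      ‖deriv (radial n k) r‖ ≤ B * k ^ (((n : ℝ) - 3) / 2) * r ^ (-(((n : ℝ) - 1) / 2)) *
        hankelBound (((n : ℝ) - 3) / 2) (k * r) * ((1 + k * r) * r⁻¹) := by
  obtain ⟨A, hA0, hA⟩ := exists_radial_eq n
  have hβ := neg_one_lt_hankel_exponent hn
  set β : ℝ := ((n : ℝ) - 3) / 2
  set m : ℝ := ((n : ℝ) - 1) / 2 with hm
  have hm0 : 0 ≤ m := by
    have : (2 : ℝ) ≤ n := by exact_mod_cast hn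
    rw [hm]; linarith
  set C₀ : ℝ := 2 ^ |β|
  have hC₀ : 0 ≤ C₀ := by positivity
  set C₁ : ℝ := 2 * |β| * 2 ^ |β|
  have hC₁ : 0 ≤ C₁ := by positivity
  refine ⟨A * (C₀ + m * C₀ + C₁), by positivity, fun k r hk hr => ?_⟩
  obtain ⟨c, hcn, hc⟩ := hA k hk
  have hkr : 0 < k * r := mul_pos hk hr
  have hsec := ofReal_mem_sector hkr
  have hJ : 0 ≤ hankelBound β (k * r) := hankelBound_nonneg hkr
  have hF := norm_hankelInt_le hβ hsec
  obtain ⟨F', hF', hF'n⟩ := exists_hasDerivAt_hankelInt hβ hsec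
  have hnkr : ‖((k * r : ℝ) : ℂ)‖ = k * r := by
    rw [Complex.norm_real, Real.norm_of_nonneg hkr.le]
  rw [hnkr] at hF hF'n
  set J := hankelBound β (k * r)
  have hexp : ‖Complex.exp (Complex.I * ((k * r : ℝ) : ℂ))‖ = 1 := by
    rw [mul_comm, Complex.norm_exp_ofReal_mul_I]
  have hpn : ‖((r ^ (-m) : ℝ) : ℂ)‖ = r ^ (-m) := by
    rw [Complex.norm_real, Real.norm_of_nonneg (by positivity)]
  have hk0 : 0 ≤ k ^ β := by positivity
  have hr0 : 0 ≤ r ^ (-m) := by positivity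
  constructor
  · rw [hc r hr, norm_mul, norm_mul, norm_mul, hexp, hpn, hcn, mul_one]
    calc A * k ^ β * r ^ (-m) * ‖hankelInt β ((k * r : ℝ) : ℂ)‖
        ≤ A * k ^ β * r ^ (-m) * (C₀ * J) := by gcongr
      _ = A * C₀ * (k ^ β * r ^ (-m) * J) := by ring
      _ ≤ A * (C₀ + m * C₀ + C₁) * (k ^ β * r ^ (-m) * J) := by
          gcongr
          have : 0 ≤ m * C₀ := by positivity
          linarith
      _ = _ := by ring
  · have hev : radial n k =ᶠ[𝓝 r] fun r => c * ((r ^ (-m) : ℝ) : ℂ) *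
        Complex.exp (Complex.I * ((k * r : ℝ) : ℂ)) * hankelInt β ((k * r : ℝ) : ℂ) := by
      filter_upwards [lt_mem_nhds hr] with s hs using hc s hs
    have d0 : HasDerivAt (fun r : ℝ => k * r) k r := by
      simpa using (hasDerivAt_id r).const_mul k
    have d1 : HasDerivAt (fun r : ℝ => c * ((r ^ (-m) : ℝ) : ℂ))
        (c * ((-m * r ^ (-m - 1) : ℝ) : ℂ)) r :=
      (Real.hasDerivAt_rpow_const (Or.inl hr.ne')).ofReal_comp.const_mul c
    have d2 : HasDerivAt (fun r : ℝ => Complex.exp (Complex.I * ((k * r : ℝ) : ℂ)))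
        (Complex.exp (Complex.I * ((k * r : ℝ) : ℂ)) * (Complex.I * (k : ℂ))) r :=
      (d0.ofReal_comp.const_mul Complex.I).cexp
    have d3 : HasDerivAt (fun r : ℝ => hankelInt β ((k * r : ℝ) : ℂ)) (F' * (k : ℂ)) r :=
      HasDerivAt.comp (h₂ := hankelInt β) (h := fun r : ℝ => ((k * r : ℝ) : ℂ)) r hF'
        d0.ofReal_comp
    rw [((((d1.mul d2).mul d3)).congr_of_eventuallyEq hev).deriv]
    have hF'2 : ‖F' * (k : ℂ)‖ ≤ C₁ * r⁻¹ * J := by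
      rw [norm_mul, Complex.norm_real, Real.norm_of_nonneg hk.le]
      calc ‖F'‖ * k ≤ (C₁ / (k * r) * J) * k := by gcongr
        _ = _ := by field_simp
    have hp' : ‖((-m * r ^ (-m - 1) : ℝ) : ℂ)‖ = m * (r ^ (-m) * r⁻¹) := by
      rw [Complex.norm_real, norm_mul, Real.norm_of_nonneg (by positivity : 0 ≤ r ^ (-m - 1)),
        norm_neg, Real.norm_of_nonneg hm0, Real.rpow_sub_one hr.ne']
      rfl
    have hd2n : ‖Complex.exp (Complex.I * ((k * r : ℝ) : ℂ)) * (Complex.I * (k : ℂ))‖ = k := by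
      rw [norm_mul, hexp, norm_mul, Complex.norm_I, Complex.norm_real,
        Real.norm_of_nonneg hk.le]
      ring
    have t1 : ‖c * ((-m * r ^ (-m - 1) : ℝ) : ℂ) * Complex.exp (Complex.I * ((k * r : ℝ) : ℂ)) *
        hankelInt β ((k * r : ℝ) : ℂ)‖ ≤ A * k ^ β * (m * (r ^ (-m) * r⁻¹)) * (C₀ * J) := by
      rw [norm_mul, norm_mul, norm_mul, hexp, hp', hcn, mul_one]
      gcongr
    have t2 : ‖c * ((r ^ (-m) : ℝ) : ℂ) * (Complex.exp (Complex.I * ((k * r : ℝ) : ℂ)) *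
        (Complex.I * (k : ℂ))) * hankelInt β ((k * r : ℝ) : ℂ)‖ ≤
        A * k ^ β * r ^ (-m) * k * (C₀ * J) := by
      rw [norm_mul, norm_mul, norm_mul, hd2n, hpn, hcn]
      gcongr
    have t3 : ‖c * ((r ^ (-m) : ℝ) : ℂ) * Complex.exp (Complex.I * ((k * r : ℝ) : ℂ)) *
        (F' * (k : ℂ))‖ ≤ A * k ^ β * r ^ (-m) * (C₁ * r⁻¹ * J) := by
      rw [norm_mul (c * _ * _), norm_mul, norm_mul, hexp, hpn, hcn, mul_one]
      gcongr
    rw [add_mul]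
    refine (norm_add₃_le).trans ((add_le_add_three t1 t2 t3).trans ?_)
    have hP : 0 ≤ A * k ^ β * r ^ (-m) * J * r⁻¹ := by positivity
    have e : A * k ^ β * (m * (r ^ (-m) * r⁻¹)) * (C₀ * J) + A * k ^ β * r ^ (-m) * k * (C₀ * J) +
        A * k ^ β * r ^ (-m) * (C₁ * r⁻¹ * J) =
        A * k ^ β * r ^ (-m) * J * r⁻¹ * (m * C₀ + (k * r) * C₀ + C₁) := by
      field_simp
    rw [e]
    have e' : A * (C₀ + m * C₀ + C₁) * k ^ β * r ^ (-m) * J * ((1 + k * r) * r⁻¹) =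
        A * k ^ β * r ^ (-m) * J * r⁻¹ * ((C₀ + m * C₀ + C₁) * (1 + k * r)) := by ring
    rw [e']
    gcongr
    have h1 : 0 ≤ m * C₀ * (k * r) := by positivity
    have h2 : 0 ≤ C₁ * (k * r) := by positivity
    linarith

/-- Size of the fundamental solution in dimension at least three. -/
theorem exists_norm_radial_le_of_three_le {n : ℕ} (hn : 3 ≤ n) {k₀ R : ℝ} (hk₀ : 0 < k₀)
    (hR : 0 < R) : ∃ B : ℝ, 0 ≤ B ∧ ∀ k r : ℝ, k₀ ≤ k → 0 < r → r ≤ R →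
      ‖radial n k r‖ ≤ B * k ^ (((n : ℝ) - 3) / 2) * r ^ (-((n : ℝ) - 2)) ∧
      ‖deriv (radial n k) r‖ ≤ B * k ^ (((n : ℝ) - 3) / 2) * r ^ (-((n : ℝ) - 2)) *
        ((1 + k * r) * r⁻¹) := by
  have hn3 : (3 : ℝ) ≤ n := by exact_mod_cast hn
  obtain ⟨B, hB, h⟩ := exists_norm_radial_le (n := n) (by omega)
  obtain ⟨C, hC, hJ⟩ := exists_hankelBound_le (β := ((n : ℝ) - 3) / 2) (by linarith)
  set β : ℝ := ((n : ℝ) - 3) / 2 with hβ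
  have hβ0 : 0 ≤ β := by rw [hβ]; linarith
  set m : ℝ := ((n : ℝ) - 1) / 2 with hm
  refine ⟨B * (C * (R ^ β + k₀ ^ (-β))), by positivity, fun k r hk hr hrR => ?_⟩
  have hk0 : 0 < k := hk₀.trans_le hk
  obtain ⟨h1, h2⟩ := h k r hk0 hr
  -- Since `m + β = n - 2`, the term `(k r)^(-β)` yields exactly `r^(-(n-2))`; the constant term is
  -- brought to that power by `r ≤ R`.
  have key : r ^ (-m) * hankelBound β (k * r) ≤
      C * (R ^ β + k₀ ^ (-β)) * r ^ (-((n : ℝ) - 2)) := by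
    have e1 : r ^ (-m) = r ^ β * r ^ (-((n : ℝ) - 2)) := by
      rw [← Real.rpow_add hr]; congr 1; rw [hm, hβ]; ring
    have e2 : r ^ (-m) * r ^ (-β) = r ^ (-((n : ℝ) - 2)) := by
      rw [← Real.rpow_add hr]; congr 1; rw [hm, hβ]; ring
    have i1 : r ^ β ≤ R ^ β := by gcongr
    have i2 : k ^ (-β) ≤ k₀ ^ (-β) := Real.rpow_le_rpow_of_nonpos hk₀ hk (by linarith)
    calc r ^ (-m) * hankelBound β (k * r) ≤ r ^ (-m) * (C * (1 + (k * r) ^ (-β))) := by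
          gcongr
          exact hJ _ (mul_pos hk0 hr)
      _ = C * (r ^ β * r ^ (-((n : ℝ) - 2)) + k ^ (-β) * r ^ (-((n : ℝ) - 2))) := by
          rw [← e2, Real.mul_rpow hk0.le hr.le, e2, ← e1, ← e2]
          ring
      _ ≤ C * (R ^ β * r ^ (-((n : ℝ) - 2)) + k₀ ^ (-β) * r ^ (-((n : ℝ) - 2))) := by
          gcongr
      _ = _ := by ring
  have key2 : B * k ^ β * r ^ (-m) * hankelBound β (k * r) ≤
      B * (C * (R ^ β + k₀ ^ (-β))) * k ^ β * r ^ (-((n : ℝ) - 2)) := by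
    calc _ = B * k ^ β * (r ^ (-m) * hankelBound β (k * r)) := by ring
      _ ≤ B * k ^ β * (C * (R ^ β + k₀ ^ (-β)) * r ^ (-((n : ℝ) - 2))) := by gcongr
      _ = _ := by ring
  exact ⟨h1.trans key2, h2.trans (by gcongr)⟩

/-- Size of the fundamental solution in dimension two. -/
theorem exists_norm_radial_two_le {α : ℝ} (hα : 0 < α) (hα2 : α ≤ 1 / 2) :
    ∃ B : ℝ, 0 ≤ B ∧ ∀ k r : ℝ, 0 < k → 0 < r →
      ‖radial 2 k r‖ ≤ B * (k ^ (-α) * r ^ (-α)) ∧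
      ‖deriv (radial 2 k) r‖ ≤ B * (k ^ (-α) * r ^ (-α)) * ((1 + k * r) * r⁻¹) := by
  obtain ⟨B, hB, h⟩ := exists_norm_radial_le (n := 2) le_rfl
  have e0 : (((2 : ℕ) : ℝ) - 3) / 2 = -(1 / 2) := by norm_num
  have e1 : (((2 : ℕ) : ℝ) - 1) / 2 = 1 / 2 := by norm_num
  rw [e0, e1] at h
  -- This `θ` makes `(k r)^(-1/2) (k r)^θ = (k r)^(-α)`.
  obtain ⟨C, hC, hJ⟩ := exists_hankelBound_le_of_neg (β := -(1 / 2)) (θ := 1 / 2 - α)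
    (by norm_num) (by linarith) (by linarith) (by linarith)
  refine ⟨B * C, by positivity, fun k r hk hr => ?_⟩
  obtain ⟨h1, h2⟩ := h k r hk hr
  have key : B * k ^ (-(1 / 2) : ℝ) * r ^ (-(1 / 2) : ℝ) * hankelBound (-(1 / 2)) (k * r) ≤
      B * C * (k ^ (-α) * r ^ (-α)) := by
    calc _ ≤ B * k ^ (-(1 / 2) : ℝ) * r ^ (-(1 / 2) : ℝ) * (C * (k * r) ^ (1 / 2 - α)) := by
          gcongr
          exact hJ _ (mul_pos hk hr)
      _ = B * C * ((k ^ (-(1 / 2) : ℝ) * k ^ (1 / 2 - α)) *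
          (r ^ (-(1 / 2) : ℝ) * r ^ (1 / 2 - α))) := by
          rw [Real.mul_rpow hk.le hr.le]; ring
      _ = _ := by
          rw [← Real.rpow_add hk, ← Real.rpow_add hr]
          congr 4 <;> ring
  exact ⟨h1.trans key, h2.trans (by gcongr)⟩

/-- For the identification `k` is fixed, and only the order `α` of the singularity matters: `α < d`
serves the trace on `Γ`, and `2(α + 1) < d + n` serves the gradient. -/
theorem exists_radial_exponent {n : ℕ} (hn : 2 ≤ n) {d : ℝ} (hd : (n : ℝ) - 2 < d) {k R : ℝ}
    (hk : 0 < k) (hR : 0 < R) : ∃ α C : ℝ, 0 ≤ α ∧ 0 ≤ C ∧ α < d ∧ 2 * (α + 1) < d + n ∧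
      ∀ r : ℝ, 0 < r → r ≤ R → ‖radial n k r‖ ≤ C * r ^ (-α) ∧
        ‖deriv (radial n k) r‖ ≤ C * r ^ (-(α + 1)) := by
  suffices h : ∃ α C : ℝ, 0 ≤ α ∧ 0 ≤ C ∧ α < d ∧ 2 * (α + 1) < d + n ∧
      ∀ r : ℝ, 0 < r → r ≤ R → ‖radial n k r‖ ≤ C * r ^ (-α) ∧
        ‖deriv (radial n k) r‖ ≤ C * r ^ (-α) * ((1 + k * r) * r⁻¹) by
    obtain ⟨α, C, hα, hC, h1, h2, h⟩ := h
    refine ⟨α, C * (1 + k * R), hα, by positivity, h1, h2, fun r hr hrR => ⟨?_, ?_⟩⟩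
    · refine (h r hr hrR).1.trans ?_
      gcongr
      have : 0 ≤ k * R := by positivity
      nlinarith
    · refine (h r hr hrR).2.trans ?_
      rw [neg_add, Real.rpow_add hr, Real.rpow_neg_one]
      calc C * r ^ (-α) * ((1 + k * r) * r⁻¹) ≤ C * r ^ (-α) * ((1 + k * R) * r⁻¹) := by gcongr
        _ = _ := by ring
  rcases hn.eq_or_lt with rfl | hn
  · have hd0 : 0 < d := by simpa using hd
    -- Small enough for `α ≤ 1/2`, `α < d` and `2α < d` at once.
    set α := min d 1 / 4 with hα
    have h1 : 0 < min d 1 := lt_min hd0 one_pos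
    have h2 := min_le_left d 1
    have h3 := min_le_right d 1
    obtain ⟨B, hB, h⟩ := exists_norm_radial_two_le (α := α) (by positivity) (by linarith)
    refine ⟨α, B * k ^ (-α), by positivity, by positivity, by linarith, ?_, fun r hr hrR => ?_⟩
    · push_cast; linarith
    · simpa only [mul_assoc] using h k r hk hr
  · have hn3 : (3 : ℝ) ≤ n := by exact_mod_cast hn
    obtain ⟨B, hB, h⟩ := exists_norm_radial_le_of_three_le hn hk hR
    exact ⟨(n : ℝ) - 2, B * k ^ (((n : ℝ) - 3) / 2), by linarith, by positivity, hd, by linarith,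
      fun r hr hrR => h k r le_rfl hr hrR⟩

end

end DSetScattering

/-! ### Truncated profiles and their smoothing. -/

namespace DSetScattering

/-- `g` is smooth on the positive half-axis, vanishes beyond `R`, and it and its derivative blow up
at `0` no faster than the powers of exponents `-α` and `-(α + 1)`. -/
structure IsSingularProfile (g : ℝ → ℂ) (α C R : ℝ) : Prop where
  exponent_nonneg : 0 ≤ α
  const_nonneg : 0 ≤ C
  contDiffAt : ∀ r, 0 < r → ContDiffAt ℝ ∞ g r
  eq_zero : ∀ r, R < r → g r = 0
  norm_le : ∀ r, 0 < r → ‖g r‖ ≤ C * r ^ (-α)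
  norm_le_succ : ∀ r, 0 < r → ‖g r‖ ≤ C * r ^ (-(α + 1))
  norm_deriv_le : ∀ r, 0 < r → ‖deriv g r‖ ≤ C * r ^ (-(α + 1))

/-- Multiplication by a bump equal to `1` up to radius `R`. Only distances up to `R` occur in the
application, so truncation changes nothing there and gives compact support. -/
theorem exists_isSingularProfile {g : ℝ → ℂ} {α C R : ℝ} (hα : 0 ≤ α) (hC : 0 ≤ C) (hR : 0 < R)
    (hg : ∀ r, 0 < r → ContDiffAt ℝ ∞ g r)
    (hb : ∀ r : ℝ, 0 < r → r ≤ R + 1 → ‖g r‖ ≤ C * r ^ (-α) ∧ ‖deriv g r‖ ≤ C * r ^ (-(α + 1))) :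
    ∃ (h : ℝ → ℂ) (C' : ℝ), IsSingularProfile h α C' (R + 1) ∧ ∀ r, 0 ≤ r → r ≤ R → h r = g r := by
  let b : ContDiffBump (0 : ℝ) := ⟨R, R + 1, hR, by linarith⟩
  have hbs : ContDiff ℝ ∞ (fun r => (b r : ℂ)) := Complex.ofRealCLM.contDiff.comp b.contDiff
  have hb1 : ∀ r, ‖(b r : ℂ)‖ ≤ 1 := fun r => by
    rw [Complex.norm_real, Real.norm_of_nonneg b.nonneg]; exact b.le_one
  have hb0 : ∀ r, R + 1 < r → b r = 0 := fun r hr => b.zero_of_le_dist (by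
    rw [Real.dist_0_eq_abs]; exact hr.le.trans (le_abs_self r))
  have hbc : HasCompactSupport (fun r => (b r : ℂ)) :=
    b.hasCompactSupport.comp_left (g := Complex.ofReal) rfl
  obtain ⟨M, hM⟩ := hbc.deriv.exists_bound_of_continuous (hbs.continuous_deriv (by norm_num))
  have hM0 : 0 ≤ M := (norm_nonneg _).trans (hM 0)
  have hd0 : ∀ r, R + 1 < r → deriv (fun r => (b r : ℂ) * g r) r = 0 := by
    intro r hr
    have : (fun r => (b r : ℂ) * g r) =ᶠ[𝓝 r] fun _ => 0 := by
      filter_upwards [lt_mem_nhds hr] with s hs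
      rw [hb0 s hs]; simp
    rw [this.deriv_eq, deriv_const]
  -- On the bounded support the weaker singularity is dominated by the stronger, so a derivative
  -- falling on the bump does no harm.
  have hsucc : ∀ r, 0 < r → r ≤ R + 1 → r ^ (-α) ≤ (R + 1) * r ^ (-(α + 1)) := by
    intro r hr hrR
    rw [neg_add, Real.rpow_add hr, Real.rpow_neg_one]
    have : 1 ≤ (R + 1) * r⁻¹ := by
      rw [← div_eq_mul_inv, le_div_iff₀ hr]; linarith
    have h0 : 0 ≤ r ^ (-α) := by positivity
    nlinarith
  have hn1 : ∀ r, 0 < r → ‖(b r : ℂ) * g r‖ ≤ C * r ^ (-α) := by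
    intro r hr
    rcases le_or_gt r (R + 1) with h | h
    · rw [norm_mul]
      exact (mul_le_of_le_one_left (norm_nonneg _) (hb1 r)).trans (hb r hr h).1
    · rw [hb0 r h]; simp; positivity
  have hn2 : ∀ r, 0 < r → ‖(b r : ℂ) * g r‖ ≤ C * (R + 1) * r ^ (-(α + 1)) := by
    intro r hr
    rcases le_or_gt r (R + 1) with h | h
    · refine (hn1 r hr).trans ?_
      rw [mul_assoc]
      gcongr
      exact hsucc r hr h
    · rw [hb0 r h]; simp; positivity
  have hn3 : ∀ r, 0 < r → ‖deriv (fun r => (b r : ℂ) * g r) r‖ ≤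
      (M * (C * (R + 1)) + C) * r ^ (-(α + 1)) := by
    intro r hr
    rcases le_or_gt r (R + 1) with h | h
    · have hd : HasDerivAt (fun r => (b r : ℂ) * g r)
          (deriv (fun r => (b r : ℂ)) r * g r + (b r : ℂ) * deriv g r) r :=
        ((hbs.differentiable (by norm_num)) r).hasDerivAt.mul
          ((hg r hr).differentiableAt (by norm_num)).hasDerivAt
      rw [hd.deriv]
      refine (norm_add_le _ _).trans ?_
      rw [norm_mul, norm_mul, add_mul]
      refine add_le_add ?_ ?_
      · rw [mul_assoc]
        refine mul_le_mul (hM r) ?_ (norm_nonneg _) hM0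
        refine (hb r hr h).1.trans ?_
        rw [mul_assoc]
        gcongr
        exact hsucc r hr h
      · exact (mul_le_of_le_one_left (norm_nonneg _) (hb1 r)).trans (hb r hr h).2
    · rw [hd0 r h]; simp; positivity
  have hMC : 0 ≤ M * (C * (R + 1)) := by positivity
  have hCR : 0 ≤ C * (R + 1) := by positivity
  refine ⟨fun r => (b r : ℂ) * g r, C + C * (R + 1) + M * (C * (R + 1)),
    ⟨hα, by positivity, fun r hr => hbs.contDiffAt.mul (hg r hr), fun r hr => ?_, fun r hr => ?_,
      fun r hr => ?_, fun r hr => ?_⟩, fun r hr hrR => ?_⟩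
  · rw [hb0 r hr]; simp
  · refine (hn1 r hr).trans ?_
    gcongr
    linarith
  · refine (hn2 r hr).trans ?_
    gcongr
    linarith
  · refine (hn3 r hr).trans (mul_le_mul_of_nonneg_right ?_ (by positivity))
    linarith
  · have : b r = 1 := b.one_of_mem_closedBall (by
      rw [mem_closedBall_zero_iff, Real.norm_of_nonneg hr]; exact hrR)
    simp only [this, Complex.ofReal_one, one_mul]

section SmoothKer

variable {n : ℕ}

/-- The regularised distance. -/
noncomputable def regNorm (ε : ℝ) (z : Eucl n) : ℝ := Real.sqrt (‖z‖ ^ 2 + ε ^ 2)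

/-- The radial kernel of profile `g`, with the singularity smoothed at scale `ε`. -/
noncomputable def smoothKer (g : ℝ → ℂ) (ε : ℝ) (z : Eucl n) : ℂ := g (regNorm ε z)

/-- The partial derivative of `smoothKer`. -/
noncomputable def smoothKerPartial (g : ℝ → ℂ) (ε : ℝ) (j : Fin n) (z : Eucl n) : ℂ :=
  ((z j / regNorm ε z : ℝ) : ℂ) * deriv g (regNorm ε z)

theorem regNorm_zero (z : Eucl n) : regNorm 0 z = ‖z‖ := by
  rw [regNorm, zero_pow two_ne_zero, add_zero, Real.sqrt_sq (norm_nonneg z)]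

theorem norm_le_regNorm (ε : ℝ) (z : Eucl n) : ‖z‖ ≤ regNorm ε z :=
  Real.le_sqrt_of_sq_le (by nlinarith [sq_nonneg ε])

theorem regNorm_pos {ε : ℝ} (hε : ε ≠ 0) (z : Eucl n) : 0 < regNorm ε z :=
  Real.sqrt_pos.2 (by positivity)

theorem continuous_regNorm : Continuous fun p : ℝ × Eucl n => regNorm p.1 p.2 := by
  unfold regNorm
  fun_prop

theorem hasFDerivAt_regNorm {ε : ℝ} (hε : ε ≠ 0) (z : Eucl n) :
    HasFDerivAt (regNorm ε) ((regNorm ε z)⁻¹ • innerSL ℝ z) z := by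
  have hpos : ‖z‖ ^ 2 + ε ^ 2 ≠ 0 := by positivity
  have h1 : HasFDerivAt (fun z : Eucl n => ‖z‖ ^ 2 + ε ^ 2) (2 • innerSL ℝ z) z :=
    (hasStrictFDerivAt_norm_sq z).hasFDerivAt.add_const _
  have e : (regNorm ε z)⁻¹ • innerSL ℝ z =
      (1 / (2 * Real.sqrt (‖z‖ ^ 2 + ε ^ 2))) • (2 • innerSL ℝ z) := by
    ext y
    simp [regNorm]
    ring
  rw [e]
  exact h1.sqrt hpos

theorem contDiff_smoothKer {g : ℝ → ℂ} (hg : ∀ r, 0 < r → ContDiffAt ℝ ∞ g r) {ε : ℝ}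
    (hε : ε ≠ 0) : ContDiff ℝ ∞ (smoothKer g ε : Eucl n → ℂ) := by
  rw [contDiff_iff_contDiffAt]
  intro z
  have hpos : ‖z‖ ^ 2 + ε ^ 2 ≠ 0 := by positivity
  have h1 : ContDiffAt ℝ ∞ (fun z : Eucl n => ‖z‖ ^ 2 + ε ^ 2) z :=
    ((contDiff_norm_sq ℝ).add contDiff_const).contDiffAt
  exact (hg _ (regNorm_pos hε z)).comp z (h1.sqrt hpos)

theorem fderiv_smoothKer {g : ℝ → ℂ} (hg : ∀ r, 0 < r → ContDiffAt ℝ ∞ g r) {ε : ℝ}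
    (hε : ε ≠ 0) (z : Eucl n) (j : Fin n) :
    fderiv ℝ (smoothKer g ε) z (unitVec j) = smoothKerPartial g ε j z := by
  have h1 := ((hg _ (regNorm_pos hε z)).differentiableAt (by norm_num)).hasDerivAt.hasFDerivAt
  have h2 : HasFDerivAt (smoothKer g ε) _ z := h1.comp z (hasFDerivAt_regNorm hε z)
  rw [h2.fderiv, smoothKerPartial]
  simp [EuclideanSpace.inner_single_right, div_eq_inv_mul, mul_assoc]

variable {g : ℝ → ℂ} {α C R : ℝ}

theorem IsSingularProfile.hasCompactSupport (hg : IsSingularProfile g α C R) (ε : ℝ) :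
    HasCompactSupport (smoothKer g ε : Eucl n → ℂ) := by
  refine HasCompactSupport.intro (isCompact_closedBall (0 : Eucl n) R) fun z hz => ?_
  rw [mem_closedBall_zero_iff, not_le] at hz
  exact hg.eq_zero _ (hz.trans_le (norm_le_regNorm ε z))

/-- The bound is uniform in `ε`: the regularised distance is at least `|z|`, and the bounding power
is non-increasing. -/
theorem IsSingularProfile.norm_smoothKer_le (hg : IsSingularProfile g α C R) (ε : ℝ)
    {z : Eucl n} (hz : z ≠ 0) : ‖smoothKer g ε z‖ ≤ C * ‖z‖ ^ (-α) := by
  have h0 := norm_pos_iff.2 hz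
  have h1 := norm_le_regNorm ε z
  refine (hg.norm_le _ (h0.trans_le h1)).trans ?_
  exact mul_le_mul_of_nonneg_left (Real.rpow_le_rpow_of_nonpos h0 h1
    (neg_nonpos.2 hg.exponent_nonneg)) hg.const_nonneg

theorem IsSingularProfile.norm_smoothKer_le_succ (hg : IsSingularProfile g α C R) (ε : ℝ)
    {z : Eucl n} (hz : z ≠ 0) : ‖smoothKer g ε z‖ ≤ C * ‖z‖ ^ (-(α + 1)) := by
  have h0 := norm_pos_iff.2 hz
  have h1 := norm_le_regNorm ε z
  refine (hg.norm_le_succ _ (h0.trans_le h1)).trans ?_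
  exact mul_le_mul_of_nonneg_left (Real.rpow_le_rpow_of_nonpos h0 h1
    (by linarith [hg.exponent_nonneg])) hg.const_nonneg

theorem IsSingularProfile.norm_smoothKerPartial_le (hg : IsSingularProfile g α C R) (ε : ℝ)
    (j : Fin n) {z : Eucl n} (hz : z ≠ 0) :
    ‖smoothKerPartial g ε j z‖ ≤ C * ‖z‖ ^ (-(α + 1)) := by
  have h0 := norm_pos_iff.2 hz
  have h1 := norm_le_regNorm ε z
  have h2 := h0.trans_le h1
  rw [smoothKerPartial, norm_mul, Complex.norm_real, norm_div, Real.norm_of_nonneg h2.le]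
  have h3 : ‖z j‖ / regNorm ε z ≤ 1 := by
    rw [div_le_one h2]
    exact (PiLp.norm_apply_le z j).trans h1
  refine (mul_le_of_le_one_left (norm_nonneg _) h3).trans ((hg.norm_deriv_le _ h2).trans ?_)
  exact mul_le_mul_of_nonneg_left (Real.rpow_le_rpow_of_nonpos h0 h1
    (by linarith [hg.exponent_nonneg])) hg.const_nonneg

theorem IsSingularProfile.tendsto_smoothKer (hg : IsSingularProfile g α C R) {z : Eucl n}
    (hz : z ≠ 0) {ε : ℕ → ℝ} (hε : Tendsto ε atTop (𝓝 0)) :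
    Tendsto (fun m => smoothKer g (ε m) z) atTop (𝓝 (smoothKer g 0 z)) := by
  have h1 : Tendsto (fun m => regNorm (ε m) z) atTop (𝓝 (regNorm 0 z)) :=
    ((continuous_regNorm.comp (Continuous.prodMk continuous_id continuous_const)).tendsto 0).comp hε
  have h0 : 0 < regNorm 0 z := (norm_pos_iff.2 hz).trans_le (norm_le_regNorm 0 z)
  exact (hg.contDiffAt _ h0).continuousAt.tendsto.comp h1

theorem IsSingularProfile.tendsto_smoothKerPartial (hg : IsSingularProfile g α C R) (j : Fin n)
    {z : Eucl n} (hz : z ≠ 0) {ε : ℕ → ℝ} (hε : Tendsto ε atTop (𝓝 0)) :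
    Tendsto (fun m => smoothKerPartial g (ε m) j z) atTop (𝓝 (smoothKerPartial g 0 j z)) := by
  have h1 : Tendsto (fun m => regNorm (ε m) z) atTop (𝓝 (regNorm 0 z)) :=
    ((continuous_regNorm.comp (Continuous.prodMk continuous_id continuous_const)).tendsto 0).comp hε
  have h0 : 0 < regNorm 0 z := (norm_pos_iff.2 hz).trans_le (norm_le_regNorm 0 z)
  have h2 : ContinuousAt (deriv g) (regNorm 0 z) := by
    have h3 := (hg.contDiffAt _ h0).continuousAt_fderiv (by norm_num)
    exact h3.clm_apply (continuousAt_const (y := (1 : ℝ)))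
  refine Tendsto.mul ?_ (h2.tendsto.comp h1)
  exact (Complex.continuous_ofReal.tendsto _).comp (tendsto_const_nhds.div h1 h0.ne')

/-- Nothing is known of `g` on the negative axis, so it is composed with `|·|`, which makes it
continuous off `0`. -/
theorem IsSingularProfile.measurable_smoothKer (hg : IsSingularProfile g α C R) (ε : ℝ) :
    Measurable (smoothKer g ε : Eucl n → ℂ) := by
  have h1 : Measurable fun r : ℝ => g |r| := by
    refine measurable_of_continuousOn_compl_singleton 0 fun r hr => ?_
    have h0 : 0 < |r| := abs_pos.2 hr
    exact ((hg.contDiffAt _ h0).continuousAt.comp continuous_abs.continuousAt).continuousWithinAt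
  have h2 : Measurable (regNorm ε : Eucl n → ℝ) :=
    (continuous_regNorm.comp (Continuous.prodMk continuous_const continuous_id)).measurable
  have h3 : (smoothKer g ε : Eucl n → ℂ) = fun z => g |regNorm ε z| := by
    ext z
    rw [smoothKer, abs_of_nonneg ((norm_nonneg z).trans (norm_le_regNorm ε z))]
  rw [h3]
  exact h1.comp h2

theorem measurable_smoothKerPartial (g : ℝ → ℂ) (ε : ℝ) (j : Fin n) :
    Measurable (smoothKerPartial g ε j) := by
  have h2 : Measurable (regNorm ε : Eucl n → ℝ) :=
    (continuous_regNorm.comp (Continuous.prodMk continuous_const continuous_id)).measurable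
  have h3 : Measurable fun z : Eucl n => z j := by fun_prop
  exact (Complex.measurable_ofReal.comp (h3.div h2)).mul ((measurable_deriv g).comp h2)

end SmoothKer

end DSetScattering

/-! ### The cut-off potential in `H¹` and its trace. -/

namespace DSetScattering

variable {n : ℕ} {g : ℝ → ℂ} {α C R : ℝ} {μ : Measure (Eucl n)} {ψ : Eucl n → ℂ}

open LineDeriv

theorem contDiff_integral_smoothKer (hg : IsSingularProfile g α C R) (hψ : Integrable ψ μ)
    {ε : ℝ} (hε : ε ≠ 0) : ContDiff ℝ ∞ fun x => ∫ y, smoothKer g ε (x - y) * ψ y ∂μ := by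
  have h := (hg.hasCompactSupport (n := n) ε).contDiff_convolution_right
    (ContinuousLinearMap.mul ℝ ℂ) hψ.locallyIntegrable (n := ⊤)
    (contDiff_smoothKer hg.contDiffAt hε)
  have e : (fun x => ∫ y, smoothKer g ε (x - y) * ψ y ∂μ) =
      convolution ψ (smoothKer g ε) (ContinuousLinearMap.mul ℝ ℂ) μ := by
    ext x
    simp only [convolution_def, ContinuousLinearMap.mul_apply', mul_comm]
  rw [e]
  exact h

theorem integrable_smoothKer_mul (hg : IsSingularProfile g α C R) (hψ : Integrable ψ μ)
    {ε : ℝ} (hε : ε ≠ 0) (x : Eucl n) :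
    Integrable (fun y => smoothKer g ε (x - y) * ψ y) μ := by
  have hc : Continuous (smoothKer g ε : Eucl n → ℂ) :=
    (contDiff_smoothKer hg.contDiffAt hε).continuous
  obtain ⟨M, hM⟩ := (hg.hasCompactSupport (n := n) ε).exists_bound_of_continuous hc
  refine hψ.bdd_mul (c := M) ?_ (Eventually.of_forall fun y => hM _)
  exact (hc.comp (continuous_const.sub continuous_id)).aestronglyMeasurable

theorem fderiv_integral_smoothKer (hg : IsSingularProfile g α C R) (hψ : Integrable ψ μ)
    {ε : ℝ} (hε : ε ≠ 0) (x : Eucl n) (j : Fin n) :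
    fderiv ℝ (fun x => ∫ y, smoothKer g ε (x - y) * ψ y ∂μ) x (unitVec j) =
      ∫ y, smoothKerPartial g ε j (x - y) * ψ y ∂μ := by
  have hs := hg.hasCompactSupport (n := n) ε
  have hc : ContDiff ℝ 1 (smoothKer g ε : Eucl n → ℂ) :=
    (contDiff_smoothKer hg.contDiffAt hε).of_le (by norm_num)
  have hdc := hc.continuous_fderiv (by norm_num)
  obtain ⟨M, hM⟩ := (hs.fderiv ℝ).exists_bound_of_continuous hdc
  have hsub : ∀ x : Eucl n, Continuous fun y : Eucl n => x - y := fun x =>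
    continuous_const.sub continuous_id
  have hF'm : AEStronglyMeasurable (fun y => ψ y • fderiv ℝ (smoothKer g ε) (x - y)) μ :=
    hψ.aestronglyMeasurable.smul (hdc.comp (hsub x)).aestronglyMeasurable
  have hF'b : ∀ x y, ‖ψ y • fderiv ℝ (smoothKer g ε) (x - y)‖ ≤ ‖ψ y‖ * M := fun x y => by
    rw [norm_smul]
    gcongr
    exact hM _
  have hbi : Integrable (fun y => ‖ψ y‖ * M) μ := hψ.norm.mul_const M
  have h : HasFDerivAt (fun x => ∫ y, smoothKer g ε (x - y) * ψ y ∂μ)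
      (∫ y, ψ y • fderiv ℝ (smoothKer g ε) (x - y) ∂μ) x := by
    refine hasFDerivAt_integral_of_dominated_of_fderiv_le
      (F' := fun x y => ψ y • fderiv ℝ (smoothKer g ε) (x - y)) (s := univ)
      (bound := fun y => ‖ψ y‖ * M) univ_mem (Eventually.of_forall fun x => ?_)
      (integrable_smoothKer_mul hg hψ hε x) hF'm
      (Eventually.of_forall fun y x _ => hF'b x y) hbi (Eventually.of_forall fun y x _ => ?_)
    · exact (integrable_smoothKer_mul hg hψ hε x).aestronglyMeasurable
    · have h1 : HasFDerivAt (fun x => smoothKer g ε (x - y))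
          (fderiv ℝ (smoothKer g ε) (x - y)) x := by
        have h2 := (hc.differentiable (by norm_num) (x - y)).hasFDerivAt
        exact h2.comp x ((hasFDerivAt_id x).sub_const y)
      exact h1.mul_const (ψ y)
  rw [h.fderiv, ContinuousLinearMap.integral_apply (hbi.mono' hF'm
    (Eventually.of_forall fun y => hF'b x y))]
  simp only [smul_apply, fderiv_smoothKer hg.contDiffAt hε, smul_eq_mul, mul_comm]

theorem continuous_smoothKerPartial (hg : IsSingularProfile g α C R) {ε : ℝ} (hε : ε ≠ 0)
    (j : Fin n) : Continuous (smoothKerPartial g ε j) := by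
  have hc := (contDiff_smoothKer (n := n) hg.contDiffAt hε).continuous_fderiv (by norm_num)
  refine (hc.clm_apply (continuous_const (y := unitVec j))).congr fun z => ?_
  exact fderiv_smoothKer hg.contDiffAt hε z j

theorem integrable_smoothKerPartial_mul (hg : IsSingularProfile g α C R) (hψ : Integrable ψ μ)
    {ε : ℝ} (hε : ε ≠ 0) (j : Fin n) (x : Eucl n) :
    Integrable (fun y => smoothKerPartial g ε j (x - y) * ψ y) μ := by
  have hc := continuous_smoothKerPartial (n := n) hg hε j
  have hs : HasCompactSupport (smoothKerPartial g ε j) := by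
    have := (hg.hasCompactSupport (n := n) ε).fderiv_apply ℝ (unitVec j)
    simpa only [fderiv_smoothKer hg.contDiffAt hε] using this
  obtain ⟨M, hM⟩ := hs.exists_bound_of_continuous hc
  refine hψ.bdd_mul (c := M) ?_ (Eventually.of_forall fun y => hM _)
  exact (hc.comp (continuous_const.sub continuous_id)).aestronglyMeasurable

/-- The `j`-th derivative in `x` of the kernel `χ(x) smoothKer(x - y)`. -/
noncomputable def cutKerPartial (g : ℝ → ℂ) (χ : Eucl n → ℂ) (ε : ℝ) (j : Fin n)
    (x y : Eucl n) : ℂ :=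
  fderiv ℝ χ x (unitVec j) * smoothKer g ε (x - y) + χ x * smoothKerPartial g ε j (x - y)

theorem fderiv_cutoff_potential (hg : IsSingularProfile g α C R) (hψ : Integrable ψ μ)
    {ε : ℝ} (hε : ε ≠ 0) {χ : Eucl n → ℂ} (hχ : ContDiff ℝ ∞ χ) (x : Eucl n) (j : Fin n) :
    fderiv ℝ (fun x => χ x * ∫ y, smoothKer g ε (x - y) * ψ y ∂μ) x (unitVec j) =
      ∫ y, cutKerPartial g χ ε j x y * ψ y ∂μ := by
  have h1 := (hχ.differentiable (by norm_num) x)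
  have h2 := ((contDiff_integral_smoothKer hg hψ hε).differentiable (by norm_num) x)
  rw [fderiv_fun_mul h1 h2]
  simp only [add_apply, smul_apply, smul_eq_mul,
    fderiv_integral_smoothKer hg hψ hε, cutKerPartial, add_mul, mul_assoc]
  rw [integral_add ((integrable_smoothKer_mul hg hψ hε x).const_mul _)
    ((integrable_smoothKerPartial_mul hg hψ hε j x).const_mul _), integral_const_mul,
    integral_const_mul]
  ring

theorem eLpNorm_restrict_tsupport {f χ : Eucl n → ℂ} (hf : ∀ x, x ∉ tsupport χ → f x = 0) :
    eLpNorm f 2 (volume.restrict (tsupport χ)) = eLpNorm f 2 volume :=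
  eLpNorm_restrict_eq_of_support_subset fun x hx => by
    by_contra h
    exact hx (hf x h)

theorem IsSingularProfile.stronglyMeasurable_sub (hg : IsSingularProfile g α C R) (ε : ℝ) :
    StronglyMeasurable fun p : Eucl n × Eucl n => smoothKer g ε (p.1 - p.2) :=
  ((hg.measurable_smoothKer ε).comp (measurable_fst.sub measurable_snd)).stronglyMeasurable

section Limit

variable [NeZero n] [IsFiniteMeasure μ] {d : ℝ} {χ : Eucl n → ℂ}

/-- `L²(ℝⁿ)` convergence of potentials whose kernels live on the support of the cut-off. -/
theorem exists_tendsto_eLpNorm_volume (hμ : UpperRegular d μ) (hd : 0 < d) {a M : ℝ}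
    (ha : 0 ≤ a) (had : 2 * a < d + n) (hχc : HasCompactSupport χ)
    (hψ : StronglyMeasurable ψ) (hψ2 : MemLp ψ 2 μ) {K : ℕ → Eucl n → Eucl n → ℂ}
    {K' : Eucl n → Eucl n → ℂ} (hK : ∀ j, StronglyMeasurable (Function.uncurry (K j)))
    (hK' : StronglyMeasurable (Function.uncurry K')) (hM : 0 ≤ M)
    (hKb : ∀ j x y, x ≠ y → ‖K j x y‖ ≤ M * dist x y ^ (-a))
    (hlim : ∀ x y, x ≠ y → Tendsto (fun j => K j x y) atTop (𝓝 (K' x y)))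
    (hK0 : ∀ j x y, x ∉ tsupport χ → K j x y = 0) (hK'0 : ∀ x y, x ∉ tsupport χ → K' x y = 0) :
    MemLp (fun x => ∫ y, K' x y * ψ y ∂μ) 2 volume ∧
      Tendsto (fun j => eLpNorm (fun x => ∫ y, K j x y * ψ y ∂μ - ∫ y, K' x y * ψ y ∂μ) 2 volume)
        atTop (𝓝 0) := by
  have hfin : IsFiniteMeasure (volume.restrict (tsupport χ)) :=
    ⟨by rw [Measure.restrict_apply_univ]; exact hχc.isCompact.measure_lt_top⟩
  have hν : UpperRegular (n : ℝ) (volume.restrict (tsupport χ)) :=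
    volume_upperRegular.restrict _
  have hn : (0 : ℝ) < n := by exact_mod_cast NeZero.pos n
  have hK'b : ∀ x y, x ≠ y → ‖K' x y‖ ≤ M * dist x y ^ (-a) := fun x y hxy =>
    le_of_tendsto (hlim x y hxy).norm (Eventually.of_forall fun j => hKb j x y hxy)
  have h1 := memLp_kernel hμ hν ha hd hn had hψ hψ2 hK' hM hK'b
  have h2 := tendsto_eLpNorm_kernel hμ hν ha hd hn had hψ hψ2 hK hK' hM hKb hlim
  have hm : StronglyMeasurable fun p : Eucl n × Eucl n => K' p.1 p.2 * ψ p.2 :=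
    hK'.mul (hψ.comp_measurable measurable_snd)
  constructor
  · refine ⟨hm.integral_prod_right.aestronglyMeasurable, ?_⟩
    rw [← eLpNorm_restrict_tsupport (χ := χ)]
    · exact h1.2
    · intro x hx
      simp [hK'0 x _ hx]
  · refine h2.congr fun j => eLpNorm_restrict_tsupport fun x hx => ?_
    simp [hK'0 x _ hx, hK0 j x _ hx]

/-- The smoothed potentials are the Schwartz approximants. The kernel theorem is used three times:
with exponent `α` and with `α + 1` (for the gradient) against Lebesgue measure on the support of
`χ`, and with `α` against `μ` itself. -/
theorem exists_cutoff_potential (hμ : UpperRegular d μ) (hd : 0 < d)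
    (hg : IsSingularProfile g α C R) (hαd : α < d) (hαdn : 2 * (α + 1) < d + n)
    (hχ : ContDiff ℝ ∞ χ) (hχc : HasCompactSupport χ)
    (hψ : StronglyMeasurable ψ) (hψ2 : MemLp ψ 2 μ) :
    ∃ (v : Lp ℂ 2 (volume : Measure (Eucl n))) (φ : ℕ → 𝓢(Eucl n, ℂ)),
      (v =ᵐ[volume] fun x => ∫ y, χ x * g (dist x y) * ψ y ∂μ) ∧
      Tendsto (fun m => h1Norm ((φ m).toLp 2 volume - v)) atTop (𝓝 0) ∧
      Tendsto (fun m => eLpNorm (fun x => φ m x - ∫ y, χ x * g (dist x y) * ψ y ∂μ) 2 μ)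
        atTop (𝓝 0) := by
  have hψi : Integrable ψ μ := hψ2.integrable (by norm_num)
  have hα := hg.exponent_nonneg
  have hC := hg.const_nonneg
  set ε : ℕ → ℝ := fun m => 1 / ((m : ℝ) + 1) with hεdef
  have hε0 : ∀ m, ε m ≠ 0 := fun m => (Nat.one_div_pos_of_nat).ne'
  have hε : Tendsto ε atTop (𝓝 0) := tendsto_one_div_add_atTop_nhds_zero_nat
  have hs0 : ∀ x y : Eucl n, smoothKer g 0 (x - y) = g (dist x y) := fun x y => by
    rw [smoothKer, regNorm_zero, dist_eq_norm]
  obtain ⟨M₀, hM₀⟩ := hχc.exists_bound_of_continuous hχ.continuous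
  have hM₀0 : 0 ≤ M₀ := (norm_nonneg _).trans (hM₀ 0)
  have hχd : ∀ j : Fin n, Continuous fun x => fderiv ℝ χ x (unitVec j) := fun j =>
    (hχ.continuous_fderiv (by norm_num)).clm_apply continuous_const
  obtain ⟨M₁, hM₁⟩ := (hχc.fderiv ℝ).exists_bound_of_continuous
    (hχ.continuous_fderiv (by norm_num))
  have hM₁0 : 0 ≤ M₁ := (norm_nonneg _).trans (hM₁ 0)
  have hM₁' : ∀ (x : Eucl n) (j : Fin n), ‖fderiv ℝ χ x (unitVec j)‖ ≤ M₁ := fun x j =>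
    ((fderiv ℝ χ x).le_opNorm _).trans (by simpa using hM₁ x)
  have hχ0 : ∀ x, x ∉ tsupport χ → χ x = 0 := fun x hx => image_eq_zero_of_notMem_tsupport hx
  have hχ'0 : ∀ x, x ∉ tsupport χ → fderiv ℝ χ x = 0 := fun x hx =>
    image_eq_zero_of_notMem_tsupport fun h => hx (tsupport_fderiv_subset ℝ h)
  have hχm : StronglyMeasurable fun p : Eucl n × Eucl n => χ p.1 :=
    (hχ.continuous.comp continuous_fst).stronglyMeasurable
  set K : ℝ → Eucl n → Eucl n → ℂ := fun ε x y => χ x * smoothKer g ε (x - y) with hKdef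
  have hKm : ∀ ε, StronglyMeasurable (Function.uncurry (K ε)) := fun ε =>
    hχm.mul (hg.stronglyMeasurable_sub ε)
  have hKb : ∀ ε x y, x ≠ y → ‖K ε x y‖ ≤ M₀ * C * dist x y ^ (-α) := fun ε x y hxy => by
    rw [hKdef, norm_mul, mul_assoc, dist_eq_norm]
    exact mul_le_mul (hM₀ x) (hg.norm_smoothKer_le ε (sub_ne_zero.2 hxy)) (norm_nonneg _) hM₀0
  have hKlim : ∀ x y, x ≠ y → Tendsto (fun m => K (ε m) x y) atTop (𝓝 (K 0 x y)) :=
    fun x y hxy => (hg.tendsto_smoothKer (sub_ne_zero.2 hxy) hε).const_mul _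
  set D : ℝ → Fin n → Eucl n → Eucl n → ℂ := fun ε j => cutKerPartial g χ ε j with hDdef
  have hDm : ∀ ε j, StronglyMeasurable (Function.uncurry (D ε j)) := fun ε j =>
    ((((hχd j).comp continuous_fst).stronglyMeasurable).mul (hg.stronglyMeasurable_sub ε)).add
      (hχm.mul ((measurable_smoothKerPartial g ε j).comp
        (measurable_fst.sub measurable_snd)).stronglyMeasurable)
  have hDb : ∀ ε j x y, x ≠ y → ‖D ε j x y‖ ≤ (M₁ + M₀) * C * dist x y ^ (-(α + 1)) :=
    fun ε j x y hxy => by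
      rw [hDdef, mul_assoc, add_mul, dist_eq_norm]
      refine (norm_add_le _ _).trans ?_
      rw [norm_mul, norm_mul]
      exact add_le_add (mul_le_mul (hM₁' x j) (hg.norm_smoothKer_le_succ ε (sub_ne_zero.2 hxy))
        (norm_nonneg _) hM₁0) (mul_le_mul (hM₀ x)
          (hg.norm_smoothKerPartial_le ε j (sub_ne_zero.2 hxy)) (norm_nonneg _) hM₀0)
  have hDlim : ∀ j x y, x ≠ y → Tendsto (fun m => D (ε m) j x y) atTop (𝓝 (D 0 j x y)) :=
    fun j x y hxy => ((hg.tendsto_smoothKer (sub_ne_zero.2 hxy) hε).const_mul _).add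
      ((hg.tendsto_smoothKerPartial j (sub_ne_zero.2 hxy) hε).const_mul _)
  obtain ⟨hv, hvlim⟩ := exists_tendsto_eLpNorm_volume hμ hd (a := α) (M := M₀ * C) hα
    (by linarith) hχc hψ hψ2 (fun m => hKm (ε m)) (hKm 0) (by positivity)
    (fun m => hKb (ε m)) hKlim (fun m x y hx => by simp [hKdef, hχ0 x hx])
    (fun x y hx => by simp [hKdef, hχ0 x hx])
  have hw := fun j => exists_tendsto_eLpNorm_volume hμ hd (a := α + 1) (M := (M₁ + M₀) * C)
    (by linarith) hαdn hχc hψ hψ2 (fun m => hDm (ε m) j) (hDm 0 j) (by positivity)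
    (fun m => hDb (ε m) j) (hDlim j)
    (fun m x y hx => by simp [hDdef, cutKerPartial, hχ0 x hx, hχ'0 x hx])
    (fun x y hx => by simp [hDdef, cutKerPartial, hχ0 x hx, hχ'0 x hx])
  -- Both measures have dimension `d` here, so the condition is `2α < 2d`.
  have hμlim := tendsto_eLpNorm_kernel hμ hμ hα hd hd (by linarith) hψ hψ2
    (fun m => hKm (ε m)) (hKm 0) (by positivity) (fun m => hKb (ε m)) hKlim
  set f : ℕ → Eucl n → ℂ := fun m x => χ x * ∫ y, smoothKer g (ε m) (x - y) * ψ y ∂μ with hf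
  have hfK : ∀ m x, f m x = ∫ y, K (ε m) x y * ψ y ∂μ := fun m x => by
    simp only [hf, hKdef, mul_assoc, integral_const_mul]
  have hfs : ∀ m, ContDiff ℝ ∞ (f m) := fun m =>
    hχ.mul (contDiff_integral_smoothKer hg hψi (hε0 m))
  have hfc : ∀ m, HasCompactSupport (f m) := fun m => hχc.mul_right
  set φ : ℕ → 𝓢(Eucl n, ℂ) := fun m => (hfc m).toSchwartzMap (hfs m) with hφ
  have hφf : ∀ m x, φ m x = f m x := fun m x => rfl
  have hφd : ∀ m j x, (∂_{unitVec j} (φ m)) x = ∫ y, D (ε m) j x y * ψ y ∂μ := fun m j x => by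
    rw [hDdef, ← fderiv_cutoff_potential hg hψi (hε0 m) hχ x j]
    rfl
  have hK0 : ∀ x y, K 0 x y = χ x * g (dist x y) := fun x y => by
    simp only [hKdef, hs0]
  refine ⟨hv.toLp _, φ, ?_, ?_, ?_⟩
  · filter_upwards [hv.coeFn_toLp] with x hx
    rw [hx]
    simp only [hK0]
  · refine tendsto_h1Norm_sub (w := fun j => (hw j).1.toLp _) ?_ fun j => ?_
    · refine (Lp.tendsto_Lp_iff_tendsto_eLpNorm'' _ (fun m => (φ m).memLp 2 volume) _ hv).2 ?_
      refine hvlim.congr fun m => ?_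
      congr 1
      ext x
      simp only [Pi.sub_apply, hφf, hfK]
    · refine (Lp.tendsto_Lp_iff_tendsto_eLpNorm'' _
        (fun m => (∂_{unitVec j} (φ m)).memLp 2 volume) _ (hw j).1).2 ?_
      refine (hw j).2.congr fun m => ?_
      congr 1
      ext x
      simp only [Pi.sub_apply, hφd]
  · refine hμlim.congr fun m => ?_
    congr 1
    ext x
    simp only [hφf, hfK, hK0]

end Limit

end DSetScattering

/-! ### Schur's test and identification of the operator. -/

namespace DSetScattering

variable {n : ℕ} {μ : Measure (Eucl n)}

theorem ENNReal_rpow_half_sq (a : ℝ≥0∞) : (a ^ (1 / 2 : ℝ)) ^ 2 = a := by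
  rw [← ENNReal.rpow_natCast, ← ENNReal.rpow_mul]
  norm_num

/-- Schur's test for a symmetric kernel. -/
theorem lintegral_schur_sq_le [SFinite μ] {k : Eucl n → Eucl n → ℝ≥0∞}
    (hk : Measurable (Function.uncurry k)) (hsymm : ∀ x y, k x y = k y x) {M : ℝ≥0∞}
    (hM : ∀ᵐ x ∂μ, ∫⁻ y, k x y ∂μ ≤ M) {f : Eucl n → ℝ≥0∞} (hf : Measurable f) :
    ∫⁻ x, (∫⁻ y, k x y * f y ∂μ) ^ 2 ∂μ ≤ M ^ 2 * ∫⁻ y, f y ^ 2 ∂μ := by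
  have hkx : ∀ x, Measurable fun y => k x y := fun x => hk.comp measurable_prodMk_left
  have hkf : Measurable fun p : Eucl n × Eucl n => k p.1 p.2 * f p.2 ^ 2 :=
    hk.mul ((hf.comp measurable_snd).pow_const 2)
  have h1 : ∀ᵐ x ∂μ, (∫⁻ y, k x y * f y ∂μ) ^ 2 ≤ M * ∫⁻ y, k x y * f y ^ 2 ∂μ := by
    filter_upwards [hM] with x hx
    -- Cauchy-Schwarz with half the kernel in each factor.
    have e : ∀ y, k x y * f y = k x y ^ (1 / 2 : ℝ) * (k x y ^ (1 / 2 : ℝ) * f y) := fun y => by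
      rw [← mul_assoc, ← sq, ENNReal_rpow_half_sq]
    simp only [e]
    refine (lintegral_mul_sq_le ((hkx x).pow_const _).aemeasurable
      (((hkx x).pow_const _).mul hf).aemeasurable).trans ?_
    simp only [Pi.mul_apply, mul_pow, ENNReal_rpow_half_sq]
    gcongr
  refine (lintegral_mono_ae h1).trans ?_
  rw [lintegral_const_mul _ (Measurable.lintegral_prod_right' hkf), sq, mul_assoc,
    lintegral_lintegral_swap hkf.aemeasurable]
  gcongr
  rw [← lintegral_const_mul _ (hf.pow_const 2)]
  refine lintegral_mono_ae ?_
  filter_upwards [hM] with y hy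
  have e : ∀ x, k x y = k y x := fun x => hsymm x y
  simp only [e]
  rw [lintegral_mul_const _ (hkx y)]
  gcongr

theorem exists_schur_operator [SFinite μ] {K : Eucl n → Eucl n → ℂ}
    (hK : StronglyMeasurable (Function.uncurry K)) (hsymm : ∀ x y, K x y = K y x) {M : ℝ}
    (hM0 : 0 ≤ M) (hM : ∀ᵐ x ∂μ, ∫⁻ y, ‖K x y‖ₑ ∂μ ≤ ENNReal.ofReal M) :
    ∃ T : Lp ℂ 2 μ →L[ℂ] Lp ℂ 2 μ, (∀ ψ : Lp ℂ 2 μ, T ψ =ᵐ[μ] fun x => ∫ y, K x y * ψ y ∂μ) ∧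
      ‖T‖ ≤ M := by
  have hb : ∀ ψ : Lp ℂ 2 μ, ∫⁻ x, (∫⁻ y, ‖K x y * ψ y‖ₑ ∂μ) ^ 2 ∂μ ≤
      ENNReal.ofReal M ^ 2 * ∫⁻ y, ‖ψ y‖ₑ ^ 2 ∂μ := fun ψ => by
    simp only [enorm_mul]
    exact lintegral_schur_sq_le hK.measurable.enorm (fun x y => by rw [hsymm]) hM
      (Lp.stronglyMeasurable ψ).measurable.enorm
  have hm : ∀ ψ : Lp ℂ 2 μ, StronglyMeasurable fun p : Eucl n × Eucl n => K p.1 p.2 * ψ p.2 :=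
    fun ψ => hK.mul ((Lp.stronglyMeasurable ψ).comp_measurable measurable_snd)
  -- Additivity of the Bochner integral needs absolute convergence for almost every `x`; finiteness
  -- of the squared Schur integral gives it.
  have hint : ∀ ψ : Lp ℂ 2 μ, ∀ᵐ x ∂μ, Integrable (fun y => K x y * ψ y) μ := fun ψ => by
    have hm2 : Measurable fun x => (∫⁻ y, ‖K x y * ψ y‖ₑ ∂μ) ^ 2 :=
      (Measurable.lintegral_prod_right (hm ψ).measurable.enorm).pow_const 2
    have hlt := (hb ψ).trans_lt (ENNReal.mul_lt_top (ENNReal.pow_lt_top ENNReal.ofReal_lt_top)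
      (lintegral_enorm_sq_ne_top (Lp.memLp ψ)).lt_top)
    filter_upwards [ae_lt_top hm2 hlt.ne] with x hx
    refine ⟨((hm ψ).comp_measurable measurable_prodMk_left).aestronglyMeasurable, ?_⟩
    by_contra hcon
    rw [HasFiniteIntegral, not_lt, top_le_iff] at hcon
    exact hx.ne (by rw [hcon, ENNReal.top_pow two_ne_zero])
  have hnorm : ∀ ψ : Lp ℂ 2 μ, eLpNorm (fun x => ∫ y, K x y * ψ y ∂μ) 2 μ ≤
      ENNReal.ofReal M * eLpNorm ψ 2 μ := fun ψ => by
    rw [← ENNReal.pow_le_pow_left_iff two_ne_zero, mul_pow, eLpNorm_two_sq, eLpNorm_two_sq]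
    refine le_trans (lintegral_mono fun x => ?_) (hb ψ)
    gcongr
    exact enorm_integral_le_lintegral_enorm _
  have hmem : ∀ ψ : Lp ℂ 2 μ, MemLp (fun x => ∫ y, K x y * ψ y ∂μ) 2 μ := fun ψ =>
    ⟨(hm ψ).integral_prod_right.aestronglyMeasurable, (hnorm ψ).trans_lt
      (ENNReal.mul_lt_top ENNReal.ofReal_lt_top (Lp.eLpNorm_lt_top ψ))⟩
  let L : Lp ℂ 2 μ →ₗ[ℂ] Lp ℂ 2 μ :=
    { toFun := fun ψ => (hmem ψ).toLp _
      map_add' := fun ψ ψ' => by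
        apply Lp.ext
        filter_upwards [(hmem (ψ + ψ')).coeFn_toLp, (hmem ψ).coeFn_toLp, (hmem ψ').coeFn_toLp,
          Lp.coeFn_add ((hmem ψ).toLp _) ((hmem ψ').toLp _), hint ψ, hint ψ'] with x a b c d e f
        rw [a, d, Pi.add_apply, b, c, ← integral_add e f]
        refine integral_congr_ae ?_
        filter_upwards [Lp.coeFn_add ψ ψ'] with y hy
        rw [hy, Pi.add_apply, mul_add]
      map_smul' := fun c ψ => by
        apply Lp.ext
        filter_upwards [(hmem (c • ψ)).coeFn_toLp, (hmem ψ).coeFn_toLp,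
          Lp.coeFn_smul c ((hmem ψ).toLp _)] with x a b d
        rw [a, RingHom.id_apply, d, Pi.smul_apply, b, smul_eq_mul, ← integral_const_mul]
        refine integral_congr_ae ?_
        filter_upwards [Lp.coeFn_smul c ψ] with y hy
        rw [hy, Pi.smul_apply, smul_eq_mul, mul_left_comm] }
  have hL : ∀ ψ, ‖L ψ‖ ≤ M * ‖ψ‖ := fun ψ => by
    change ‖(hmem ψ).toLp _‖ ≤ _
    rw [Lp.norm_toLp, Lp.norm_def, ← ENNReal.toReal_ofReal hM0, ← ENNReal.toReal_mul]
    exact ENNReal.toReal_mono (ENNReal.mul_ne_top ENNReal.ofReal_ne_top (Lp.eLpNorm_ne_top ψ))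
      (hnorm ψ)
  exact ⟨L.mkContinuous M hL, fun ψ => (hmem ψ).coeFn_toLp, L.mkContinuous_norm_le hM0 hL⟩

/-- The kernel of a potential, paired with a test function, is absolutely integrable. -/
theorem integrable_prod_kernel [NeZero n] [IsFiniteMeasure μ] {d a M : ℝ} {χ ψ f : Eucl n → ℂ}
    (hμ : UpperRegular d μ) (hd : 0 < d) (ha : 0 ≤ a) (had : 2 * a < d + n)
    (hχc : HasCompactSupport χ) (hψ : StronglyMeasurable ψ) (hψ2 : MemLp ψ 2 μ)
    {K : Eucl n → Eucl n → ℂ} (hK : StronglyMeasurable (Function.uncurry K)) (hM : 0 ≤ M)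
    (hKb : ∀ x y, x ≠ y → ‖K x y‖ ≤ M * dist x y ^ (-a))
    (hK0 : ∀ x y, x ∉ tsupport χ → K x y = 0) (hf : StronglyMeasurable f)
    (hf2 : MemLp f 2 volume) :
    Integrable (fun p : Eucl n × Eucl n => K p.1 p.2 * ψ p.2 * f p.1) (volume.prod μ) := by
  have hfin : IsFiniteMeasure (volume.restrict (tsupport χ)) :=
    ⟨by rw [Measure.restrict_apply_univ]; exact hχc.isCompact.measure_lt_top⟩
  have hν : UpperRegular (n : ℝ) (volume.restrict (tsupport χ)) :=
    volume_upperRegular.restrict _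
  have hn : (0 : ℝ) < n := by exact_mod_cast NeZero.pos n
  have h1 := lintegral_kernel_enorm_sq_lt_top hμ hν ha hd hn had hψ hψ2 hK hM hKb
  have hm : StronglyMeasurable fun p : Eucl n × Eucl n => K p.1 p.2 * ψ p.2 :=
    hK.mul (hψ.comp_measurable measurable_snd)
  have hm2 : StronglyMeasurable fun p : Eucl n × Eucl n => K p.1 p.2 * ψ p.2 * f p.1 :=
    hm.mul (hf.comp_measurable measurable_fst)
  set A : Eucl n → ℝ≥0∞ := fun x => ∫⁻ y, ‖K x y * ψ y‖ₑ ∂μ with hA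
  have hAm : Measurable A := Measurable.lintegral_prod_right hm.measurable.enorm
  have h2 : ∫⁻ x, A x ^ 2 < ⊤ := by
    have e : (fun x => A x ^ 2) = (tsupport χ).indicator (fun x => A x ^ 2) := by
      ext x
      by_cases hx : x ∈ tsupport χ
      · rw [indicator_of_mem hx]
      · rw [indicator_of_notMem hx, hA]
        simp [hK0 x _ hx]
    rw [e, lintegral_indicator (isClosed_tsupport χ).measurableSet]
    exact h1
  refine ⟨hm2.aestronglyMeasurable, ?_⟩
  rw [HasFiniteIntegral, lintegral_prod _ hm2.measurable.enorm.aemeasurable]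
  have e : ∀ x, ∫⁻ y, ‖K x y * ψ y * f x‖ₑ ∂μ = A x * ‖f x‖ₑ := fun x => by
    rw [hA, ← lintegral_mul_const' _ _ enorm_ne_top]
    simp only [enorm_mul]
  simp only [e]
  have h3 := lintegral_mul_sq_le hAm.aemeasurable (μ := volume) hf.measurable.enorm.aemeasurable
  have h4 := h3.trans_lt (ENNReal.mul_lt_top h2 (lintegral_enorm_sq_ne_top hf2).lt_top)
  exact (ENNReal.pow_lt_top_iff.1 h4).resolve_right two_ne_zero

theorem exists_dist_le_of_isCompact {s t : Set (Eucl n)} (hs : IsCompact s) (ht : IsCompact t) :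
    ∃ R : ℝ, 0 < R ∧ ∀ x ∈ s, ∀ y ∈ t, dist x y ≤ R := by
  obtain ⟨R, hR⟩ := (hs.union ht).isBounded.subset_closedBall 0
  refine ⟨max (2 * R) 1, by positivity, fun x hx y hy => ?_⟩
  have h1 := hR (Or.inl hx)
  have h2 := hR (Or.inr hy)
  rw [Metric.mem_closedBall] at h1 h2
  exact (dist_triangle_right x y 0).trans ((by linarith : _ ≤ 2 * R).trans (le_max_left _ _))

theorem IsCutoff.eq_one {Γ : Set (Eucl n)} {χ : Eucl n → ℂ} (hχ : IsCutoff Γ χ) {x : Eucl n}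
    (hx : x ∈ Γ) : χ x = 1 :=
  hχ.2.2.self_of_nhdsSet x hx

/-- The explicit potential `v` has trace `T ψ`, and Fubini identifies it as a distribution by moving
the kernel onto the test function. For the converse, the distributional identity determines `v`, and
`v` determines its trace. -/
theorem isAk_of_ae_eq (hn : 2 ≤ n) {d : ℝ} (hd : (n : ℝ) - 2 < d) (hdn : d ≤ n)
    {Γ : Set (Eucl n)} (hΓ : IsCompact Γ) (hΓd : IsDSet d Γ) {k : ℝ} (hk : 0 < k)
    {T : L2 d Γ →L[ℂ] L2 d Γ}
    (hT : ∀ ψ : L2 d Γ, T ψ =ᵐ[surf d Γ] fun x => ∫ y, fundSol k x y * ψ y ∂(surf d Γ)) :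
    IsAk d Γ k T := by
  have : NeZero n := ⟨by omega⟩
  have hn2 : (2 : ℝ) ≤ n := by exact_mod_cast hn
  have hd0 : 0 < d := by linarith
  have hfin : IsFiniteMeasure (surf d Γ) := ⟨surf_univ_lt_top hΓ hΓd⟩
  have hμ := surf_upperRegular hd0.le hΓ hΓd
  have hΓae : ∀ᵐ y ∂(surf d Γ), y ∈ Γ := ae_restrict_mem hΓ.measurableSet
  intro χ hχ ψ η
  obtain ⟨R, hR, hdist⟩ := exists_dist_le_of_isCompact hχ.2.1.isCompact hΓ
  obtain ⟨α, C, hα, hC, hαd, hαdn, hb⟩ :=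
    exists_radial_exponent hn hd hk (by positivity : 0 < R + 1)
  obtain ⟨g, C', hg, hgR⟩ := exists_isSingularProfile hα hC hR
    (fun r hr => contDiffAt_radial hn hk hr) hb
  -- On the support of `χ` the distance to `Γ` is at most `R`, where profile and kernel agree;
  -- elsewhere both sides vanish.
  have hgχ : ∀ x, ∀ y ∈ Γ, χ x * g (dist x y) = χ x * fundSol k x y := by
    intro x y hy
    by_cases hx : x ∈ tsupport χ
    · rw [hgR _ dist_nonneg (hdist x hx y hy), fundSol_eq_radial]
    · rw [image_eq_zero_of_notMem_tsupport hx, zero_mul, zero_mul]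
  have hψm := Lp.stronglyMeasurable ψ
  have hψ2 := Lp.memLp ψ
  obtain ⟨v, φ, hv, hφv, hφμ⟩ := exists_cutoff_potential hμ hd0 hg hαd hαdn hχ.1 hχ.2.1 hψm hψ2
  have htrace : HasTrace d Γ v (T ψ) := by
    refine ⟨φ, hφv, hφμ.congr fun m => eLpNorm_congr_ae ?_⟩
    filter_upwards [hT ψ, hΓae] with x hx hxΓ
    rw [hx]
    congr 1
    refine integral_congr_ae ?_
    filter_upwards [hΓae] with y hy
    rw [hgχ x y hy, hχ.eq_one hxΓ, one_mul]
  have hpot : IsCutoffPotential d Γ k χ ψ v := by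
    intro f
    obtain ⟨M₀, hM₀⟩ := hχ.2.1.exists_bound_of_continuous hχ.1.continuous
    have hM₀0 : 0 ≤ M₀ := (norm_nonneg _).trans (hM₀ 0)
    have hKm : StronglyMeasurable (Function.uncurry fun x y : Eucl n => χ x * g (dist x y)) := by
      have h := (hχ.1.continuous.comp continuous_fst).stronglyMeasurable.mul
        (hg.stronglyMeasurable_sub (n := n) 0)
      have e : (Function.uncurry fun x y : Eucl n => χ x * g (dist x y)) =
          fun p : Eucl n × Eucl n => χ p.1 * smoothKer g 0 (p.1 - p.2) := by
        ext p
        change χ p.1 * g (dist p.1 p.2) = _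
        rw [smoothKer, regNorm_zero, dist_eq_norm]
      rw [e]
      exact h
    have hint := integrable_prod_kernel (f := f) (a := α) (M := M₀ * C') hμ hd0 hα (by linarith)
      hχ.2.1 hψm hψ2 hKm (mul_nonneg hM₀0 hg.const_nonneg) (fun x y hxy => by
        rw [norm_mul, mul_assoc]
        exact mul_le_mul (hM₀ x) (hg.norm_le _ (dist_pos.2 hxy)) (norm_nonneg _) hM₀0)
      (fun x y hx => by rw [image_eq_zero_of_notMem_tsupport hx, zero_mul])
      f.continuous.stronglyMeasurable (f.memLp 2 volume)
    calc ∫ x, v x * f x = ∫ x, ∫ y, χ x * g (dist x y) * ψ y * f x ∂(surf d Γ) := by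
          refine integral_congr_ae ?_
          filter_upwards [hv] with x hx
          rw [hx, integral_mul_const]
      _ = ∫ y, (∫ x, χ x * g (dist x y) * ψ y * f x) ∂(surf d Γ) := integral_integral_swap hint
      _ = adjTrace d Γ ψ (newton k fun y => χ y * f y) := by
          rw [adjTrace]
          refine integral_congr_ae ?_
          filter_upwards [hΓae] with y hy
          rw [newton, ← integral_const_mul]
          refine integral_congr_ae (Eventually.of_forall fun x => ?_)
          change χ x * g (dist x y) * ψ y * f x = ψ y * (fundSol k y x * (χ x * f x))
          rw [hgχ x y hy, fundSol_eq_radial, fundSol_eq_radial, dist_comm]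
          ring
  constructor
  · rintro ⟨v', hv', htr'⟩
    have : v' = v := Lp.eq_of_integral_mul_schwartz_eq fun f => (hv' f).trans (hpot f).symm
    subst this
    exact htr'.unique hΓ hΓd hd0.le hd htrace
  · rintro rfl
    exact ⟨v, hpot, htrace⟩

end DSetScattering

/-! ### Bounds on the Schur integral. -/

namespace DSetScattering

variable {n : ℕ}

theorem measurable_radial_dist (hn : 2 ≤ n) {k : ℝ} (hk : 0 < k) :
    Measurable fun p : Eucl n × Eucl n => radial n k (dist p.1 p.2) := by
  have h1 : Measurable fun r : ℝ => radial n k |r| := by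
    refine measurable_of_continuousOn_compl_singleton 0 fun r hr => ?_
    have h0 : 0 < |r| := abs_pos.2 hr
    exact ((contDiffAt_radial hn hk h0).continuousAt.comp
      continuous_abs.continuousAt).continuousWithinAt
  have h2 : Measurable fun p : Eucl n × Eucl n => dist p.1 p.2 := by fun_prop
  simpa only [Function.comp_def, abs_of_nonneg dist_nonneg] using h1.comp h2

theorem exists_isAk_norm_le (hn : 2 ≤ n) {d : ℝ} (hd : (n : ℝ) - 2 < d) (hdn : d ≤ n)
    {Γ : Set (Eucl n)} (hΓ : IsCompact Γ) (hΓd : IsDSet d Γ) {k : ℝ} (hk : 0 < k) {M : ℝ}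
    (hM0 : 0 ≤ M) (hM : ∀ x ∈ Γ,
      ∫⁻ y, ‖radial n k (dist x y)‖ₑ ∂(surf d Γ) ≤ ENNReal.ofReal M) :
    ∃ T : L2 d Γ →L[ℂ] L2 d Γ, IsAk d Γ k T ∧ ‖T‖ ≤ M := by
  have hfin : IsFiniteMeasure (surf d Γ) := ⟨surf_univ_lt_top hΓ hΓd⟩
  obtain ⟨T, hT, hTM⟩ := exists_schur_operator (μ := surf d Γ)
    (K := fun x y => radial n k (dist x y)) (measurable_radial_dist hn hk).stronglyMeasurable
    (fun x y => by rw [dist_comm]) hM0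
    (by filter_upwards [ae_restrict_mem hΓ.measurableSet] with x hx using hM x hx)
  exact ⟨T, isAk_of_ae_eq hn hd hdn hΓ hΓd hk hT, hTM⟩

theorem enorm_radial_le {k a b r : ℝ} (hb : 0 ≤ b) (hr : 0 ≤ r)
    (h : 0 < r → ‖radial n k r‖ ≤ b * r ^ (-a)) :
    ‖radial n k r‖ₑ ≤ ENNReal.ofReal b * ENNReal.ofReal (r ^ (-a)) := by
  rcases hr.eq_or_lt with rfl | hr
  · rw [radial_zero, enorm_zero]; exact zero_le
  · rw [← ENNReal.ofReal_mul hb, ← ofReal_norm]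
    exact ENNReal.ofReal_le_ofReal (h hr)

theorem exists_isAk_norm_le_of_three_le (hn : 3 ≤ n) {d : ℝ} (hd : (n : ℝ) - 2 < d)
    (hdn : d ≤ n) {Γ : Set (Eucl n)} (hΓ : IsCompact Γ) (hΓd : IsDSet d Γ) {k₀ : ℝ}
    (hk₀ : 0 < k₀) : ∃ C₁ : ℝ, 0 < C₁ ∧ ∀ k : ℝ, k₀ ≤ k →
      ∃ T : L2 d Γ →L[ℂ] L2 d Γ, IsAk d Γ k T ∧ ‖T‖ ≤ C₁ * k ^ (((n : ℝ) - 3) / 2) := by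
  have hn3 : (3 : ℝ) ≤ n := by exact_mod_cast hn
  have hfin : IsFiniteMeasure (surf d Γ) := ⟨surf_univ_lt_top hΓ hΓd⟩
  have hμ := surf_upperRegular (by linarith) hΓ hΓd
  obtain ⟨R, hR, hdist⟩ := exists_dist_le_of_isCompact hΓ hΓ
  obtain ⟨B, hB, hrad⟩ := exists_norm_radial_le_of_three_le hn hk₀ hR
  obtain ⟨C, hC, hCx⟩ := hμ.exists_lintegral_le (a := (n : ℝ) - 2) (by linarith) hd
  -- The `+ 1` only secures positivity, as in the later constants.
  refine ⟨B * C + 1, by positivity, fun k hk => ?_⟩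
  have hk0 : 0 < k := hk₀.trans_le hk
  refine exists_isAk_norm_le (by omega) hd hdn hΓ hΓd hk0 (by positivity) fun x hx => ?_
  have hb : 0 ≤ B * k ^ (((n : ℝ) - 3) / 2) := by positivity
  calc ∫⁻ y, ‖radial n k (dist x y)‖ₑ ∂(surf d Γ)
      ≤ ∫⁻ y, ENNReal.ofReal (B * k ^ (((n : ℝ) - 3) / 2)) *
        ENNReal.ofReal (dist x y ^ (-((n : ℝ) - 2))) ∂(surf d Γ) := by
        refine lintegral_mono_ae ?_
        filter_upwards [ae_restrict_mem hΓ.measurableSet] with y hy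
        exact enorm_radial_le hb dist_nonneg fun hr => (hrad k _ hk hr (hdist x hx y hy)).1
    _ ≤ ENNReal.ofReal (B * k ^ (((n : ℝ) - 3) / 2)) * ENNReal.ofReal C := by
        rw [lintegral_const_mul' _ _ ENNReal.ofReal_ne_top]
        gcongr
        exact hCx x
    _ ≤ _ := by
        rw [← ENNReal.ofReal_mul hb]
        apply ENNReal.ofReal_le_ofReal
        have : 0 ≤ k ^ (((n : ℝ) - 3) / 2) := by positivity
        nlinarith

section Plane

variable {μ : Measure (Eucl 2)} {d : ℝ}

/-- The exponent `α = d/2` is admissible and integrable; it gives `k^(-d/2) (1/k)^(d/2) = k^(-d)`.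
-/
theorem UpperRegular.exists_lintegral_near_le [SFinite μ] (hμ : UpperRegular d μ) (hd : 0 < d)
    (hd1 : d ≤ 1 / 2) : ∃ C : ℝ, 0 ≤ C ∧ ∀ (k : ℝ) (x : Eucl 2), 0 < k →
      ∫⁻ y in {y | dist x y ≤ k⁻¹}, ‖radial 2 k (dist x y)‖ₑ ∂μ ≤ ENNReal.ofReal (C * k ^ (-d)) := by
  obtain ⟨B, hB, hrad⟩ := exists_norm_radial_two_le (α := d / 2) (by positivity) (by linarith)
  obtain ⟨C, hC, hCx⟩ := hμ.exists_lintegral_closedBall_le (a := d / 2) (by positivity)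
    (by linarith)
  refine ⟨B * C, by positivity, fun k x hk => ?_⟩
  have hb : 0 ≤ B * k ^ (-(d / 2)) := by positivity
  calc _ ≤ ∫⁻ y in {y | dist x y ≤ k⁻¹}, ENNReal.ofReal (B * k ^ (-(d / 2))) *
        ENNReal.ofReal (dist x y ^ (-(d / 2))) ∂μ := by
        refine lintegral_mono fun y => ?_
        exact enorm_radial_le hb dist_nonneg fun hr =>
          (hrad k _ hk hr).1.trans (by rw [mul_assoc])
    _ ≤ ENNReal.ofReal (B * k ^ (-(d / 2))) * ENNReal.ofReal (C * k⁻¹ ^ (d - d / 2)) := by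
        rw [lintegral_const_mul' _ _ ENNReal.ofReal_ne_top]
        gcongr
        exact hCx x _ (by positivity)
    _ = _ := by
        rw [← ENNReal.ofReal_mul hb, Real.inv_rpow hk.le, ← Real.rpow_neg hk.le]
        congr 1
        rw [show -d = -(d / 2) + -(d - d / 2) by ring, Real.rpow_add hk]
        ring

/-- Here the full decay `(k r)^(-1/2)` is used. The `s`-integral is left unevaluated, since its size
depends on whether `d` is below or equal to `1/2`. -/
theorem UpperRegular.exists_lintegral_far_le [SFinite μ] (hμ : UpperRegular d μ) :
    ∃ C : ℝ, 0 ≤ C ∧ ∀ (k R : ℝ) (x : Eucl 2), 0 < k → 0 < R →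
      ∫⁻ y in {y | k⁻¹ < dist x y ∧ dist x y ≤ R}, ‖radial 2 k (dist x y)‖ₑ ∂μ ≤
        ENNReal.ofReal (C * k ^ (-(1 / 2) : ℝ)) * (ENNReal.ofReal (R ^ (d - 1 / 2)) +
          ∫⁻ s in Ioc k⁻¹ R, ENNReal.ofReal (s ^ (d - 1 / 2 - 1))) := by
  obtain ⟨B, hB, hrad⟩ := exists_norm_radial_two_le (α := 1 / 2) (by positivity) le_rfl
  obtain ⟨C, hC, hμ⟩ := hμ
  refine ⟨B * C, by positivity, fun k R x hk hR => ?_⟩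
  have hb : 0 ≤ B * k ^ (-(1 / 2) : ℝ) := by positivity
  have hk' : 0 ≤ k ^ (-(1 / 2) : ℝ) := by positivity
  calc _ ≤ ∫⁻ y in {y | k⁻¹ < dist x y ∧ dist x y ≤ R}, ENNReal.ofReal (B * k ^ (-(1 / 2) : ℝ)) *
        ENNReal.ofReal (dist x y ^ (-(1 / 2) : ℝ)) ∂μ := by
        refine lintegral_mono fun y => ?_
        exact enorm_radial_le hb dist_nonneg fun hr =>
          (hrad k _ hk hr).1.trans (by rw [mul_assoc])
    _ ≤ ENNReal.ofReal (B * k ^ (-(1 / 2) : ℝ)) * (ENNReal.ofReal (C * R ^ (d - 1 / 2)) +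
        ENNReal.ofReal (1 / 2 * C) * ∫⁻ s in Ioc k⁻¹ R, ENNReal.ofReal (s ^ (d - 1 / 2 - 1))) := by
        rw [lintegral_const_mul' _ _ ENNReal.ofReal_ne_top]
        gcongr
        exact lintegral_annulus_rpow_neg_le hC (hμ x) (by norm_num) (by positivity) hR
    _ ≤ ENNReal.ofReal (B * k ^ (-(1 / 2) : ℝ)) * (ENNReal.ofReal (C * R ^ (d - 1 / 2)) +
        ENNReal.ofReal C * ∫⁻ s in Ioc k⁻¹ R, ENNReal.ofReal (s ^ (d - 1 / 2 - 1))) := by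
        gcongr
        linarith
    _ = _ := by
        rw [ENNReal.ofReal_mul hC, ← mul_add, ← mul_assoc, ← ENNReal.ofReal_mul hb]
        congr 2
        ring

theorem lintegral_le_near_add_far {f : Eucl 2 → ℝ≥0∞} {x : Eucl 2} {r R : ℝ}
    (hR : ∀ᵐ y ∂μ, dist x y ≤ R) :
    ∫⁻ y, f y ∂μ ≤ ∫⁻ y in {y | dist x y ≤ r}, f y ∂μ +
      ∫⁻ y in {y | r < dist x y ∧ dist x y ≤ R}, f y ∂μ := by
  have hm : MeasurableSet {y | dist x y ≤ r} := measurableSet_le (by fun_prop) measurable_const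
  rw [← lintegral_add_compl _ hm]
  gcongr 1
  refine le_of_eq (setLIntegral_congr ?_)
  filter_upwards [hR] with y hy
  apply propext
  change ¬ dist x y ≤ r ↔ r < dist x y ∧ dist x y ≤ R
  rw [not_le, and_iff_left hy]

end Plane

section PlaneOperator

variable {d : ℝ} {Γ : Set (Eucl 2)} {k₀ : ℝ}

/-- No splitting is needed: `r^(-1/2)` is integrable over `Γ` down to the diagonal. -/
theorem exists_isAk_norm_le_two_of_half_lt (hd : 1 / 2 < d) (hdn : d ≤ 2)
    (hΓ : IsCompact Γ) (hΓd : IsDSet d Γ) (hk₀ : 0 < k₀) :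
    ∃ C : ℝ, 0 < C ∧ ∀ k : ℝ, k₀ ≤ k →
      ∃ T : L2 d Γ →L[ℂ] L2 d Γ, IsAk d Γ k T ∧ ‖T‖ ≤ C * k ^ (-(1 / 2) : ℝ) := by
  have hfin : IsFiniteMeasure (surf d Γ) := ⟨surf_univ_lt_top hΓ hΓd⟩
  have hμ := surf_upperRegular (by linarith) hΓ hΓd
  obtain ⟨B, hB, hrad⟩ := exists_norm_radial_two_le (α := 1 / 2) (by positivity) le_rfl
  obtain ⟨C, hC, hCx⟩ := hμ.exists_lintegral_le (a := 1 / 2) (by norm_num) hd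
  refine ⟨B * C + 1, by positivity, fun k hk => ?_⟩
  have hk0 : 0 < k := hk₀.trans_le hk
  refine exists_isAk_norm_le le_rfl (by push_cast; linarith) (by push_cast; linarith) hΓ hΓd hk0
    (by positivity) fun x hx => ?_
  have hb : 0 ≤ B * k ^ (-(1 / 2) : ℝ) := by positivity
  calc ∫⁻ y, ‖radial 2 k (dist x y)‖ₑ ∂(surf d Γ)
      ≤ ∫⁻ y, ENNReal.ofReal (B * k ^ (-(1 / 2) : ℝ)) *
        ENNReal.ofReal (dist x y ^ (-(1 / 2) : ℝ)) ∂(surf d Γ) := by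
        refine lintegral_mono fun y => ?_
        exact enorm_radial_le hb dist_nonneg fun hr =>
          (hrad k _ hk0 hr).1.trans (by rw [mul_assoc])
    _ ≤ ENNReal.ofReal (B * k ^ (-(1 / 2) : ℝ)) * ENNReal.ofReal C := by
        rw [lintegral_const_mul' _ _ ENNReal.ofReal_ne_top]
        gcongr
        exact hCx x
    _ ≤ _ := by
        rw [← ENNReal.ofReal_mul hb]
        apply ENNReal.ofReal_le_ofReal
        have : 0 ≤ k ^ (-(1 / 2) : ℝ) := by positivity
        nlinarith

/-- The far integral is governed by its lower end `1/k` and has size `k^(1/2-d)`; times `k^(-1/2)`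
this matches the near part. -/
theorem exists_isAk_norm_le_two_of_lt_half (hd0 : 0 < d) (hd : d < 1 / 2)
    (hΓ : IsCompact Γ) (hΓd : IsDSet d Γ) (hk₀ : 0 < k₀) :
    ∃ C : ℝ, 0 < C ∧ ∀ k : ℝ, k₀ ≤ k →
      ∃ T : L2 d Γ →L[ℂ] L2 d Γ, IsAk d Γ k T ∧ ‖T‖ ≤ C * k ^ (-d) := by
  have hfin : IsFiniteMeasure (surf d Γ) := ⟨surf_univ_lt_top hΓ hΓd⟩
  have hμ := surf_upperRegular hd0.le hΓ hΓd
  obtain ⟨R₀, hR₀, hdist⟩ := exists_dist_le_of_isCompact hΓ hΓ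
  obtain ⟨C₁, hC₁, hnear⟩ := hμ.exists_lintegral_near_le hd0 hd.le
  obtain ⟨C₂, hC₂, hfar⟩ := hμ.exists_lintegral_far_le
  -- Enlarged so that `1/k ≤ R` for every `k ≥ k₀`.
  set R := max R₀ k₀⁻¹ with hRdef
  have hR : 0 < R := hR₀.trans_le (le_max_left _ _)
  set p := 1 / 2 - d with hp
  have hp0 : 0 < p := by rw [hp]; linarith
  refine ⟨C₁ + C₂ * (1 + 1 / p) + 1, by positivity, fun k hk => ?_⟩
  have hk0 : 0 < k := hk₀.trans_le hk
  have hkR : k⁻¹ ≤ R := (inv_anti₀ hk₀ hk).trans (le_max_right _ _)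
  refine exists_isAk_norm_le le_rfl (by push_cast; linarith) (by push_cast; linarith) hΓ hΓd hk0
    (by positivity) fun x hx => ?_
  refine (lintegral_le_near_add_far (x := x) (r := k⁻¹) (R := R) ?_).trans ?_
  · filter_upwards [ae_restrict_mem hΓ.measurableSet] with y hy
    exact (hdist x hx y hy).trans (le_max_left _ _)
  refine (add_le_add (hnear k x hk0) (hfar k R x hk0 hR)).trans ?_
  have e1 : d - 1 / 2 = -p := by rw [hp]; ring
  have e2 : (k⁻¹) ^ (-p) = k ^ p := by
    rw [Real.inv_rpow hk0.le, Real.rpow_neg hk0.le, inv_inv]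
  have e3 : k ^ (-(1 / 2) : ℝ) * k ^ p = k ^ (-d) := by
    rw [← Real.rpow_add hk0]; congr 1; rw [hp]; ring
  have i1 : R ^ (-p) ≤ k ^ p := by
    rw [← e2]
    exact Real.rpow_le_rpow_of_nonpos (by positivity) hkR (by linarith)
  have i2 := lintegral_Ioc_rpow_neg_sub_one_le hp0 (inv_pos.2 hk0) hkR
  rw [e2] at i2
  rw [e1]
  have hkd : 0 ≤ k ^ (-d) := by positivity
  calc _ ≤ ENNReal.ofReal (C₁ * k ^ (-d)) + ENNReal.ofReal (C₂ * k ^ (-(1 / 2) : ℝ)) *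
        (ENNReal.ofReal (k ^ p) + ENNReal.ofReal (k ^ p / p)) := by gcongr
    _ = ENNReal.ofReal (C₁ * k ^ (-d) + C₂ * k ^ (-(1 / 2) : ℝ) * (k ^ p + k ^ p / p)) := by
        rw [← ENNReal.ofReal_add (by positivity) (by positivity),
          ← ENNReal.ofReal_mul (by positivity), ← ENNReal.ofReal_add (by positivity)
            (by positivity)]
    _ ≤ _ := by
        apply ENNReal.ofReal_le_ofReal
        calc _ = (C₁ + C₂ * (1 + 1 / p)) * k ^ (-d) := by rw [← e3]; ring
          _ ≤ _ := mul_le_mul_of_nonneg_right (by linarith) hkd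

/-- All scales between `1/k` and `R` contribute equally, whence `log (R k)`. -/
theorem exists_isAk_norm_le_two_of_eq_half (hd : d = 1 / 2)
    (hΓ : IsCompact Γ) (hΓd : IsDSet d Γ) (hk₀ : 0 < k₀) :
    ∃ C : ℝ, 0 < C ∧ ∀ k : ℝ, k₀ ≤ k →
      ∃ T : L2 d Γ →L[ℂ] L2 d Γ, IsAk d Γ k T ∧
        ‖T‖ ≤ C * (k ^ (-(1 / 2) : ℝ) * Real.log (1 + k)) := by
  have hd0 : 0 < d := by rw [hd]; norm_num
  have hfin : IsFiniteMeasure (surf d Γ) := ⟨surf_univ_lt_top hΓ hΓd⟩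
  have hμ := surf_upperRegular hd0.le hΓ hΓd
  obtain ⟨R₀, hR₀, hdist⟩ := exists_dist_le_of_isCompact hΓ hΓ
  obtain ⟨C₁, hC₁, hnear⟩ := hμ.exists_lintegral_near_le hd0 hd.le
  obtain ⟨C₂, hC₂, hfar⟩ := hμ.exists_lintegral_far_le
  set R := max R₀ k₀⁻¹ with hRdef
  have hR : 0 < R := hR₀.trans_le (le_max_left _ _)
  set l := Real.log (1 + k₀) with hl
  have hl0 : 0 < l := Real.log_pos (by linarith)
  have hlR : 0 < Real.log (1 + R) := Real.log_pos (by linarith)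
  -- Terms without a logarithm are multiplied by `log (1 + k) / l ≥ 1`, which explains the divisions
  -- by `l`.
  refine ⟨C₁ / l + C₂ * (1 / l + (Real.log (1 + R) / l + 1)) + 1, by positivity, fun k hk => ?_⟩
  have hk0 : 0 < k := hk₀.trans_le hk
  have hkR : k⁻¹ ≤ R := (inv_anti₀ hk₀ hk).trans (le_max_right _ _)
  have hlk : l ≤ Real.log (1 + k) := Real.log_le_log (by linarith) (by linarith)
  set L := Real.log (1 + k) with hL
  have hL0 : 0 < L := hl0.trans_le hlk
  refine exists_isAk_norm_le le_rfl (by push_cast; linarith) (by push_cast; linarith) hΓ hΓd hk0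
    (by positivity) fun x hx => ?_
  refine (lintegral_le_near_add_far (x := x) (r := k⁻¹) (R := R) ?_).trans ?_
  · filter_upwards [ae_restrict_mem hΓ.measurableSet] with y hy
    exact (hdist x hx y hy).trans (le_max_left _ _)
  refine (add_le_add (hnear k x hk0) (hfar k R x hk0 hR)).trans ?_
  have i2 := lintegral_Ioc_inv (inv_pos.2 hk0) hkR
  have e1 : d - 1 / 2 = 0 := by rw [hd]; ring
  rw [e1, Real.rpow_zero, zero_sub, i2, div_inv_eq_mul, hd]
  have hRk : 1 ≤ R * k := by
    rw [← inv_mul_cancel₀ hk0.ne']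
    gcongr
  have hlog0 : 0 ≤ Real.log (R * k) := Real.log_nonneg hRk
  -- From `R k ≤ (1 + R)(1 + k)`.
  have hlog : Real.log (R * k) ≤ Real.log (1 + R) + L := by
    rw [hL, ← Real.log_mul (by positivity) (by positivity)]
    exact Real.log_le_log (by positivity) (by nlinarith)
  have hone : 1 ≤ L / l := (one_le_div hl0).2 hlk
  have hkn : 0 ≤ k ^ (-(1 / 2) : ℝ) := by positivity
  rw [← ENNReal.ofReal_add zero_le_one hlog0, ← ENNReal.ofReal_mul (by positivity),
    ← ENNReal.ofReal_add (by positivity) (by positivity)]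
  apply ENNReal.ofReal_le_ofReal
  calc C₁ * k ^ (-(1 / 2) : ℝ) + C₂ * k ^ (-(1 / 2) : ℝ) * (1 + Real.log (R * k))
      ≤ C₁ * k ^ (-(1 / 2) : ℝ) * (L / l) + C₂ * k ^ (-(1 / 2) : ℝ) *
        (L / l + (Real.log (1 + R) * (L / l) + L)) := by
        refine add_le_add (le_mul_of_one_le_right (by positivity) hone)
          (mul_le_mul_of_nonneg_left (add_le_add hone (hlog.trans ?_)) (by positivity))
        exact add_le_add_left (le_mul_of_one_le_right hlR.le hone) _
    _ = (C₁ / l + C₂ * (1 / l + (Real.log (1 + R) / l + 1))) * (k ^ (-(1 / 2) : ℝ) * L) := by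
        ring
    _ ≤ _ := mul_le_mul_of_nonneg_right (by linarith) (by positivity)

end PlaneOperator

end DSetScattering

theorem proposition5p2 (n : ℕ) (hn : 2 ≤ n) (d : ℝ) (hd : (n : ℝ) - 2 < d) (hdn : d ≤ n)
    (Γ : Set (EuclideanSpace ℝ (Fin n))) (hΓ : IsCompact Γ) (hΓd : DSetScattering.IsDSet d Γ)
    (k₀ : ℝ) (hk₀ : 0 < k₀) :
    (3 ≤ n → ∃ C₁ : ℝ, 0 < C₁ ∧ ∀ k : ℝ, k₀ ≤ k →
      ∃ T : DSetScattering.L2 d Γ →L[ℂ] DSetScattering.L2 d Γ, DSetScattering.IsAk d Γ k T ∧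
        ‖T‖ ≤ C₁ * k ^ (((n : ℝ) - 3) / 2)) ∧
    (n = 2 → ∃ C₂ : ℝ, 0 < C₂ ∧ ∀ k : ℝ, k₀ ≤ k →
      ∃ T : DSetScattering.L2 d Γ →L[ℂ] DSetScattering.L2 d Γ, DSetScattering.IsAk d Γ k T ∧
        ‖T‖ ≤ C₂ * (if d < 1 / 2 then k ^ (-d)
          else if d = 1 / 2 then k ^ (-(1 / 2) : ℝ) * Real.log (1 + k)
          else k ^ (-(1 / 2) : ℝ))) := by
  refine ⟨fun hn3 => DSetScattering.exists_isAk_norm_le_of_three_le hn3 hd hdn hΓ hΓd hk₀, ?_⟩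
  rintro rfl
  have hd0 : 0 < d := by simpa using hd
  split_ifs with h1 h2
  · exact DSetScattering.exists_isAk_norm_le_two_of_lt_half hd0 h1 hΓ hΓd hk₀
  · exact DSetScattering.exists_isAk_norm_le_two_of_eq_half h2 hΓ hΓd hk₀
  · exact DSetScattering.exists_isAk_norm_le_two_of_half_lt
      (lt_of_le_of_ne (not_lt.1 h1) (Ne.symm h2)) (by simpa using hdn) hΓ hΓd hk₀
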